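/- **Setting.** Let $d\ge 1$, let $\mathcal M_b$ be the space of bounded measurable functions $\mathbb R^d\to\mathbb R$ and $\|f\|_\infty=\sup|f|$. For $q\in\mathbb N\cup\{\infty\}$ let $\mathcal C^q_b$ (resp. $\mathcal C^q_1$) be the set of $f\in\mathcal C^q(\mathbb R^d)$ all of whose derivatives $\partial^\gamma f$, $|\gamma|\le q$, are bounded (resp. in $L^1$); $\|f\|_{r,\infty}=\sum_{|\gamma|\le r}\|\partial^\gamma f\|_\infty$ and $\|f\|_{r,1}=\sum_{|\gamma|\le r}\|\partial^\gamma f\|_{L^1}$. An *operator* is a linear map $A:\mathcal M_b\to\mathcal M_b$ of the form $Af(x)=\int f(y)A(x,dy)$ with $A(x,dy)$ a finite signed kernel (a difference of two finite kernels; e.g. a Markov kernel); $AB$ is the composition $f\mapsto A(Bf)$, and $A^*$ is the dual of $A$ for the $L^2(\mathbb R^d)$ scalar product. Let $T>0$, $n\in\mathbb N^*$, $\delta_n^l=T/n^l$, $\pi^\delta=\{k\delta:k\in\mathbb N\}$. All times below are in $[0,T]$. Let $P=(P_{s,t})_{0\le s\le t\le T}$ and, for every $l\in\mathbb N$, $Q^{\delta_n^l}=(Q^{\delta_n^l}_{s,t})_{s\le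 t\in\pi^{\delta_n^l}}$ be semigroups of operators ($A_{s,s}=\mathrm{Id}$, $A_{s,u}A_{u,t}=A_{s,t}$ for $s\le u\le t$). Let $\nu>0$, $\alpha>0$ be real, $\beta\in\mathbb N$, $\eta\ge0$, $\overline p\ge 0$, and, for $l\in\mathbb N$, $$m(l,\nu)=\Big\lceil\frac{\nu}{(1+\alpha)l+\alpha}\Big\rceil,\qquad q_i(l,\nu)=\nu+\lceil i-(1+\alpha)(l+1)(i-1)\rceil ,$$ $$\kappa(l,\nu)=\max\Big\{\beta\, m(l,\nu),\ \max_{1\le i\le m(l,\nu)-1} i\,\kappa(l+1,q_i(l,\nu))\Big\},\qquad q_\nu=\max_{1\le i\le m(0,\nu)} i\,\max\big(\beta,\kappa(1,q_i(0,\nu))\big),$$ $$l(\nu,\alpha)=\lceil\nu/\alpha\rceil,\qquad T(\nu)=\inf\Big\{t\in\pi^{\delta_n^1}:\ t\ge T\,\tfrac{n-m(0,\nu)}{n(m(0,\nu)+1)}\Big\}.$$ For $t\in\pi^{\delta_n^l}$ define recursively (the recursion terminates) $$\hat Q^{\nu,\delta_n^l}_{t,t+\delta_n^l}=Q^{\delta_n^{l+1}}_{t,t+\delta_n^l}+\sum_{i=1}^{m(l,\nu)-1}\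 \sum_{t=t_0<t_1<\dots<t_i\le t+\delta_n^l}\ \Big(\prod_{j=1}^i Q^{\delta_n^{l+1}}_{t_{j-1},t_j-\delta_n^{l+1}}\big(\hat Q^{q_i(l,\nu),\delta_n^{l+1}}_{t_j-\delta_n^{l+1},t_j}-Q^{\delta_n^{l+1}}_{t_j-\delta_n^{l+1},t_j}\big)\Big)Q^{\delta_n^{l+1}}_{t_i,t+\delta_n^l},$$ where $t_j-t\in\pi^{\delta_n^{l+1}}$ and the products are composed from left to right. Write $P_T=P_{0,T}$; note $\delta_n^0=T$. **Assumptions**, with constants $K_r$ ($r\in\mathbb N$) and $c$: 1. (Stability.) For every $r\in\mathbb N$, every $A\in\{P_{s,t}: s\le t\}\cup\{Q^{\delta_n^l}_{s,t}: l\in\mathbb N,\ s\le t\in\pi^{\delta_n^l}\}$: $f\in\mathcal C^r_b$ implies $Af\in\mathcal C_b^r$ and $\|Af\|_{r,\infty}\le K_r\|f\|_{r,\infty}$; $f\in\mathcal C_1^r$ implies $A^*f\in\mathcal C_1^r$ and $\|A^*f\|_{r,1}\le K_r\|f\|_{r,1}$. 2. (Short time.) For every $1\le l\le l(\nu,\alpha)$,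 $t\in\pi^{\delta_n^l}$ with $t+\delta_n^l\le T$ and $r\in\mathbb N$, writing $\delta=\delta^l_n$: $\|P_{t,t+\delta}f-Q^{\delta}_{t,t+\delta}f\|_{r,\infty}\le K_r\|f\|_{\beta+r,\infty}\,\delta^{\alpha+1}$ for $f\in\mathcal C_b^{\beta+r}$, and $\|P^*_{t,t+\delta}f-Q^{\delta,*}_{t,t+\delta}f\|_{r,1}\le K_r\|f\|_{\beta+r,1}\,\delta^{\alpha+1}$ for $f\in\mathcal C_1^{\beta+r}$. 3. (Regularizing modifications.) There are families of operators $\overline Q^{\delta_n^1}_{s,t}$ and $\overline P_{s,t}$, $s<t\in\pi^{\delta_n^1}$ (not necessarily semigroups), such that for $A=\overline Q^{\delta_n^1}$ and $A=\overline P$ property $R_{q_\nu,\eta}(A)$ holds: for all $s<t$ in $\pi^{\delta_n^1}$, $r\in\mathbb N$ and $|\gamma|+r\le q_\nu$, $f\in\mathcal C_b^\infty$, one has $A_{s,t}\partial^\gamma f\in\mathcal C_b^r$ and $\|A_{s,t}\partial^\gamma f\|_{r,\infty}\le c\,(t-s)^{-\eta}\|f\|_\infty$. Moreover, for all $s<t$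 in $\pi^{\delta_n^1}$ and $f\in\mathcal M_b$, $$\|Q^{\delta_n^1}_{s,t}f-\overline Q^{\delta_n^1}_{s,t}f\|_\infty+\|P_{s,t}f-\overline P_{s,t}f\|_\infty\le c\,\frac{1+T^{\overline p}}{n^{\nu+m(0,\nu)}}\,(t-s)^{-\eta}\,\|f\|_\infty .$$ **Conclusion.** There is $p\ge0$ depending only on $\nu,\alpha,\overline p$ such that, for every $T_0>0$, there is a constant $C$ depending only on $\nu,\alpha,\overline p,d,\beta,\eta,(K_r)_r,c$ and $T_0$ (thus not on $n$ nor on $f$, nor on $T\ge T_0$) such that, whenever the assumptions hold with $T\ge T_0$ and $n\ge1$, for every $f\in\mathcal M_b$, $$\|P_Tf-\hat Q^{\nu,\delta_n^0}_{0,T}f\|_\infty\ \le\ \frac{1}{n^\nu}\,\|f\|_\infty\,\frac{C(1+T^p)}{T(\nu)^\eta}.$$ (When $T(\nu)=0$, i.e. $n\le m(0,\nu)$, the right-hand side is read as $+\infty$ if $\eta>0$, and $0^0=1$ if $\eta=0$.) -/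

import Mathlib

open MeasureTheory ProbabilityTheory Finset Filter Topology

namespace WeakApprox

/-! ### Function spaces on `ℝ^d` -/

/-- The space `ℝ^d`. -/
abbrev E (d : ℕ) : Type := EuclideanSpace ℝ (Fin d)

/-- `M_b(ℝ^d)`: the vector space of bounded measurable functions `ℝ^d → ℝ`. -/
def Mb (d : ℕ) : Submodule ℝ (E d → ℝ) where
  carrier := {f | Measurable f ∧ ∃ c : ℝ, ∀ x, |f x| ≤ c}
  zero_mem' := ⟨measurable_const, 0, fun x => by simp⟩
  add_mem' := by
    rintro f g ⟨hf, a, ha⟩ ⟨hg, b, hb⟩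
    exact ⟨hf.add hg, a + b, fun x => (abs_add_le _ _).trans (add_le_add (ha x) (hb x))⟩
  smul_mem' := by
    rintro k f ⟨hf, a, ha⟩
    refine ⟨hf.const_smul k, |k| * a, fun x => ?_⟩
    simpa [abs_mul] using mul_le_mul_of_nonneg_left (ha x) (abs_nonneg k)

/-- Supremum norm `‖f‖_∞`; used only for bounded functions. -/
noncomputable def supNorm {d : ℕ} (f : E d → ℝ) : ℝ := ⨆ x, |f x|

/-- Partial derivative `∂_i f`. -/
noncomputable def pderiv {d : ℕ} (i : Fin d) (f : E d → ℝ) : E d → ℝ :=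
  fun x => fderiv ℝ f x (EuclideanSpace.single i 1)

/-- `∂^γ f = (∂_1)^{γ^1} ⋯ (∂_d)^{γ^d} f` for a multi-index `γ`. -/
noncomputable def mderiv {d : ℕ} (γ : Fin d → ℕ) (f : E d → ℝ) : E d → ℝ :=
  (List.finRange d).foldr (fun i g => (pderiv i)^[γ i] g) f

/-- Length `|γ| = γ^1 + ⋯ + γ^d` of a multi-index. -/
def mlen {d : ℕ} (γ : Fin d → ℕ) : ℕ := ∑ i, γ i

/-- The finite set of multi-indices with `|γ| ≤ r`. -/
def multiIdx (d r : ℕ) : Finset (Fin d → ℕ) :=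
  (Fintype.piFinset fun _ => Finset.range (r + 1)).filter fun γ => mlen γ ≤ r

/-- `f ∈ C_b^q(ℝ^d)`, `q ∈ ℕ ∪ {∞}`: `f` is of class `C^q` and its derivatives of order `≤ q`
(order `0` included) are bounded. -/
def IsCb {d : ℕ} (q : ℕ∞) (f : E d → ℝ) : Prop :=
  ContDiff ℝ (q : WithTop ℕ∞) f ∧
    ∀ γ : Fin d → ℕ, (mlen γ : ℕ∞) ≤ q → ∃ c : ℝ, ∀ x, |mderiv γ f x| ≤ c

/-- `f ∈ C_1^q(ℝ^d)`: `f` is of class `C^q` and its derivatives of order `≤ q`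
(order `0` included) are in `L^1`. -/
def IsC1 {d : ℕ} (q : ℕ∞) (f : E d → ℝ) : Prop :=
  ContDiff ℝ (q : WithTop ℕ∞) f ∧
    ∀ γ : Fin d → ℕ, (mlen γ : ℕ∞) ≤ q → Integrable (mderiv γ f)

/-- `‖f‖_{r,∞} = ∑_{|γ| ≤ r} ‖∂^γ f‖_∞`; used only for `f ∈ C_b^r`. -/
noncomputable def normInf {d : ℕ} (r : ℕ) (f : E d → ℝ) : ℝ :=
  ∑ γ ∈ multiIdx d r, supNorm (mderiv γ f)

/-- `‖f‖_{r,1} = ∑_{|γ| ≤ r} ‖∂^γ f‖_{L^1}`; used only for `f ∈ C_1^r`. -/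
noncomputable def normOne {d : ℕ} (r : ℕ) (f : E d → ℝ) : ℝ :=
  ∑ γ ∈ multiIdx d r, ∫ x, |mderiv γ f x|

theorem measurable_mderiv {d : ℕ} (γ : Fin d → ℕ) {f : E d → ℝ} (hf : Measurable f) :
    Measurable (mderiv γ f) := by
  have hit : ∀ (i : Fin d) (k : ℕ) (g : E d → ℝ), Measurable g →
      Measurable ((pderiv i)^[k] g) := by
    intro i k
    induction k with
    | zero => intro g hg; simpa using hg
    | succ k ih => intro g _; exact ih _ (measurable_fderiv_apply_const ℝ g _)
  unfold mderiv
  induction List.finRange d with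
  | nil => simpa using hf
  | cons a L ih => exact hit _ _ _ ih

/-- For `f ∈ C_b^∞`, the derivative `∂^γ f` as an element of `M_b`. -/
noncomputable def mderivMb {d : ℕ} (γ : Fin d → ℕ) (f : E d → ℝ) (hf : IsCb ⊤ f) : Mb d :=
  ⟨mderiv γ f, measurable_mderiv γ hf.1.continuous.measurable, hf.2 γ le_top⟩

/-! ### Functional operators -/

/-- Linear operators on `M_b(ℝ^d)`; the product `A * B` is the composition `f ↦ A (B f)`. -/
abbrev Op (d : ℕ) : Type := Module.End ℝ (Mb d)

/-- `A` is the integral operator of a finite signed kernel (a difference of two finite kernels).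
The operators `f ↦ 𝔼[f(X_t) | X_s = ·]` of a Markov process are of this form (with a Markov
kernel and the zero kernel). -/
def IsKernelOp {d : ℕ} (A : Op d) : Prop :=
  ∃ κ₁ κ₂ : Kernel (E d) (E d), IsFiniteKernel κ₁ ∧ IsFiniteKernel κ₂ ∧
    ∀ (f : Mb d) (x : E d), (A f).1 x = (∫ y, f.1 y ∂(κ₁ x)) - ∫ y, f.1 y ∂(κ₂ x)

/-- `(A_{s,t})`, `s ≤ t` in `S`, is a (time-inhomogeneous) semigroup of kernel operators. -/
structure IsSemigroupOn {d : ℕ} (S : Set ℝ) (A : ℝ → ℝ → Op d) : Prop where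
  kernel : ∀ s ∈ S, ∀ t ∈ S, s ≤ t → IsKernelOp (A s t)
  refl : ∀ s ∈ S, A s s = 1
  comp : ∀ s ∈ S, ∀ u ∈ S, ∀ t ∈ S, s ≤ u → u ≤ t → A s u * A u t = A s t

/-- `g = A^* f`, the dual for the `L^2(ℝ^d)` scalar product: `⟨A h, f⟩ = ⟨h, g⟩` for every
`h ∈ M_b`. It is used only for continuous `f, g ∈ L^1`, so that all integrals converge and `g` is
unique. -/
def IsDual {d : ℕ} (A : Op d) (f g : E d → ℝ) : Prop :=
  ∀ h : Mb d, ∫ x, (A h).1 x * f x = ∫ x, h.1 x * g x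

/-- `A` maps `C_b^r` to itself and `‖A f‖_{r,∞} ≤ K_r ‖f‖_{r,∞}`, for every `r`. -/
def Transport {d : ℕ} (K : ℕ → ℝ) (A : Op d) : Prop :=
  ∀ (r : ℕ) (f : Mb d), IsCb r (f : E d → ℝ) →
    IsCb r (A f : E d → ℝ) ∧ normInf r (A f : E d → ℝ) ≤ K r * normInf r (f : E d → ℝ)

/-- `A^*` maps `C_1^r` to itself and `‖A^* f‖_{r,1} ≤ K_r ‖f‖_{r,1}`, for every `r`. -/
def DualTransport {d : ℕ} (K : ℕ → ℝ) (A : Op d) : Prop :=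
  ∀ (r : ℕ) (f : E d → ℝ), IsC1 r f →
    ∃ g : E d → ℝ, IsDual A f g ∧ IsC1 r g ∧ normOne r g ≤ K r * normOne r f

/-- `‖A f - B f‖_{r,∞} ≤ K_r ‖f‖_{β+r,∞} δ^{α+1}` for every `r` and `f ∈ C_b^{β+r}`. -/
def ShortTime {d : ℕ} (K : ℕ → ℝ) (α : ℝ) (β : ℕ) (δ : ℝ) (A B : Op d) : Prop :=
  ∀ (r : ℕ) (f : Mb d), IsCb ((β + r : ℕ) : ℕ∞) (f : E d → ℝ) →
    normInf r (A f - B f : E d → ℝ) ≤ K r * normInf (β + r) (f : E d → ℝ) * δ ^ (α + 1)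

/-- `‖A^* f - B^* f‖_{r,1} ≤ K_r ‖f‖_{β+r,1} δ^{α+1}` for every `r` and `f ∈ C_1^{β+r}`. -/
def DualShortTime {d : ℕ} (K : ℕ → ℝ) (α : ℝ) (β : ℕ) (δ : ℝ) (A B : Op d) : Prop :=
  ∀ (r : ℕ) (f : E d → ℝ), IsC1 ((β + r : ℕ) : ℕ∞) f →
    ∃ g₁ g₂ : E d → ℝ, IsDual A f g₁ ∧ IsDual B f g₂ ∧ IsC1 r g₁ ∧ IsC1 r g₂ ∧
      normOne r (g₁ - g₂) ≤ K r * normOne (β + r) f * δ ^ (α + 1)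

/-- The regularization property `R_{q,η}` (with constant `c`) of a family of operators indexed by
`s < t` in `S`: `‖A_{s,t} ∂^γ f‖_{r,∞} ≤ c (t - s)^{-η} ‖f‖_∞` whenever `|γ| + r ≤ q` and
`f ∈ C_b^∞`. -/
def Regularizing {d : ℕ} (S : Set ℝ) (c : ℝ) (q : ℕ) (η : ℝ) (A : ℝ → ℝ → Op d) : Prop :=
  ∀ s ∈ S, ∀ t ∈ S, s < t → ∀ (r : ℕ) (γ : Fin d → ℕ), mlen γ + r ≤ q →
    ∀ (f : E d → ℝ) (hf : IsCb ⊤ f),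
      IsCb r (A s t (mderivMb γ f hf) : E d → ℝ) ∧
        normInf r (A s t (mderivMb γ f hf) : E d → ℝ) ≤ c / (t - s) ^ η * supNorm f

/-! ### The approximation of arbitrary order -/

/-- `δ_n^l = T / n^l`. -/
noncomputable def step (T : ℝ) (n l : ℕ) : ℝ := T / (n : ℝ) ^ l

/-- The points of the time grid `π^δ = {k δ : k ∈ ℕ}` up to the horizon `T`. -/
def grid (δ T : ℝ) : Set ℝ := {t | (∃ k : ℕ, t = k * δ) ∧ t ≤ T}

/-- `m(l,ν) = ⌈ν / ((1+α) l + α)⌉`. -/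
noncomputable def mOrd (α : ℝ) (l : ℕ) (ν : ℝ) : ℕ := ⌈ν / ((1 + α) * l + α)⌉₊

/-- `q_i(l,ν) = ν + ⌈i - (1+α)(l+1)(i-1)⌉`. -/
noncomputable def qOrd (α : ℝ) (l : ℕ) (ν : ℝ) (i : ℕ) : ℝ :=
  ν + (⌈(i : ℝ) - (1 + α) * (l + 1) * ((i : ℝ) - 1)⌉ : ℤ)

/-- The recursion `(l,ν) ↦ (l+1, q_i(l,ν))`, `1 ≤ i ≤ m(l,ν) - 1`, terminates. -/
theorem recursion_decreases {α : ℝ} (hα : 0 < α) (l : ℕ) (ν : ℝ)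
    (i : Fin (mOrd α l ν - 1)) :
    ⌈(qOrd α l ν (i + 1) - (1 + α) * ((l + 1 : ℕ) : ℝ) - α) / α⌉₊
      < ⌈(ν - (1 + α) * (l : ℝ) - α) / α⌉₊ := by
  have hm : 1 < mOrd α l ν := by have := i.2; omega
  have hden : 0 < (1 + α) * (l : ℝ) + α := by positivity
  have h1 : (1 : ℝ) < ν / ((1 + α) * l + α) := by
    unfold mOrd at hm
    simpa using Nat.lt_ceil.1 hm
  rw [lt_div_iff₀ hden] at h1
  have hq : qOrd α l ν (i + 1) ≤ ν + 1 := by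
    unfold qOrd
    have : (⌈((i + 1 : ℕ) : ℝ) - (1 + α) * (l + 1) * (((i + 1 : ℕ) : ℝ) - 1)⌉ : ℤ) ≤ 1 := by
      rw [Int.ceil_le]
      push_cast
      have : 0 ≤ ((i : ℕ) : ℝ) * (α * (l + 1) + l) := by positivity
      nlinarith
    have h2 : ((⌈((i + 1 : ℕ) : ℝ) - (1 + α) * (l + 1) * (((i + 1 : ℕ) : ℝ) - 1)⌉ : ℤ) : ℝ) ≤ 1 := by
      exact_mod_cast this
    linarith
  have hpos : 0 < (ν - (1 + α) * (l : ℝ) - α) / α := div_pos (by linarith) hα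
  have hle : (qOrd α l ν (i + 1) - (1 + α) * ((l + 1 : ℕ) : ℝ) - α) / α
      ≤ (ν - (1 + α) * (l : ℝ) - α) / α - 1 := by
    rw [div_sub_one hα.ne']
    refine div_le_div_of_nonneg_right ?_ hα.le
    push_cast
    linarith
  have hc : 0 < ⌈(ν - (1 + α) * (l : ℝ) - α) / α⌉₊ := Nat.ceil_pos.2 hpos
  have h3 : ⌈(qOrd α l ν (i + 1) - (1 + α) * ((l + 1 : ℕ) : ℝ) - α) / α⌉₊
      ≤ ⌈(ν - (1 + α) * (l : ℝ) - α) / α⌉₊ - 1 := by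
    rw [Nat.ceil_le, Nat.cast_sub hc]
    have := Nat.le_ceil ((ν - (1 + α) * (l : ℝ) - α) / α)
    rw [Nat.cast_one]
    linarith
  omega

/-- `κ(l,ν) = max {β m(l,ν), max_{1 ≤ i ≤ m(l,ν)-1} i κ(l+1, q_i(l,ν))}`. -/
noncomputable def kappa (α : ℝ) (hα : 0 < α) (β : ℕ) (l : ℕ) (ν : ℝ) : ℕ :=
  max (β * mOrd α l ν)
    (Finset.univ.sup fun i : Fin (mOrd α l ν - 1) =>
      ((i : ℕ) + 1) * kappa α hα β (l + 1) (qOrd α l ν (i + 1)))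
termination_by ⌈(ν - (1 + α) * (l : ℝ) - α) / α⌉₊
decreasing_by exact recursion_decreases hα l ν i

/-- `q_ν = max_{1 ≤ i ≤ m(0,ν)} i max(β, κ(1, q_i(0,ν)))`. -/
noncomputable def qReg (α : ℝ) (hα : 0 < α) (β : ℕ) (ν : ℝ) : ℕ :=
  (Finset.Icc 1 (mOrd α 0 ν)).sup fun i => i * max β (kappa α hα β 1 (qOrd α 0 ν i))

/-- The integer sequences `0 = u_0 < u_1 < ⋯ < u_i ≤ n`. -/
def chains (n i : ℕ) : Finset (Fin (i + 1) → Fin (n + 1)) :=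
  Finset.univ.filter fun u => u 0 = 0 ∧ StrictMono u

/-- The operator `Q̂^{ν,δ_n^l}_{t,t+δ_n^l}`, defined by recursion from the family `Q`
(`Q l s t` stands for `Q^{δ_n^l}_{s,t}`):
`Q̂^{ν,δ_n^l}_{t,t+δ_n^l} = Q^{δ_n^{l+1}}_{t,t+δ_n^l} + ∑_{i=1}^{m(l,ν)-1} ∑_{t = t_0 < ⋯ < t_i ≤ t+δ_n^l}`
`∏_{j=1}^{i} [Q^{δ_n^{l+1}}_{t_{j-1},t_j-δ_n^{l+1}}`
`(Q̂^{q_i(l,ν),δ_n^{l+1}}_{t_j-δ_n^{l+1},t_j} - Q^{δ_n^{l+1}}_{t_j-δ_n^{l+1},t_j})] Q^{δ_n^{l+1}}_{t_i,t+δ_n^l}`,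
the `t_j = t + u_j δ_n^{l+1}` being points of the grid of step `δ_n^{l+1}`, and the products being
composed from left to right. -/
noncomputable def Qhat {d : ℕ} (α : ℝ) (hα : 0 < α) (T : ℝ) (n : ℕ) (Q : ℕ → ℝ → ℝ → Op d)
    (l : ℕ) (ν : ℝ) (t : ℝ) : Op d :=
  Q (l + 1) t (t + step T n l) +
    ∑ i : Fin (mOrd α l ν - 1), ∑ u ∈ chains n ((i : ℕ) + 1),
      (List.ofFn fun j : Fin ((i : ℕ) + 1) =>
        Q (l + 1) (t + (u j.castSucc : ℕ) * step T n (l + 1))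
            (t + (u j.succ : ℕ) * step T n (l + 1) - step T n (l + 1)) *
          (Qhat α hα T n Q (l + 1) (qOrd α l ν (i + 1))
              (t + (u j.succ : ℕ) * step T n (l + 1) - step T n (l + 1)) -
            Q (l + 1) (t + (u j.succ : ℕ) * step T n (l + 1) - step T n (l + 1))
              (t + (u j.succ : ℕ) * step T n (l + 1)))).prod *
      Q (l + 1) (t + (u (Fin.last _) : ℕ) * step T n (l + 1)) (t + step T n l)
termination_by ⌈(ν - (1 + α) * (l : ℝ) - α) / α⌉₊
decreasing_by exact recursion_decreases hα l ν i

/-- `T(ν) = inf {t ∈ π^{δ_n^1} : t ≥ T (n - m(0,ν)) / (n (m(0,ν) + 1))}`. -/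
noncomputable def Tnu (α T : ℝ) (n : ℕ) (ν : ℝ) : ℝ :=
  sInf {t : ℝ | (∃ k : ℕ, t = k * step T n 1) ∧
    T * ((n : ℝ) - mOrd α 0 ν) / (n * ((mOrd α 0 ν : ℝ) + 1)) ≤ t}

end WeakApprox

open WeakApprox

/-! Put m = m(0,ν). Iterating the Duhamel (Lindeberg) formula m times writes P over a coarse step as
a sum over chains of jumps on the finer grid: long stretches of Q alternate with one-step
differences P - Q, and only the chains with exactly m jumps are closed by P (`lindeberg_expansion`).
Q̂ is this expansion cut before m jumps, with P in the one-step differences replaced by a finer Q̂.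
So P - Q̂ consists of differences of products, which telescope, and of the m-jump remainder
(`Scheme.sub_Qhat_eq`). Inside level l, one difference P - Q has order n^{-(1+α)(l+1)}, P - Q̂ has
order n^{-q_i} by induction, and there are O(n^i) chains with i jumps; m(l,ν) and q_i(l,ν) are
chosen so that every contribution is O(n^{-ν}). This is `factorBounds`. Each small factor costs
derivatives, and the total cost at level 0 is at most q_ν.

The derivatives are then removed. A chain with at most m jumps leaves a gap of at least ⌊n/(m+1)⌋
steps (`exists_gap`), and this gap has length T(ν) (`Tnu_eq`). In the gap the semigroup is replaced
by its regularizing modification. What stands to the left needs smoothness, which the modification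
supplies. What stands to the right loses derivatives, which L^1 duality converts into a ∂^γ placed
under the modification (`abs_apply_le_of_dual`, `opBound_smoothing_mul`). This is why both the
sup-norm and the dual L^1 estimates are carried along, in the predicate `Good`.

The replacement error is only measured on bounded functions, where the remaining factors gain
nothing and their sum is merely O(n^k). The gap is therefore cut into k + 1 pieces, so that the
replacement errors multiply and beat n^k (`regularized_mul_of_split`). Only one factor T(ν)^{-η} may
survive; the others are absorbed because T(ν) is bounded below when n > m and T ≥ T₀
(`exists_split`). If n ≤ m, then T(ν) = 0 and n is bounded, so a crude bound suffices. -/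

namespace WeakApprox

/-! ### Supremum norm -/

theorem supNorm_nonneg {d : ℕ} (f : E d → ℝ) : 0 ≤ supNorm f :=
  Real.iSup_nonneg fun _ => abs_nonneg _

theorem supNorm_le {d : ℕ} {f : E d → ℝ} {c : ℝ} (h : ∀ x, |f x| ≤ c) : supNorm f ≤ c :=
  ciSup_le h

theorem le_supNorm {d : ℕ} {f : E d → ℝ} (h : ∃ c, ∀ x, |f x| ≤ c) (x : E d) :
    |f x| ≤ supNorm f := by
  obtain ⟨c, hc⟩ := h
  exact le_ciSup (f := fun x => |f x|) ⟨c, by rintro _ ⟨y, rfl⟩; exact hc y⟩ x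

theorem abs_le_supNorm {d : ℕ} (f : Mb d) (x : E d) : |f.1 x| ≤ supNorm f.1 :=
  le_supNorm f.2.2 x

theorem supNorm_add_le {d : ℕ} (f g : Mb d) :
    supNorm (f + g : Mb d).1 ≤ supNorm f.1 + supNorm g.1 :=
  supNorm_le fun x => (abs_add_le _ _).trans (add_le_add (abs_le_supNorm f x) (abs_le_supNorm g x))

theorem supNorm_sub_le {d : ℕ} (f g : Mb d) :
    supNorm (f - g : Mb d).1 ≤ supNorm f.1 + supNorm g.1 :=
  supNorm_le fun x => (abs_sub _ _).trans (add_le_add (abs_le_supNorm f x) (abs_le_supNorm g x))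

/-! ### Iterated partial derivatives -/

theorem mem_multiIdx {d r : ℕ} {γ : Fin d → ℕ} : γ ∈ multiIdx d r ↔ mlen γ ≤ r := by
  unfold multiIdx
  simp only [mem_filter, Fintype.mem_piFinset, mem_range, and_iff_right_iff_imp]
  intro h i
  have : γ i ≤ mlen γ := Finset.single_le_sum (fun _ _ => Nat.zero_le _) (mem_univ i)
  omega

theorem multiIdx_mono {d r r' : ℕ} (h : r ≤ r') : multiIdx d r ⊆ multiIdx d r' := fun _ hγ =>
  mem_multiIdx.2 ((mem_multiIdx.1 hγ).trans h)

/-- A graded relation stable under partial derivatives is stable under `∂^γ`. -/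
theorem mderiv_induction {d : ℕ} {p : ℕ → (E d → ℝ) → (E d → ℝ) → (E d → ℝ) → Prop}
    (hp : ∀ m f g h i, p (m + 1) f g h → p m (pderiv i f) (pderiv i g) (pderiv i h))
    (γ : Fin d → ℕ) {m : ℕ} {f g h : E d → ℝ} (H : p (m + mlen γ) f g h) :
    p m (mderiv γ f) (mderiv γ g) (mderiv γ h) := by
  have hit : ∀ (i : Fin d) (k m : ℕ) (f g h : E d → ℝ), p (m + k) f g h →
      p m ((pderiv i)^[k] f) ((pderiv i)^[k] g) ((pderiv i)^[k] h) := by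
    intro i k
    induction k with
    | zero => intro m f g h H; exact H
    | succ k ih =>
      intro m f g h H
      exact ih m _ _ _ (hp _ _ _ _ i H)
  have key : ∀ (L : List (Fin d)) (m : ℕ), p (m + (L.map γ).sum) f g h →
      p m (L.foldr (fun i g => (pderiv i)^[γ i] g) f)
        (L.foldr (fun i g => (pderiv i)^[γ i] g) g)
        (L.foldr (fun i g => (pderiv i)^[γ i] g) h) := by
    intro L
    induction L with
    | nil => intro m H; simpa using H
    | cons a L ih =>
      intro m H
      refine hit a _ m _ _ _ (ih _ ?_)
      simpa [add_assoc] using H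
  refine key _ m ?_
  unfold mlen at H
  rwa [Fin.sum_univ_def] at H

theorem ContDiff.pderiv {d : ℕ} {m : ℕ} {f : E d → ℝ} (hf : ContDiff ℝ ((m + 1 : ℕ) : ℕ∞) f)
    (i : Fin d) : ContDiff ℝ (m : ℕ∞) (pderiv i f) := by
  unfold WeakApprox.pderiv
  refine ContDiff.clm_apply (hf.fderiv_right (m := ((m : ℕ∞) : WithTop ℕ∞)) ?_) contDiff_const
  norm_cast

theorem pderiv_add_smul {d : ℕ} (i : Fin d) (s : ℝ) {f g : E d → ℝ} (hf : Differentiable ℝ f)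
    (hg : Differentiable ℝ g) : pderiv i (f + s • g) = pderiv i f + s • pderiv i g := by
  funext x
  unfold pderiv
  rw [fderiv_add (hf x) ((hg x).const_smul s), fderiv_const_smul (hg x)]
  simp

theorem mderiv_add_smul {d : ℕ} {m : ℕ} (γ : Fin d → ℕ) (s : ℝ) {f g : E d → ℝ}
    (hf : ContDiff ℝ (m : ℕ∞) f) (hg : ContDiff ℝ (m : ℕ∞) g) (hγ : mlen γ ≤ m) :
    mderiv γ (f + s • g) = mderiv γ f + s • mderiv γ g := by
  refine (mderiv_induction (p := fun m f g h => ContDiff ℝ (m : ℕ∞) f ∧ ContDiff ℝ (m : ℕ∞) g ∧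
    h = f + s • g) ?_ γ (m := m - mlen γ) (f := f) (g := g) (h := f + s • g) ?_).2.2
  · rintro m f g h i ⟨hf, hg, rfl⟩
    refine ⟨ContDiff.pderiv hf i, ContDiff.pderiv hg i, pderiv_add_smul i s ?_ ?_⟩
    · exact hf.differentiable (by norm_cast)
    · exact hg.differentiable (by norm_cast)
  · rw [Nat.sub_add_cancel hγ]
    exact ⟨hf, hg, rfl⟩

theorem mderiv_zero_idx {d : ℕ} (f : E d → ℝ) : mderiv (fun _ => 0) f = f := by
  simp [mderiv]

theorem multiIdx_zero (d : ℕ) : multiIdx d 0 = {fun _ => 0} := by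
  ext γ
  rw [mem_multiIdx, mem_singleton]
  unfold mlen
  constructor
  · intro h
    funext i
    have : γ i ≤ ∑ j, γ j := Finset.single_le_sum (fun _ _ => Nat.zero_le _) (mem_univ i)
    omega
  · rintro rfl; simp

theorem normInf_zero {d : ℕ} (f : E d → ℝ) : normInf 0 f = supNorm f := by
  unfold normInf
  rw [multiIdx_zero, sum_singleton, mderiv_zero_idx]

theorem normOne_zero {d : ℕ} (f : E d → ℝ) : normOne 0 f = ∫ x, |f x| := by
  unfold normOne
  rw [multiIdx_zero, sum_singleton, mderiv_zero_idx]

/-! ### The spaces `C_b^r` and `C_1^r` -/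

theorem IsCb.of_le {d : ℕ} {q r : ℕ∞} {f : E d → ℝ} (h : IsCb q f) (hr : r ≤ q) : IsCb r f :=
  ⟨h.1.of_le (by exact_mod_cast hr), fun γ hγ => h.2 γ (hγ.trans hr)⟩

theorem IsC1.of_le {d : ℕ} {q r : ℕ∞} {f : E d → ℝ} (h : IsC1 q f) (hr : r ≤ q) : IsC1 r f :=
  ⟨h.1.of_le (by exact_mod_cast hr), fun γ hγ => h.2 γ (hγ.trans hr)⟩

theorem IsC1.integrable {d : ℕ} {q : ℕ∞} {f : E d → ℝ} (h : IsC1 q f) : Integrable f := by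
  have := h.2 (fun _ => 0) (by simp [mlen])
  rwa [mderiv_zero_idx] at this

theorem IsCb.add_smul {d r : ℕ} (s : ℝ) {f g : E d → ℝ} (hf : IsCb (r : ℕ∞) f)
    (hg : IsCb (r : ℕ∞) g) : IsCb (r : ℕ∞) (f + s • g) := by
  refine ⟨hf.1.add (hg.1.const_smul s), fun γ hγ => ?_⟩
  obtain ⟨a, ha⟩ := hf.2 γ hγ
  obtain ⟨b, hb⟩ := hg.2 γ hγ
  refine ⟨a + |s| * b, fun x => ?_⟩
  rw [mderiv_add_smul γ s hf.1 hg.1 (by exact_mod_cast hγ)]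
  simp only [Pi.add_apply, Pi.smul_apply, smul_eq_mul]
  refine (abs_add_le _ _).trans (add_le_add (ha x) ?_)
  rw [abs_mul]
  exact mul_le_mul_of_nonneg_left (hb x) (abs_nonneg s)

theorem IsC1.add_smul {d r : ℕ} (s : ℝ) {f g : E d → ℝ} (hf : IsC1 (r : ℕ∞) f)
    (hg : IsC1 (r : ℕ∞) g) : IsC1 (r : ℕ∞) (f + s • g) := by
  refine ⟨hf.1.add (hg.1.const_smul s), fun γ hγ => ?_⟩
  rw [mderiv_add_smul γ s hf.1 hg.1 (by exact_mod_cast hγ)]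
  exact (hf.2 γ hγ).add ((hg.2 γ hγ).smul s)

theorem normInf_add_smul_le {d r : ℕ} (s : ℝ) {f g : E d → ℝ} (hf : IsCb (r : ℕ∞) f)
    (hg : IsCb (r : ℕ∞) g) : normInf r (f + s • g) ≤ normInf r f + |s| * normInf r g := by
  unfold normInf
  rw [mul_sum, ← sum_add_distrib]
  refine sum_le_sum fun γ hγ => ?_
  have hγ' := mem_multiIdx.1 hγ
  rw [mderiv_add_smul γ s hf.1 hg.1 hγ']
  refine supNorm_le fun x => ?_
  simp only [Pi.add_apply, Pi.smul_apply, smul_eq_mul]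
  refine (abs_add_le _ _).trans (add_le_add (le_supNorm (hf.2 γ (by exact_mod_cast hγ')) x) ?_)
  rw [abs_mul]
  exact mul_le_mul_of_nonneg_left (le_supNorm (hg.2 γ (by exact_mod_cast hγ')) x) (abs_nonneg s)

theorem normOne_add_smul_le {d r : ℕ} (s : ℝ) {f g : E d → ℝ} (hf : IsC1 (r : ℕ∞) f)
    (hg : IsC1 (r : ℕ∞) g) : normOne r (f + s • g) ≤ normOne r f + |s| * normOne r g := by
  unfold normOne
  rw [mul_sum, ← sum_add_distrib]
  refine sum_le_sum fun γ hγ => ?_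
  have hγ' := mem_multiIdx.1 hγ
  have hfi := (hf.2 γ (by exact_mod_cast hγ')).abs
  have hgi := (hg.2 γ (by exact_mod_cast hγ')).abs
  rw [mderiv_add_smul γ s hf.1 hg.1 hγ', ← integral_const_mul,
    ← integral_add hfi (hgi.const_mul _)]
  refine integral_mono_of_nonneg (Eventually.of_forall fun x => abs_nonneg _)
    (hfi.add (hgi.const_mul _)) (Eventually.of_forall fun x => ?_)
  simp only [Pi.add_apply, Pi.smul_apply, smul_eq_mul]
  refine (abs_add_le _ _).trans (add_le_add le_rfl ?_)
  rw [abs_mul]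

theorem normInf_nonneg {d : ℕ} (r : ℕ) (f : E d → ℝ) : 0 ≤ normInf r f :=
  sum_nonneg fun _ _ => supNorm_nonneg _

theorem normOne_nonneg {d : ℕ} (r : ℕ) (f : E d → ℝ) : 0 ≤ normOne r f :=
  sum_nonneg fun _ _ => integral_nonneg fun _ => abs_nonneg _

theorem normInf_mono {d r r' : ℕ} (h : r ≤ r') (f : E d → ℝ) : normInf r f ≤ normInf r' f :=
  sum_le_sum_of_subset_of_nonneg (multiIdx_mono h) fun _ _ _ => supNorm_nonneg _

theorem normOne_mono {d r r' : ℕ} (h : r ≤ r') (f : E d → ℝ) : normOne r f ≤ normOne r' f :=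
  sum_le_sum_of_subset_of_nonneg (multiIdx_mono h) fun _ _ _ =>
    integral_nonneg fun _ => abs_nonneg _

theorem supNorm_le_normInf {d : ℕ} (r : ℕ) (f : E d → ℝ) : supNorm f ≤ normInf r f := by
  rw [← normInf_zero]; exact normInf_mono (Nat.zero_le r) f

/-! ### Kernel operators -/

theorem integrable_Mb {d : ℕ} (f : Mb d) (μ : Measure (E d)) [IsFiniteMeasure μ] :
    Integrable f.1 μ :=
  Integrable.of_bound f.2.1.aestronglyMeasurable (supNorm f.1)
    (Eventually.of_forall fun x => abs_le_supNorm f x)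

theorem IsKernelOp.one {d : ℕ} : IsKernelOp (1 : Op d) := by
  refine ⟨Kernel.id, 0, inferInstance, inferInstance, fun f x => ?_⟩
  simp [Kernel.id_apply, integral_dirac' _ _ f.2.1.stronglyMeasurable]

theorem IsKernelOp.zero {d : ℕ} : IsKernelOp (0 : Op d) :=
  ⟨0, 0, inferInstance, inferInstance, fun f x => by simp⟩

theorem IsKernelOp.add {d : ℕ} {A B : Op d} (hA : IsKernelOp A) (hB : IsKernelOp B) :
    IsKernelOp (A + B) := by
  obtain ⟨a₁, a₂, _, _, ha⟩ := hA
  obtain ⟨b₁, b₂, _, _, hb⟩ := hB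
  refine ⟨a₁ + b₁, a₂ + b₂, inferInstance, inferInstance, fun f x => ?_⟩
  rw [show (a₁ + b₁) x = a₁ x + b₁ x from rfl, show (a₂ + b₂) x = a₂ x + b₂ x from rfl, integral_add_measure (integrable_Mb f _) (integrable_Mb f _),
    integral_add_measure (integrable_Mb f _) (integrable_Mb f _)]
  change (A f).1 x + (B f).1 x = _
  rw [ha, hb]; ring

theorem IsKernelOp.sub {d : ℕ} {A B : Op d} (hA : IsKernelOp A) (hB : IsKernelOp B) :
    IsKernelOp (A - B) := by
  obtain ⟨a₁, a₂, _, _, ha⟩ := hA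
  obtain ⟨b₁, b₂, _, _, hb⟩ := hB
  refine ⟨a₁ + b₂, a₂ + b₁, inferInstance, inferInstance, fun f x => ?_⟩
  rw [show (a₁ + b₂) x = a₁ x + b₂ x from rfl, show (a₂ + b₁) x = a₂ x + b₁ x from rfl,
    integral_add_measure (integrable_Mb f _) (integrable_Mb f _),
    integral_add_measure (integrable_Mb f _) (integrable_Mb f _)]
  change (A f).1 x - (B f).1 x = _
  rw [ha, hb]; ring

/-- Kernel composition runs against operator composition: (AB)f(x) integrates f against b(y,dz) and
then against a(x,dy). Products of like signs form the positive part, products of opposite signs the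
negative part. -/
theorem IsKernelOp.mul {d : ℕ} {A B : Op d} (hA : IsKernelOp A) (hB : IsKernelOp B) :
    IsKernelOp (A * B) := by
  obtain ⟨a₁, a₂, _, _, ha⟩ := hA
  obtain ⟨b₁, b₂, _, _, hb⟩ := hB
  have hint : ∀ (κ η : Kernel (E d) (E d)) [IsFiniteKernel κ] [IsFiniteKernel η] (f : Mb d)
      (x : E d), Integrable (fun y => ∫ z, f.1 z ∂(κ y)) (η x) := by
    intro κ η _ _ f x
    exact (integrable_Mb f ((κ ∘ₖ η) x)).integral_comp
  have hcomp : ∀ (κ η : Kernel (E d) (E d)) [IsFiniteKernel κ] [IsFiniteKernel η] (f : Mb d)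
      (x : E d), ∫ z, f.1 z ∂((κ ∘ₖ η) x) = ∫ y, ∫ z, f.1 z ∂(κ y) ∂(η x) := by
    intro κ η _ _ f x
    exact Kernel.integral_comp (integrable_Mb f _)
  refine ⟨b₁ ∘ₖ a₁ + b₂ ∘ₖ a₂, b₂ ∘ₖ a₁ + b₁ ∘ₖ a₂, inferInstance, inferInstance, fun f x => ?_⟩
  rw [show (b₁ ∘ₖ a₁ + b₂ ∘ₖ a₂) x = (b₁ ∘ₖ a₁) x + (b₂ ∘ₖ a₂) x from rfl,
    show (b₂ ∘ₖ a₁ + b₁ ∘ₖ a₂) x = (b₂ ∘ₖ a₁) x + (b₁ ∘ₖ a₂) x from rfl, integral_add_measure (integrable_Mb f _) (integrable_Mb f _),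
    integral_add_measure (integrable_Mb f _) (integrable_Mb f _), hcomp, hcomp, hcomp, hcomp]
  change (A (B f)).1 x = _
  rw [ha]
  simp only [hb]
  rw [integral_sub (hint b₁ a₁ f x) (hint b₂ a₁ f x),
    integral_sub (hint b₁ a₂ f x) (hint b₂ a₂ f x)]
  ring

/-! ### Mollification -/

/-- Smooth functions with compact support. -/
def IsTest {d : ℕ} (ψ : E d → ℝ) : Prop :=
  ContDiff ℝ ((⊤ : ℕ∞) : WithTop ℕ∞) ψ ∧ HasCompactSupport ψ

/-- The convolution `y ↦ ∫ g(z) ψ(y - z) dz`. -/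
noncomputable def mollify {d : ℕ} (ψ g : E d → ℝ) : E d → ℝ := fun y => ∫ z, g z * ψ (y - z)

/-- The function `z ↦ ∫ ψ(y - z) μ(dy)`. -/
noncomputable def mollifyMeasure {d : ℕ} {F : Type} [NormedAddCommGroup F] [NormedSpace ℝ F]
    (μ : Measure (E d)) (ψ : E d → F) : E d → F := fun z => ∫ y, ψ (y - z) ∂μ

theorem IsTest.pderiv {d : ℕ} {ψ : E d → ℝ} (h : IsTest ψ) (i : Fin d) : IsTest (pderiv i ψ) := by
  refine ⟨?_, h.2.fderiv_apply ℝ _⟩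
  unfold WeakApprox.pderiv
  refine ContDiff.clm_apply (h.1.fderiv_right (m := ((⊤ : ℕ∞) : WithTop ℕ∞)) ?_) contDiff_const
  exact le_rfl

theorem IsTest.mderiv {d : ℕ} {ψ : E d → ℝ} (h : IsTest ψ) (γ : Fin d → ℕ) :
    IsTest (mderiv γ ψ) :=
  mderiv_induction (p := fun _ f _ _ => IsTest f) (fun _ _ _ _ i h => h.pderiv i) γ
    (m := 0) (g := ψ) (h := ψ) h

theorem IsTest.integrable {d : ℕ} {ψ : E d → ℝ} (h : IsTest ψ) : Integrable ψ :=
  h.1.continuous.integrable_of_hasCompactSupport h.2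

theorem mollify_eq_convolution {d : ℕ} (ψ g : E d → ℝ) :
    mollify ψ g = convolution g ψ (ContinuousLinearMap.mul ℝ ℝ) volume := rfl

theorem locallyIntegrable_Mb {d : ℕ} (g : Mb d) : LocallyIntegrable g.1 := by
  refine (locallyIntegrable_const (supNorm g.1)).mono g.2.1.aestronglyMeasurable
    (Eventually.of_forall fun x => ?_)
  rw [Real.norm_eq_abs, Real.norm_eq_abs, abs_of_nonneg (supNorm_nonneg _)]
  exact abs_le_supNorm g x

theorem contDiff_mollify {d : ℕ} {ψ : E d → ℝ} (h : IsTest ψ) (g : Mb d) :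
    ContDiff ℝ ((⊤ : ℕ∞) : WithTop ℕ∞) (mollify ψ g.1) := by
  rw [mollify_eq_convolution]
  exact h.2.contDiff_convolution_right _ (locallyIntegrable_Mb g) h.1

theorem pderiv_mollify {d : ℕ} {ψ : E d → ℝ} (h : IsTest ψ) (g : Mb d) (i : Fin d) :
    pderiv i (mollify ψ g.1) = mollify (pderiv i ψ) g.1 := by
  funext x
  unfold pderiv
  rw [mollify_eq_convolution]
  have h1 : ContDiff ℝ 1 ψ := h.1.of_le (by exact_mod_cast le_top)
  rw [(h.2.hasFDerivAt_convolution_right (ContinuousLinearMap.mul ℝ ℝ)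
    (locallyIntegrable_Mb g) h1 x).fderiv,
    convolution_precompR_apply _ (locallyIntegrable_Mb g) (h.2.fderiv ℝ)
      (h1.continuous_fderiv one_ne_zero)]
  rfl

theorem mderiv_mollify {d : ℕ} {ψ : E d → ℝ} (h : IsTest ψ) (g : Mb d) (γ : Fin d → ℕ) :
    mderiv γ (mollify ψ g.1) = mollify (mderiv γ ψ) g.1 :=
  (mderiv_induction (p := fun _ f k _ => IsTest f ∧ k = mollify f g.1)
    (fun _ _ _ _ i h => ⟨h.1.pderiv i, by rw [h.2, pderiv_mollify h.1]⟩) γ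
    (m := 0) (f := ψ) (g := mollify ψ g.1) (h := ψ) ⟨h, rfl⟩).2

theorem abs_mollify_le {d : ℕ} {ψ : E d → ℝ} (h : IsTest ψ) {g : E d → ℝ} {c : ℝ}
    (hg : ∀ x, |g x| ≤ c) (y : E d) : |mollify ψ g y| ≤ c * ∫ z, |ψ z| := by
  unfold mollify
  have hi : Integrable (fun z => |ψ (y - z)|) := (h.integrable.comp_sub_left y).abs
  calc |∫ z, g z * ψ (y - z)| ≤ ∫ z, |g z * ψ (y - z)| := abs_integral_le_integral_abs
    _ ≤ ∫ z, c * |ψ (y - z)| := by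
        refine integral_mono_of_nonneg (Eventually.of_forall fun _ => abs_nonneg _)
          (hi.const_mul c) (Eventually.of_forall fun z => ?_)
        simp only [abs_mul]
        exact mul_le_mul_of_nonneg_right (hg z) (abs_nonneg _)
    _ = c * ∫ z, |ψ z| := by
        rw [integral_const_mul, integral_sub_left_eq_self (fun z => |ψ z|)]

theorem isCb_mollify {d : ℕ} {ψ : E d → ℝ} (h : IsTest ψ) (g : Mb d) :
    IsCb ⊤ (mollify ψ g.1) := by
  refine ⟨contDiff_mollify h g, fun γ _ => ⟨supNorm g.1 * ∫ z, |mderiv γ ψ z|, fun x => ?_⟩⟩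
  rw [mderiv_mollify h]
  exact abs_mollify_le (h.mderiv γ) (abs_le_supNorm g) x

/-- Normalized bumps with shrinking supports. Unit mass makes mollification a contraction of the sup
norm; pointwise convergence is enough, since it is only used under finite measures with a uniform
bound. -/
theorem exists_mollifier (d : ℕ) : ∃ ψ : ℕ → E d → ℝ, (∀ k, IsTest (ψ k) ∧ ∫ z, |ψ k z| = 1) ∧
    ∀ g : E d → ℝ, Continuous g → ∀ y, Tendsto (fun k => mollify (ψ k) g y) atTop (𝓝 (g y)) := by
  let φ : ℕ → ContDiffBump (0 : E d) := fun k =>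
    ⟨1 / (2 * ((k : ℝ) + 1)), 1 / ((k : ℝ) + 1), by positivity, by
      apply one_div_lt_one_div_of_lt <;> [positivity; linarith [k.cast_nonneg (α := ℝ)]]⟩
  refine ⟨fun k => (φ k).normed volume, fun k => ⟨⟨(φ k).contDiff_normed,
    (φ k).hasCompactSupport_normed⟩, ?_⟩, fun g hg y => ?_⟩
  · simp_rw [abs_of_nonneg ((φ k).nonneg_normed _)]
    exact (φ k).integral_normed
  · have := ContDiffBump.convolution_tendsto_right_of_continuous (φ := φ) (μ := volume) (l := atTop)
      tendsto_one_div_add_atTop_nhds_zero_nat hg y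
    refine this.congr fun k => ?_
    rw [convolution_lsmul_swap]
    simp only [smul_eq_mul, mollify, mul_comm]

/-! ### Mollification of measures -/

theorem integrable_translate {d : ℕ} {F : Type} [NormedAddCommGroup F]
    (μ : Measure (E d)) [IsFiniteMeasure μ] {ψ : E d → F} (h : Continuous ψ) (hc : HasCompactSupport ψ)
    (z : E d) : Integrable (fun y => ψ (y - z)) μ := by
  obtain ⟨C, hC⟩ := h.bounded_above_of_compact_support hc
  refine Integrable.of_bound ?_ C (Eventually.of_forall fun y => hC _)
  exact ((h.stronglyMeasurable_of_hasCompactSupport hc).comp_measurable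
    (measurable_id.sub_const z)).aestronglyMeasurable

/-- Differentiation under a finite measure, dominated by the maximum of the compactly supported
derivative. The sign comes from differentiating ψ(y - z) in z. -/
theorem hasFDerivAt_mollifyMeasure {d : ℕ} {F : Type} [NormedAddCommGroup F] [NormedSpace ℝ F]
    (μ : Measure (E d)) [IsFiniteMeasure μ] {ψ : E d → F} (h : ContDiff ℝ 1 ψ) (hc : HasCompactSupport ψ)
    (z : E d) : HasFDerivAt (mollifyMeasure μ ψ) (-mollifyMeasure μ (fderiv ℝ ψ) z) z := by
  have h' : Continuous (fderiv ℝ ψ) := h.continuous_fderiv one_ne_zero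
  have hc' := hc.fderiv ℝ
  obtain ⟨C, hC⟩ := h'.bounded_above_of_compact_support hc'
  have := hasFDerivAt_integral_of_dominated_of_fderiv_le (𝕜 := ℝ) (μ := μ) (x₀ := z)
    (F := fun z y => ψ (y - z)) (F' := fun z y => -fderiv ℝ ψ (y - z)) (s := Set.univ)
    (bound := fun _ => C) Filter.univ_mem
    (Eventually.of_forall fun x => (integrable_translate μ h.continuous hc x).aestronglyMeasurable)
    (integrable_translate μ h.continuous hc z)
    (integrable_translate μ h' hc' z).neg.aestronglyMeasurable
    (Eventually.of_forall fun y x _ => by rw [norm_neg]; exact hC _) (integrable_const C)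
    (Eventually.of_forall fun y x _ => by
      have h1 : HasFDerivAt ψ (fderiv ℝ ψ (y - x)) (y - x) :=
        (h.differentiable one_ne_zero (y - x)).hasFDerivAt
      have h2 : HasFDerivAt (fun x : E d => y - x) (-(ContinuousLinearMap.id ℝ (E d))) x :=
        (hasFDerivAt_id x).const_sub y
      have h3 : HasFDerivAt (fun x => ψ (y - x)) _ x := h1.comp x h2
      simpa using h3)
  rw [integral_neg] at this
  exact this

/-- The target space is quantified inside the induction because the derivative of ψ takes values in
a space of linear maps. -/
theorem contDiff_mollifyMeasure_nat {d : ℕ} (μ : Measure (E d)) [IsFiniteMeasure μ] (n : ℕ) :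
    ∀ {F : Type} [NormedAddCommGroup F] [NormedSpace ℝ F] {ψ : E d → F},
      ContDiff ℝ ((⊤ : ℕ∞) : WithTop ℕ∞) ψ → HasCompactSupport ψ →
      ContDiff ℝ n (mollifyMeasure μ ψ) := by
  induction n with
  | zero =>
    intro F _ _ ψ h hc
    have h1 : ContDiff ℝ 1 ψ := h.of_le (by exact_mod_cast le_top)
    refine contDiff_zero.2 (Differentiable.continuous (𝕜 := ℝ) fun z => ?_)
    exact (hasFDerivAt_mollifyMeasure μ h1 hc z).differentiableAt
  | succ n ih =>
    intro F _ _ ψ h hc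
    have h1 : ContDiff ℝ 1 ψ := h.of_le (by exact_mod_cast le_top)
    have key : fderiv ℝ (mollifyMeasure μ ψ) = -mollifyMeasure μ (fderiv ℝ ψ) := by
      funext z
      exact (hasFDerivAt_mollifyMeasure μ h1 hc z).fderiv
    push_cast
    rw [contDiff_succ_iff_fderiv]
    refine ⟨fun z => (hasFDerivAt_mollifyMeasure μ h1 hc z).differentiableAt, by simp, ?_⟩
    rw [key]
    refine (ih (h.fderiv_right (m := ((⊤ : ℕ∞) : WithTop ℕ∞)) le_rfl) (hc.fderiv ℝ)).neg

theorem contDiff_mollifyMeasure {d : ℕ} (μ : Measure (E d)) [IsFiniteMeasure μ] {ψ : E d → ℝ}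
    (h : IsTest ψ) : ContDiff ℝ ((⊤ : ℕ∞) : WithTop ℕ∞) (mollifyMeasure μ ψ) :=
  contDiff_infty.2 fun n => contDiff_mollifyMeasure_nat μ n h.1 h.2

theorem pderiv_mollifyMeasure {d : ℕ} (μ : Measure (E d)) [IsFiniteMeasure μ] {ψ : E d → ℝ}
    (h : IsTest ψ) (i : Fin d) :
    pderiv i (mollifyMeasure μ ψ) = -mollifyMeasure μ (pderiv i ψ) := by
  have h1 : ContDiff ℝ 1 ψ := h.1.of_le (by exact_mod_cast le_top)
  funext z
  unfold pderiv
  rw [(hasFDerivAt_mollifyMeasure μ h1 h.2 z).fderiv, neg_apply]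
  unfold mollifyMeasure
  rw [ContinuousLinearMap.integral_apply
    (integrable_translate μ (h1.continuous_fderiv one_ne_zero) (h.2.fderiv ℝ) z)]
  rfl

/-- The sign is (-1)^{|γ|}; only its modulus matters for the L^1 norms. -/
theorem mderiv_mollifyMeasure_sub {d : ℕ} (μ ν : Measure (E d)) [IsFiniteMeasure μ]
    [IsFiniteMeasure ν] {ψ : E d → ℝ} (h : IsTest ψ) (γ : Fin d → ℕ) :
    ∃ s : ℝ, |s| = 1 ∧ mderiv γ (mollifyMeasure μ ψ - mollifyMeasure ν ψ) =
      s • (mollifyMeasure μ (mderiv γ ψ) - mollifyMeasure ν (mderiv γ ψ)) := by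
  refine (mderiv_induction (p := fun _ f k _ => IsTest f ∧ ∃ s : ℝ, |s| = 1 ∧
    k = s • (mollifyMeasure μ f - mollifyMeasure ν f)) ?_ γ (m := 0) (f := ψ)
    (g := mollifyMeasure μ ψ - mollifyMeasure ν ψ) (h := ψ) ⟨h, 1, by simp⟩).2
  rintro m f _ - i ⟨hf, s, hs, rfl⟩
  refine ⟨hf.pderiv i, -s, by simpa using hs, ?_⟩
  have hdμ := (contDiff_mollifyMeasure μ hf).differentiable (by simp)
  have hdν := (contDiff_mollifyMeasure ν hf).differentiable (by simp)
  have e1 : s • (mollifyMeasure μ f - mollifyMeasure ν f)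
      = (s • mollifyMeasure μ f) + (-s) • mollifyMeasure ν f := by
    funext x; simp; ring
  have e2 : s • mollifyMeasure μ f = (fun _ => (0 : ℝ)) + s • mollifyMeasure μ f := by
    funext x; simp
  rw [e1, pderiv_add_smul i (-s) (hdμ.const_smul s) hdν, e2,
    pderiv_add_smul i s (differentiable_const 0) hdμ, pderiv_mollifyMeasure μ hf,
    pderiv_mollifyMeasure ν hf]
  funext x
  simp [pderiv]
  ring

theorem integrable_prod_translate {d : ℕ} (μ : Measure (E d)) [IsFiniteMeasure μ] {ψ : E d → ℝ}
    (h : IsTest ψ) : Integrable (fun p : E d × E d => ψ (p.1 - p.2)) (μ.prod volume) := by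
  have hm : Measurable fun p : E d × E d => ψ (p.1 - p.2) :=
    h.1.continuous.measurable.comp (measurable_fst.sub measurable_snd)
  rw [integrable_prod_iff hm.aestronglyMeasurable]
  refine ⟨Eventually.of_forall fun y => h.integrable.comp_sub_left y, ?_⟩
  simp only
  have : (fun y : E d => ∫ z, ‖ψ (y - z)‖) = fun _ => ∫ z, ‖ψ z‖ := by
    funext y
    exact integral_sub_left_eq_self (fun z => ‖ψ z‖) volume y
  rw [this]
  exact integrable_const _

theorem integrable_mollifyMeasure {d : ℕ} (μ : Measure (E d)) [IsFiniteMeasure μ] {ψ : E d → ℝ}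
    (h : IsTest ψ) : Integrable (mollifyMeasure μ ψ) :=
  (integrable_prod_translate μ h).integral_prod_right

/-- Fubini: the mollified measure is the density of the functional that mollifies a function and
then integrates it against μ. -/
theorem integral_mul_mollifyMeasure {d : ℕ} (μ : Measure (E d)) [IsFiniteMeasure μ]
    {ψ : E d → ℝ} (h : IsTest ψ) (g : Mb d) :
    ∫ z, g.1 z * mollifyMeasure μ ψ z = ∫ y, mollify ψ g.1 y ∂μ := by
  unfold mollifyMeasure mollify
  simp_rw [← integral_const_mul]
  refine (integral_integral_swap ?_).symm
  have := (integrable_prod_translate μ h).bdd_mul (f := fun p : E d × E d => g.1 p.2)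
    (c := supNorm g.1) (g.2.1.comp measurable_snd).aestronglyMeasurable
    (Eventually.of_forall fun p => abs_le_supNorm g p.2)
  exact this

/-! ### Operator bounds on bounded measurable functions -/

/-- `‖A f‖_∞ ≤ b ‖f‖_∞` for every bounded measurable `f`. -/
def OpBound {d : ℕ} (b : ℝ) (A : Op d) : Prop :=
  ∀ f : Mb d, supNorm (A f).1 ≤ b * supNorm f.1

theorem tendsto_integral_mollify {d : ℕ} {ψ : ℕ → E d → ℝ}
    (h1 : ∀ k, IsTest (ψ k) ∧ ∫ z, |ψ k z| = 1)
    (h2 : ∀ g : E d → ℝ, Continuous g → ∀ y,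
      Tendsto (fun k => mollify (ψ k) g y) atTop (𝓝 (g y)))
    (μ : Measure (E d)) [IsFiniteMeasure μ] (f : Mb d) (hf : Continuous f.1) :
    Tendsto (fun k => ∫ y, mollify (ψ k) f.1 y ∂μ) atTop (𝓝 (∫ y, f.1 y ∂μ)) := by
  refine tendsto_integral_of_dominated_convergence (fun _ => supNorm f.1)
    (fun k => (contDiff_mollify (h1 k).1 f).continuous.aestronglyMeasurable)
    (integrable_const _) (fun k => Eventually.of_forall fun y => ?_)
    (Eventually.of_forall fun y => h2 f.1 hf y)
  have := abs_mollify_le (h1 k).1 (abs_le_supNorm f) y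
  rwa [(h1 k).2, mul_one] at this

/-- The convolution of a bounded measurable function with a test function, in `M_b`. -/
noncomputable def mollifyMb {d : ℕ} {ψ : E d → ℝ} (h : IsTest ψ) (f : Mb d) : Mb d :=
  ⟨mollify ψ f.1, (contDiff_mollify h f).continuous.measurable, _, abs_mollify_le h (abs_le_supNorm f)⟩

theorem supNorm_mollifyMb_le {d : ℕ} {ψ : E d → ℝ} (h : IsTest ψ) (h1 : ∫ z, |ψ z| = 1) (f : Mb d) :
    supNorm (mollifyMb h f).1 ≤ supNorm f.1 := by
  refine supNorm_le fun x => ?_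
  have := abs_mollify_le h (abs_le_supNorm f) x
  rwa [h1, mul_one] at this

/-- A bound of a kernel operator on `C_b^∞` extends to bounded measurable functions. -/
theorem opBound_of_smooth {d : ℕ} {A : Op d} (hA : IsKernelOp A) {b : ℝ} (hb : 0 ≤ b)
    (h : ∀ f : Mb d, IsCb ⊤ f.1 → ∀ x, |(A f).1 x| ≤ b * supNorm f.1) : OpBound b A := by
  obtain ⟨κ₁, κ₂, _, _, hκ⟩ := hA
  obtain ⟨ψ, h1, h2⟩ := exists_mollifier d
  -- From smooth to continuous functions: mollify and pass to the limit by dominated convergence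
  -- under the two finite measures at x.
  have hcont : ∀ f : Mb d, Continuous f.1 → ∀ x, |(A f).1 x| ≤ b * supNorm f.1 := by
    intro f hf x
    have hlim : Tendsto (fun k => |(A (mollifyMb (h1 k).1 f)).1 x|) atTop (𝓝 |(A f).1 x|) := by
      simp_rw [hκ]
      exact ((tendsto_integral_mollify h1 h2 (κ₁ x) f hf).sub
        (tendsto_integral_mollify h1 h2 (κ₂ x) f hf)).abs
    refine le_of_tendsto hlim (Eventually.of_forall fun k => ?_)
    exact (h _ (isCb_mollify (h1 k).1 f) x).trans
      (mul_le_mul_of_nonneg_left (supNorm_mollifyMb_le _ (h1 k).2 f) hb)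
  intro f
  refine supNorm_le fun x => le_of_forall_pos_le_add fun ε hε => ?_
  -- From continuous to measurable functions: approximate f in L^1 of the total mass of the kernel
  -- at x, which controls both parts at once.
  set μ := κ₁ x + κ₂ x with hμ
  obtain ⟨g, hg, hgi⟩ := (integrable_Mb f μ).exists_boundedContinuous_integral_sub_le hε
  set S := supNorm f.1 with hS
  have hS0 : 0 ≤ S := supNorm_nonneg _
  -- Truncating the approximation at ‖f‖_∞ keeps its sup norm below that of f and does not increase
  -- its distance to f.
  let k : E d → ℝ := fun y => max (-S) (min S (g y))
  have hkc : Continuous k := continuous_const.max (continuous_const.min g.continuous)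
  have hkb : ∀ y, |k y| ≤ S := fun y =>
    abs_le.2 ⟨le_max_left _ _, max_le (by linarith) (min_le_left _ _)⟩
  let kM : Mb d := ⟨k, hkc.measurable, S, hkb⟩
  have hdist : ∀ y, |(f - kM : Mb d).1 y| ≤ ‖f.1 y - g y‖ := by
    intro y
    change |f.1 y - max (-S) (min S (g y))| ≤ |f.1 y - g y|
    have hf := abs_le.1 (abs_le_supNorm f y)
    rcases le_total S (g y) with h3 | h3
    · rw [min_eq_left h3, max_eq_right (by linarith), abs_of_nonpos (by linarith [hf.2]),
        abs_of_nonpos (by linarith [hf.2])]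
      linarith
    · rw [min_eq_right h3]
      rcases le_total (-S) (g y) with h4 | h4
      · rw [max_eq_right h4]
      · rw [max_eq_left h4, abs_of_nonneg (by linarith [hf.1]), abs_of_nonneg (by linarith [hf.1])]
        linarith
  have hsplit : (A f).1 x = (A kM).1 x + (A (f - kM)).1 x := by
    rw [map_sub]
    change (A f).1 x = (A kM).1 x + ((A f).1 x - (A kM).1 x)
    ring
  have hI := (integrable_Mb (f - kM) μ).abs
  have hI1 := (integrable_Mb (f - kM) (κ₁ x)).abs
  have hI2 := (integrable_Mb (f - kM) (κ₂ x)).abs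
  have hsmall : |(A (f - kM)).1 x| ≤ ε := by
    rw [hκ]
    calc _ ≤ |∫ y, (f - kM).1 y ∂κ₁ x| + |∫ y, (f - kM).1 y ∂κ₂ x| := abs_sub _ _
      _ ≤ (∫ y, |(f - kM).1 y| ∂κ₁ x) + ∫ y, |(f - kM).1 y| ∂κ₂ x :=
        add_le_add abs_integral_le_integral_abs abs_integral_le_integral_abs
      _ = ∫ y, |(f - kM).1 y| ∂μ := (integral_add_measure hI1 hI2).symm
      _ ≤ ∫ y, ‖f.1 y - g y‖ ∂μ :=
        integral_mono hI ((integrable_Mb f μ).sub hgi).norm hdist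
      _ ≤ ε := hg
  rw [hsplit]
  refine (abs_add_le _ _).trans (add_le_add ((hcont kM hkc x).trans ?_) hsmall)
  exact mul_le_mul_of_nonneg_left (supNorm_le hkb) hb

/-- If `B ∂^γ` is bounded for `|γ| ≤ q`, then `B g` is controlled by the norm of `g` as a functional
on `C_1^q`. -/
theorem abs_apply_le_of_dual {d : ℕ} {B : Op d} (hB : IsKernelOp B) {M : ℝ} (hM0 : 0 ≤ M) {q : ℕ}
    (hM : ∀ γ : Fin d → ℕ, mlen γ ≤ q → ∀ (f : E d → ℝ) (hf : IsCb ⊤ f) (x : E d),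
      |(B (mderivMb γ f hf)).1 x| ≤ M * supNorm f)
    {g : Mb d} (hg : Continuous g.1) {e : ℝ} (he : 0 ≤ e)
    (hd : ∀ φ : E d → ℝ, IsC1 (q : ℕ∞) φ → |∫ z, g.1 z * φ z| ≤ e * normOne q φ) (x : E d) :
    |(B g).1 x| ≤ (multiIdx d q).card * M * e := by
  obtain ⟨κ₁, κ₂, _, _, hκ⟩ := hB
  obtain ⟨ψ, h1, h2⟩ := exists_mollifier d
  have hlim : Tendsto (fun k => |(B (mollifyMb (h1 k).1 g)).1 x|) atTop (𝓝 |(B g).1 x|) := by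
    simp_rw [hκ]
    exact ((tendsto_integral_mollify h1 h2 (κ₁ x) g hg).sub
      (tendsto_integral_mollify h1 h2 (κ₂ x) g hg)).abs
  refine le_of_tendsto hlim (Eventually.of_forall fun k => ?_)
  obtain ⟨hψ, hψ1⟩ := h1 k
  -- This is the density of the functional u ↦ B(u * ψ_k)(x). The hypothesis on B ∂^γ becomes a
  -- bound of its L^1 derivatives, so it may be tested against g through `hd`.
  set φ := mollifyMeasure (κ₁ x) (ψ k) - mollifyMeasure (κ₂ x) (ψ k) with hφ
  have hpair : ∀ (χ : E d → ℝ) (hχ : IsTest χ) (u : Mb d),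
      ∫ z, u.1 z * (mollifyMeasure (κ₁ x) χ - mollifyMeasure (κ₂ x) χ) z
        = (B (mollifyMb hχ u)).1 x := by
    intro χ hχ u
    have hi : ∀ (ρ : Measure (E d)) [IsFiniteMeasure ρ],
        Integrable (fun z => u.1 z * mollifyMeasure ρ χ z) := fun ρ _ =>
      (integrable_mollifyMeasure ρ hχ).bdd_mul (c := supNorm u.1) u.2.1.aestronglyMeasurable
        (Eventually.of_forall fun z => abs_le_supNorm u z)
    simp only [Pi.sub_apply, mul_sub]
    rw [integral_sub (hi _) (hi _), integral_mul_mollifyMeasure _ hχ,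
      integral_mul_mollifyMeasure _ hχ, hκ]
    rfl
  have hL1 : ∀ γ : Fin d → ℕ, mlen γ ≤ q →
      Integrable (mderiv γ φ) ∧ ∫ z, |mderiv γ φ z| ≤ M := by
    intro γ hγ
    obtain ⟨s, hs, hsφ⟩ := mderiv_mollifyMeasure_sub (κ₁ x) (κ₂ x) hψ γ
    have hχ := hψ.mderiv γ
    set χ := mderiv γ (ψ k) with hχdef
    set G := mollifyMeasure (κ₁ x) χ - mollifyMeasure (κ₂ x) χ with hG
    have hGi : Integrable G :=
      (integrable_mollifyMeasure _ hχ).sub (integrable_mollifyMeasure _ hχ)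
    have hGc : Continuous G :=
      (contDiff_mollifyMeasure _ hχ).continuous.sub (contDiff_mollifyMeasure _ hχ).continuous
    rw [hsφ]
    refine ⟨hGi.smul s, ?_⟩
    have hsgn : ∀ z, |if 0 ≤ G z then (1 : ℝ) else -1| ≤ 1 := fun z => by split_ifs <;> simp
    -- The L^1 norm is attained by pairing with the sign. Moving ∂^γ from ψ_k onto the mollified
    -- sign gives a smooth function of sup norm at most 1, to which `hM` applies.
    let u : Mb d := ⟨fun z => if 0 ≤ G z then 1 else -1,
      Measurable.ite (measurableSet_le measurable_const hGc.measurable) measurable_const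
        measurable_const, 1, hsgn⟩
    have hu : supNorm u.1 ≤ 1 := supNorm_le hsgn
    have habs : ∀ z, |(s • G) z| = u.1 z * G z := by
      intro z
      change |s * G z| = (if 0 ≤ G z then (1 : ℝ) else -1) * G z
      rw [abs_mul, hs]
      split_ifs with h0
      · rw [abs_of_nonneg h0]
      · rw [abs_of_neg (not_le.1 h0)]; ring
    simp_rw [habs]
    rw [hpair χ hχ u]
    have hmd : mollifyMb hχ u = mderivMb γ (mollify (ψ k) u.1) (isCb_mollify hψ u) :=
      Subtype.ext (mderiv_mollify hψ u γ).symm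
    rw [hmd]
    refine (le_abs_self _).trans ((hM γ hγ _ _ x).trans ?_)
    have := supNorm_mollifyMb_le hψ hψ1 u
    calc M * supNorm (mollify (ψ k) u.1) ≤ M * 1 :=
          mul_le_mul_of_nonneg_left (this.trans hu) hM0
      _ = M := mul_one M
  have hφC : IsC1 (q : ℕ∞) φ := by
    refine ⟨?_, fun γ hγ => (hL1 γ (by exact_mod_cast hγ)).1⟩
    exact ((contDiff_mollifyMeasure _ hψ).sub (contDiff_mollifyMeasure _ hψ)).of_le
      (by exact_mod_cast le_top)
  have hφn : normOne q φ ≤ (multiIdx d q).card * M := by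
    unfold normOne
    have := sum_le_card_nsmul (multiIdx d q) (fun γ => ∫ z, |mderiv γ φ z|) M
      fun γ hγ => (hL1 γ (mem_multiIdx.1 hγ)).2
    rwa [nsmul_eq_mul] at this
  have := hd φ hφC
  rw [hpair (ψ k) hψ g] at this
  refine this.trans ?_
  rw [mul_comm]
  exact mul_le_mul_of_nonneg_right hφn he

/-! ### Operators of finite order -/

theorem integrable_Mb_mul {d : ℕ} (u : Mb d) {f : E d → ℝ} (hf : Integrable f) :
    Integrable (fun x => u.1 x * f x) :=
  hf.bdd_mul (c := supNorm u.1) u.2.1.aestronglyMeasurable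
    (Eventually.of_forall fun z => abs_le_supNorm u z)

theorem OpBound.mul {d : ℕ} {a b : ℝ} {A B : Op d} (hA : OpBound a A) (hB : OpBound b B)
    (ha : 0 ≤ a) : OpBound (a * b) (A * B) := fun f => by
  rw [mul_assoc]
  exact (hA (B f)).trans (mul_le_mul_of_nonneg_left (hB f) ha)

theorem OpBound.add {d : ℕ} {a b : ℝ} {A B : Op d} (hA : OpBound a A) (hB : OpBound b B) :
    OpBound (a + b) (A + B) := fun f => by
  rw [add_mul]
  exact (supNorm_add_le (A f) (B f)).trans (add_le_add (hA f) (hB f))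

theorem OpBound.sub {d : ℕ} {a b : ℝ} {A B : Op d} (hA : OpBound a A) (hB : OpBound b B) :
    OpBound (a + b) (A - B) := fun f => by
  rw [add_mul]
  exact (supNorm_sub_le (A f) (B f)).trans (add_le_add (hA f) (hB f))

theorem OpBound.mono {d : ℕ} {a b : ℝ} {A : Op d} (hA : OpBound a A) (h : a ≤ b) : OpBound b A :=
  fun f => (hA f).trans (mul_le_mul_of_nonneg_right h (supNorm_nonneg _))

theorem OpBound.sum {d : ℕ} {ι : Type*} (s : Finset ι) {A : ι → Op d} {b : ι → ℝ}
    (h : ∀ i ∈ s, OpBound (b i) (A i)) : OpBound (∑ i ∈ s, b i) (∑ i ∈ s, A i) := by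
  classical
  induction s using Finset.induction_on with
  | empty => intro f; exact supNorm_le fun x => by simp
  | insert i s hi ih =>
    rw [sum_insert hi, sum_insert hi]
    exact (h i (mem_insert_self i s)).add (ih fun j hj => h j (mem_insert_of_mem hj))

/-- `A` loses at most `q` derivatives, in the supremum norms with constant `c` and, dually, in the
`L^1` norms; the number of derivatives is at most `R`. Moreover `A` is bounded by `b` on `M_b`. -/
structure Good {d : ℕ} (R q : ℕ) (c b : ℝ) (A : Op d) : Prop where
  kernel : IsKernelOp A
  c_nonneg : 0 ≤ c
  b_nonneg : 0 ≤ b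
  smooth : ∀ r : ℕ, q + r ≤ R → ∀ f : Mb d, IsCb ((q + r : ℕ) : ℕ∞) f.1 →
    IsCb (r : ℕ∞) (A f).1 ∧ normInf r (A f).1 ≤ c * normInf (q + r) f.1
  dual : ∀ r : ℕ, q + r ≤ R → ∀ f : E d → ℝ, IsC1 ((q + r : ℕ) : ℕ∞) f →
    ∃ g : E d → ℝ, IsDual A f g ∧ IsC1 (r : ℕ∞) g ∧ normOne r g ≤ c * normOne (q + r) f
  op : OpBound b A

theorem Good.mono {d R q q' : ℕ} {c c' b b' : ℝ} {A : Op d} (h : Good R q c b A) (hq : q ≤ q')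
    (hc : c ≤ c') (hb : b ≤ b') : Good R q' c' b' A where
  kernel := h.kernel
  c_nonneg := h.c_nonneg.trans hc
  b_nonneg := h.b_nonneg.trans hb
  smooth r hr f hf := by
    obtain ⟨h1, h2⟩ := h.smooth r (by omega) f (hf.of_le (by exact_mod_cast by omega))
    exact ⟨h1, h2.trans (mul_le_mul hc (normInf_mono (by omega) _) (normInf_nonneg _ _)
      (h.c_nonneg.trans hc))⟩
  dual r hr f hf := by
    obtain ⟨g, h0, h1, h2⟩ := h.dual r (by omega) f (hf.of_le (by exact_mod_cast by omega))
    exact ⟨g, h0, h1, h2.trans (mul_le_mul hc (normOne_mono (by omega) _) (normOne_nonneg _ _)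
      (h.c_nonneg.trans hc))⟩
  op := h.op.mono hb

theorem Good.one {d R : ℕ} : Good R 0 1 1 (1 : Op d) where
  kernel := .one
  c_nonneg := zero_le_one
  b_nonneg := zero_le_one
  smooth r _ f hf := by
    rw [zero_add] at hf ⊢
    exact ⟨hf, by rw [one_mul]; exact le_rfl⟩
  dual r _ f hf := by
    rw [zero_add] at hf ⊢
    exact ⟨f, fun h => rfl, hf, by rw [one_mul]⟩
  op f := by rw [one_mul]; exact le_rfl

theorem Good.mul {d R q q' : ℕ} {c c' b b' : ℝ} {A B : Op d} (hA : Good R q c b A)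
    (hB : Good R q' c' b' B) : Good R (q + q') (c * c') (b * b') (A * B) where
  kernel := hA.kernel.mul hB.kernel
  c_nonneg := mul_nonneg hA.c_nonneg hB.c_nonneg
  b_nonneg := mul_nonneg hA.b_nonneg hB.b_nonneg
  smooth r hr f hf := by
    have e : q + q' + r = q' + (q + r) := by ring
    rw [e] at hf ⊢
    obtain ⟨h1, h2⟩ := hB.smooth (q + r) (by omega) f hf
    obtain ⟨h3, h4⟩ := hA.smooth r (by omega) (B f) h1
    refine ⟨h3, h4.trans ?_⟩
    rw [mul_assoc]
    exact mul_le_mul_of_nonneg_left h2 hA.c_nonneg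
  dual r hr f hf := by
    have e : q + q' + r = q + (q' + r) := by ring
    rw [e] at hf ⊢
    obtain ⟨g, h0, h1, h2⟩ := hA.dual (q' + r) (by omega) f hf
    obtain ⟨k, h3, h4, h5⟩ := hB.dual r (by omega) g h1
    refine ⟨k, fun u => (h0 (B u)).trans (h3 u), h4, h5.trans ?_⟩
    rw [mul_comm c, mul_assoc]
    exact mul_le_mul_of_nonneg_left h2 hB.c_nonneg
  op := hA.op.mul hB.op hA.b_nonneg

/-- A coefficient of modulus one treats sums and differences together. The kernel property of D is a
separate hypothesis because it is proved by different kernels in the two cases. -/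
theorem Good.add_smul {d R q : ℕ} {c c' b b' : ℝ} {A B : Op d} (hA : Good R q c b A)
    (hB : Good R q c' b' B) {s : ℝ} (hs : |s| = 1) {D : Op d} (hD : D = A + s • B)
    (hK : IsKernelOp D) : Good R q (c + c') (b + b') D where
  kernel := hK
  c_nonneg := add_nonneg hA.c_nonneg hB.c_nonneg
  b_nonneg := add_nonneg hA.b_nonneg hB.b_nonneg
  smooth r hr f hf := by
    obtain ⟨h1, h2⟩ := hA.smooth r hr f hf
    obtain ⟨h3, h4⟩ := hB.smooth r hr f hf
    have e : (D f).1 = (A f).1 + s • (B f).1 := by rw [hD]; rfl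
    rw [e]
    refine ⟨h1.add_smul s h3, (normInf_add_smul_le s h1 h3).trans ?_⟩
    rw [hs, one_mul, add_mul]
    exact add_le_add h2 h4
  dual r hr f hf := by
    obtain ⟨g, h0, h1, h2⟩ := hA.dual r hr f hf
    obtain ⟨k, h3, h4, h5⟩ := hB.dual r hr f hf
    refine ⟨g + s • k, fun u => ?_, h1.add_smul s h4, (normOne_add_smul_le s h1 h4).trans ?_⟩
    · have e : ∀ x, (D u).1 x * f x = (A u).1 x * f x + s * ((B u).1 x * f x) := by
        intro x
        have : (D u).1 x = (A u).1 x + s * (B u).1 x := by rw [hD]; rfl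
        rw [this]; ring
      have e' : ∀ x, u.1 x * (g + s • k) x = u.1 x * g x + s * (u.1 x * k x) := by
        intro x
        simp only [Pi.add_apply, Pi.smul_apply, smul_eq_mul]; ring
      simp_rw [e, e']
      rw [integral_add (integrable_Mb_mul _ hf.integrable)
        ((integrable_Mb_mul _ hf.integrable).const_mul s),
        integral_add (integrable_Mb_mul _ h1.integrable)
        ((integrable_Mb_mul _ h4.integrable).const_mul s), integral_const_mul, integral_const_mul,
        h0 u, h3 u]
    · rw [hs, one_mul, add_mul]
      exact add_le_add h2 h5
  op f := by
    have e : (D f).1 = (A f).1 + s • (B f).1 := by rw [hD]; rfl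
    refine supNorm_le fun x => ?_
    rw [e]
    simp only [Pi.add_apply, Pi.smul_apply, smul_eq_mul]
    refine (abs_add_le _ _).trans ?_
    rw [abs_mul, hs, one_mul, add_mul]
    exact add_le_add ((abs_le_supNorm (A f) x).trans (hA.op f))
      ((abs_le_supNorm (B f) x).trans (hB.op f))

theorem Good.add {d R q : ℕ} {c c' b b' : ℝ} {A B : Op d} (hA : Good R q c b A)
    (hB : Good R q c' b' B) : Good R q (c + c') (b + b') (A + B) :=
  hA.add_smul hB (s := 1) (by simp) (by rw [one_smul]) (hA.kernel.add hB.kernel)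

theorem Good.sub {d R q : ℕ} {c c' b b' : ℝ} {A B : Op d} (hA : Good R q c b A)
    (hB : Good R q c' b' B) : Good R q (c + c') (b + b') (A - B) :=
  hA.add_smul hB (s := -1) (by simp) (LinearMap.ext fun f => Subtype.ext (funext fun x => by
    change (A f).1 x - (B f).1 x = (A f).1 x + -1 * (B f).1 x
    ring)) (hA.kernel.sub hB.kernel)

theorem Good.zero {d R q : ℕ} : Good R q 0 0 (0 : Op d) := by
  have h := (Good.one (d := d) (R := R)).mono (Nat.zero_le q) le_rfl le_rfl
  refine ⟨.zero, le_rfl, le_rfl, fun r hr f hf => ?_, fun r hr f hf => ?_, fun f => ?_⟩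
  · have h1 : IsCb (r : ℕ∞) f.1 := hf.of_le (by exact_mod_cast by omega)
    -- Zero is written as f - f so that the linearity of ∂^γ shows that its derivatives vanish.
    have e : ((0 : Op d) f).1 = f.1 + (-1 : ℝ) • f.1 := by funext x; simp
    have e' : ∀ γ : Fin d → ℕ, mlen γ ≤ r → mderiv γ (f.1 + (-1 : ℝ) • f.1) = 0 := by
      intro γ hγ
      rw [mderiv_add_smul γ _ h1.1 h1.1 hγ]
      funext x; simp
    rw [e]
    refine ⟨h1.add_smul _ h1, ?_⟩
    rw [zero_mul]
    refine (sum_nonpos fun γ hγ => ?_)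
    rw [e' γ (mem_multiIdx.1 hγ)]
    exact supNorm_le fun x => by simp
  · have h1 : IsC1 (r : ℕ∞) f := hf.of_le (by exact_mod_cast by omega)
    have e' : ∀ γ : Fin d → ℕ, mlen γ ≤ r → mderiv γ (f + (-1 : ℝ) • f) = 0 := by
      intro γ hγ
      rw [mderiv_add_smul γ _ h1.1 h1.1 hγ]
      funext x; simp
    refine ⟨f + (-1 : ℝ) • f, fun u => by simp, h1.add_smul _ h1, ?_⟩
    rw [zero_mul]
    refine (sum_nonpos fun γ hγ => ?_)
    rw [e' γ (mem_multiIdx.1 hγ)]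
    simp
  · exact supNorm_le fun x => by simp

theorem Good.sum {d R q : ℕ} {ι : Type*} (s : Finset ι) {A : ι → Op d} {b c : ι → ℝ}
    (h : ∀ i ∈ s, Good R q (c i) (b i) (A i)) :
    Good R q (∑ i ∈ s, c i) (∑ i ∈ s, b i) (∑ i ∈ s, A i) := by
  classical
  induction s using Finset.induction_on with
  | empty => simpa using Good.zero
  | insert i s hi ih =>
    rw [sum_insert hi, sum_insert hi, sum_insert hi]
    exact (h i (mem_insert_self i s)).add (ih fun j hj => h j (mem_insert_of_mem hj))

/-! ### Regularization -/

/-- `W : C_b^r → M_b` is bounded by `e`, and by `b` on `M_b`. -/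
structure SmoothBound {d : ℕ} (r : ℕ) (e b : ℝ) (W : Op d) : Prop where
  kernel : IsKernelOp W
  e_nonneg : 0 ≤ e
  b_nonneg : 0 ≤ b
  smooth : ∀ f : Mb d, IsCb (r : ℕ∞) f.1 → ∀ x, |(W f).1 x| ≤ e * normInf r f.1
  op : OpBound b W

theorem Good.smoothBound {d R q : ℕ} {c b : ℝ} {A : Op d} (h : Good R q c b A) (hq : q ≤ R) :
    SmoothBound q c b A where
  kernel := h.kernel
  e_nonneg := h.c_nonneg
  b_nonneg := h.b_nonneg
  smooth f hf x := (abs_le_supNorm (A f) x).trans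
    ((supNorm_le_normInf 0 _).trans (h.smooth 0 hq f hf).2)
  op := h.op

/-- `X` maps derivatives of order `γ` into `C_b^r` with constant `M`, for `|γ| + r ≤ R`. -/
def Smoothing {d : ℕ} (R : ℕ) (M : ℝ) (X : Op d) : Prop :=
  ∀ (r : ℕ) (γ : Fin d → ℕ), mlen γ + r ≤ R → ∀ (f : E d → ℝ) (hf : IsCb ⊤ f),
    IsCb (r : ℕ∞) (X (mderivMb γ f hf)).1 ∧ normInf r (X (mderivMb γ f hf)).1 ≤ M * supNorm f

/-- The smoothing operator in the middle pays for both sides: it supplies the r derivatives that W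
consumes, and W X ∂^γ stays bounded for |γ| ≤ q. The q derivatives lost by U are seen only dually:
⟨Uf, φ⟩ = ⟨f, U^*φ⟩ ≤ c ‖f‖_∞ ‖φ‖_{q,1}, so no derivative of f enters. Smooth f are treated first,
so that U f is continuous. -/
theorem opBound_smoothing_mul {d R r q : ℕ} {e b M c b' : ℝ} {W X U : Op d}
    (hW : SmoothBound r e b W) (hXk : IsKernelOp X) (hX : Smoothing R M X) (hM : 0 ≤ M)
    (hU : Good R q c b' U) (hR : r + q ≤ R) :
    OpBound ((multiIdx d R).card * M * (e * c)) (W * X * U) := by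
  have hcard : ((multiIdx d q).card : ℝ) ≤ (multiIdx d R).card := by
    exact_mod_cast card_le_card (multiIdx_mono (by omega))
  have he := hW.e_nonneg
  have hc := hU.c_nonneg
  refine opBound_of_smooth ((hW.kernel.mul hXk).mul hU.kernel) (by positivity) fun f hf x => ?_
  have hS := supNorm_nonneg f.1
  have key := abs_apply_le_of_dual (hW.kernel.mul hXk) (M := e * M) (mul_nonneg he hM) (q := q)
    (fun γ hγ f hf x => ?_) (g := U f)
    (hU.smooth 0 (by omega) f (hf.of_le le_top)).1.1.continuous (e := c * supNorm f.1)
    (mul_nonneg hc hS) (fun φ hφ => ?_) x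
  · refine key.trans ?_
    calc ((multiIdx d q).card : ℝ) * (e * M) * (c * supNorm f.1)
        ≤ ((multiIdx d R).card : ℝ) * (e * M) * (c * supNorm f.1) := by gcongr
      _ = _ := by ring
  · obtain ⟨h1, h2⟩ := hX r γ (by omega) f hf
    refine (hW.smooth _ h1 x).trans ?_
    rw [mul_assoc]
    exact mul_le_mul_of_nonneg_left h2 he
  · obtain ⟨g, h0, h1, h2⟩ := hU.dual 0 (by omega) φ hφ
    rw [h0 f]
    have hgi := h1.integrable
    calc |∫ z, f.1 z * g z| ≤ ∫ z, |f.1 z * g z| := abs_integral_le_integral_abs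
      _ ≤ ∫ z, supNorm f.1 * |g z| := by
          refine integral_mono (integrable_Mb_mul f hgi).abs (hgi.abs.const_mul _) fun z => ?_
          simp only [abs_mul]
          exact mul_le_mul_of_nonneg_right (abs_le_supNorm f z) (abs_nonneg _)
      _ = supNorm f.1 * normOne 0 g := by rw [integral_const_mul, normOne_zero]
      _ ≤ supNorm f.1 * (c * normOne q φ) := mul_le_mul_of_nonneg_left h2 hS
      _ = _ := by ring

/-- On smooth functions nothing is gained, but the order r is unchanged; on bounded functions the
factor ρ is gained. This allows X - Xbar to be absorbed into W repeatedly. -/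
theorem SmoothBound.mul_sub {d R r : ℕ} {e b M ρ K : ℝ} {W X Xbar : Op d}
    (hW : SmoothBound r e b W) (hX : Good R 0 K K X) (hk : IsKernelOp Xbar)
    (hs : Smoothing R M Xbar) (hM : 0 ≤ M) (hρ : OpBound ρ (X - Xbar)) (hρ0 : 0 ≤ ρ) (hr : r ≤ R) :
    SmoothBound r (e * (K + M)) (b * ρ) (W * (X - Xbar)) where
  kernel := hW.kernel.mul (hX.kernel.sub hk)
  e_nonneg := mul_nonneg hW.e_nonneg (add_nonneg hX.c_nonneg hM)
  b_nonneg := mul_nonneg hW.b_nonneg hρ0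
  smooth g hg x := by
    have he := hW.e_nonneg
    have h1 : |(W (X g)).1 x| ≤ e * (K * normInf r g.1) := by
      have := hX.smooth r (by omega) g (by rwa [zero_add])
      rw [zero_add] at this
      exact (hW.smooth _ this.1 x).trans (mul_le_mul_of_nonneg_left this.2 he)
    -- The smoothing property is assumed for C_b^∞ inputs only. With γ = 0 it bounds W Xbar by the
    -- sup norm, and this bound extends to every bounded measurable function, in particular to g of
    -- class C_b^r.
    have h2 : OpBound (e * M) (W * Xbar) := by
      refine opBound_of_smooth (hW.kernel.mul hk) (mul_nonneg he hM) fun f hf x => ?_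
      obtain ⟨h3, h4⟩ := hs r (fun _ => 0) (by simpa [mlen] using hr) f.1 hf
      have e0 : mderivMb (fun _ => 0) f.1 hf = f := Subtype.ext (mderiv_zero_idx _)
      rw [e0] at h3 h4
      refine (hW.smooth _ h3 x).trans ?_
      rw [mul_assoc]
      exact mul_le_mul_of_nonneg_left h4 he
    have h3 : |(W (Xbar g)).1 x| ≤ e * M * normInf r g.1 :=
      (abs_le_supNorm (W (Xbar g)) x).trans ((h2 g).trans
        (mul_le_mul_of_nonneg_left (supNorm_le_normInf r _) (mul_nonneg he hM)))
    have e1 : ((W * (X - Xbar)) g).1 x = (W (X g)).1 x - (W (Xbar g)).1 x := by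
      change (W (X g - Xbar g)).1 x = _
      rw [map_sub]; rfl
    rw [e1]
    refine (abs_sub _ _).trans ((add_le_add h1 h3).trans (le_of_eq ?_))
    ring
  op := hW.op.mul hρ hW.b_nonneg

/-- `A U` is bounded on `M_b`, by `e e' M + b b' σ`, for every `U` of order `q'` with constants
`e'`, `b'`. -/
def Regularized {d : ℕ} (R : ℕ) (M σ : ℝ) (q : ℕ) (e b : ℝ) (A : Op d) : Prop :=
  ∀ (q' : ℕ) (e' b' : ℝ) (U : Op d), Good R q' e' b' U → q + q' ≤ R →
    OpBound (e * e' * M + b * b' * σ) (A * U)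

theorem Regularized.mul {d R q q' : ℕ} {M σ e b e' b' : ℝ} {A B : Op d}
    (hA : Regularized R M σ q e b A) (hB : Good R q' e' b' B) :
    Regularized R M σ (q + q') (e * e') (b * b') (A * B) := fun q'' e'' b'' U hU hR => by
  have := hA _ _ _ (B * U) (hB.mul hU) (by omega)
  rw [mul_assoc A]
  exact this.mono (le_of_eq (by ring))

theorem Regularized.add {d R q : ℕ} {M σ e b e' b' : ℝ} {A B : Op d}
    (hA : Regularized R M σ q e b A) (hB : Regularized R M σ q e' b' B) :
    Regularized R M σ q (e + e') (b + b') (A + B) := fun q'' e'' b'' U hU hR => by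
  rw [add_mul A B U]
  exact ((hA _ _ _ U hU hR).add (hB _ _ _ U hU hR)).mono (le_of_eq (by ring))

theorem Regularized.opBound {d R q : ℕ} {M σ e b : ℝ} {A : Op d}
    (hA : Regularized R M σ q e b A) (hq : q ≤ R) : OpBound (e * M + b * σ) A := by
  have := hA 0 1 1 1 Good.one (by omega)
  rw [mul_one] at this
  exact this.mono (le_of_eq (by ring))

theorem mul_mul_mul_eq_add_mul_sub {S : Type*} [Ring S] (w x x' y u : S) :
    w * (x * x') * u = w * y * (x' * u) + w * (x - y) * x' * u := by
  noncomm_ring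

/-- Splitting a long time interval into `N` intervals of `w` steps: the distance `ρ` between an
operator and its smoothing modification is improved to `ρ ^ N`. -/
theorem regularized_mul_of_split {d R : ℕ} {K M ρ : ℝ} (hK : 0 ≤ K) (hM : 0 ≤ M) (hρ : 0 ≤ ρ)
    {n w : ℕ} {X : ℕ → ℕ → Op d} (hX : ∀ a b, a ≤ b → b ≤ n → Good R 0 K K (X a b))
    (hcomp : ∀ a b c, a ≤ b → b ≤ c → c ≤ n → X a b * X b c = X a c)
    (happ : ∀ a, a + w ≤ n → ∃ Y : Op d, IsKernelOp Y ∧ Smoothing R M Y ∧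
      OpBound ρ (X a (a + w) - Y)) (N : ℕ) :
    ∀ {a b : ℕ}, a + N * w ≤ b → b ≤ n → ∀ {W : Op d} {r : ℕ} {e bW : ℝ}, SmoothBound r e bW W →
      Regularized R (N * (multiIdx d R).card * K * (1 + K + M) ^ N * M) (K * ρ ^ N) r e bW
        (W * X a b) := by
  induction N with
  | zero =>
    intro a b hab hb W r e bW hW q' e' b' U hU hR
    have := (hW.op.mul (hX a b (by omega) hb).op hW.b_nonneg).mul hU.op
      (mul_nonneg hW.b_nonneg hK)
    refine this.mono (le_of_eq ?_)
    simp; ring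
  | succ N ih =>
    intro a b hab hb W r e bW hW q' e' b' U hU hR
    have hab' : a + w + N * w ≤ b := by
      have : (N + 1) * w = N * w + w := by ring
      omega
    obtain ⟨Y, hYk, hYs, hYρ⟩ := happ a (by omega)
    have hX1 := hX a (a + w) (by omega) (by omega)
    have hX2 := hX (a + w) b (by omega) hb
    have h1 := opBound_smoothing_mul hW hYk hYs hM (hX2.mul hU) (by omega)
    have h2 := ih hab' hb (hW.mul_sub hX1 hYk hYs hM hYρ hρ (by omega)) q' e' b' U hU hR
    -- On the first piece, X = Y + (X - Y). The term with Y is regularized at once; in the other, X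
    -- - Y joins the left factor, contributes one ρ, and the induction continues on the remaining
    -- pieces.
    have e1 : W * X a b * U = W * Y * (X (a + w) b * U)
        + W * (X a (a + w) - Y) * X (a + w) b * U := by
      rw [← hcomp a (a + w) b (by omega) (by omega) hb]
      exact mul_mul_mul_eq_add_mul_sub W _ _ Y U
    rw [e1]
    refine (h1.add h2).mono ?_
    have he := hW.e_nonneg
    have he' := hU.c_nonneg
    set k : ℝ := (((multiIdx d R).card : ℕ) : ℝ) with hk
    have hk0 : 0 ≤ k := Nat.cast_nonneg _
    have h3 : k * M * (e * (K * e')) ≤ e * e' * (k * K * (1 + K + M) ^ (N + 1) * M) := by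
      have : (1 : ℝ) ≤ (1 + K + M) ^ (N + 1) := one_le_pow₀ (by linarith)
      calc k * M * (e * (K * e')) = e * e' * (k * K * 1 * M) := by ring
        _ ≤ _ := by gcongr
    have h4 : e * (K + M) * e' * (N * k * K * (1 + K + M) ^ N * M)
        ≤ e * e' * (N * k * K * (1 + K + M) ^ (N + 1) * M) := by
      rw [pow_succ]
      calc e * (K + M) * e' * (N * k * K * (1 + K + M) ^ N * M)
          = e * e' * (N * k * K * ((1 + K + M) ^ N * (K + M)) * M) := by ring
        _ ≤ e * e' * (N * k * K * ((1 + K + M) ^ N * (1 + K + M)) * M) := by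
            gcongr; linarith
    have h5 : bW * ρ * b' * (K * ρ ^ N) = bW * b' * (K * ρ ^ (N + 1)) := by ring
    have h6 : e * e' * (((N + 1 : ℕ) : ℝ) * k * K * (1 + K + M) ^ (N + 1) * M)
        = e * e' * (k * K * (1 + K + M) ^ (N + 1) * M)
          + e * e' * (N * k * K * (1 + K + M) ^ (N + 1) * M) := by push_cast; ring
    linarith

/-! ### Chains and the Lindeberg expansion -/

/-- The product `∏_{j=1}^i q_{u_{j-1}, u_j - 1} D_{u_j}`. -/
def chainProd {S : Type*} [Ring S] (q : ℕ → ℕ → S) (D : ℕ → S) (i : ℕ) (u : Fin (i + 1) → ℕ) : S :=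
  (List.ofFn fun j : Fin i => q (u j.castSucc) (u j.succ - 1) * D (u j.succ)).prod

theorem chainProd_zero {S : Type*} [Ring S] (q : ℕ → ℕ → S) (D : ℕ → S) (u : Fin 1 → ℕ) :
    chainProd q D 0 u = 1 := by
  simp [chainProd]

theorem chainProd_succ {S : Type*} [Ring S] (q : ℕ → ℕ → S) (D : ℕ → S) (i : ℕ)
    (u : Fin (i + 2) → ℕ) :
    chainProd q D (i + 1) u = chainProd q D i (fun j => u j.castSucc) *
      (q (u (Fin.last i).castSucc) (u (Fin.last (i + 1)) - 1) * D (u (Fin.last (i + 1)))) := by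
  unfold chainProd
  rw [List.ofFn_succ', List.prod_concat]
  rfl

theorem mem_chains {n i : ℕ} {u : Fin (i + 1) → Fin (n + 1)} :
    u ∈ chains n i ↔ u 0 = 0 ∧ StrictMono u := by
  simp [chains]

theorem chains_zero (n : ℕ) : chains n 0 = {fun _ => 0} := by
  have hsub : Subsingleton (Fin (0 + 1)) := inferInstanceAs (Subsingleton (Fin 1))
  ext u
  rw [mem_chains, mem_singleton]
  constructor
  · rintro ⟨h, -⟩
    funext j
    rw [Subsingleton.elim j 0, h]
  · rintro rfl
    exact ⟨rfl, Subsingleton.strictMono _⟩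

theorem card_chains_le (n i : ℕ) : (chains n i).card ≤ (n + 1) ^ i := by
  have : (chains n i).card ≤ (Finset.univ : Finset (Fin i → Fin (n + 1))).card := by
    refine Finset.card_le_card_of_injOn (fun u j => u j.succ) (fun _ _ => mem_univ _) ?_
    intro u hu v hv huv
    have hu0 := (mem_chains.1 hu).1
    have hv0 := (mem_chains.1 hv).1
    funext j
    refine Fin.cases ?_ (fun k => ?_) j
    · rw [hu0, hv0]
    · exact congrFun huv k
  simpa using this

/-- A chain with one more jump is a chain together with a point after its last one. -/
theorem sum_chains_succ {S : Type*} [AddCommMonoid S] (n i : ℕ)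
    (f : (Fin (i + 2) → Fin (n + 1)) → S) :
    ∑ v ∈ chains n (i + 1), f v = ∑ u ∈ chains n i,
      ∑ k ∈ Finset.univ.filter fun k : Fin (n + 1) => u (Fin.last i) < k,
        f (Fin.snoc (α := fun _ => Fin (n + 1)) u k) := by
  rw [Finset.sum_sigma']
  refine Finset.sum_bij' (fun v _ => ⟨Fin.init v, v (Fin.last (i + 1))⟩)
    (fun x _ => Fin.snoc (α := fun _ => Fin (n + 1)) x.1 x.2) ?_ ?_ ?_ ?_ ?_
  · intro v hv
    obtain ⟨h0, hm⟩ := mem_chains.1 hv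
    rw [mem_sigma]
    refine ⟨mem_chains.2 ⟨h0, fun a b hab => hm (by simpa using hab)⟩, ?_⟩
    simp only [mem_filter, mem_univ, true_and]
    exact hm (Fin.castSucc_lt_last _)
  · rintro ⟨u, k⟩ hx
    rw [mem_sigma] at hx
    obtain ⟨h0, hm⟩ := mem_chains.1 hx.1
    have hk : u (Fin.last i) < k := by simpa using hx.2
    refine mem_chains.2 ⟨?_, ?_⟩
    · have : (0 : Fin (i + 2)) = (0 : Fin (i + 1)).castSucc := rfl
      rw [this, Fin.snoc_castSucc]; exact h0
    · refine Fin.strictMono_iff_lt_succ.2 fun j => ?_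
      refine Fin.lastCases ?_ (fun j => ?_) j
      · rw [Fin.snoc_castSucc, Fin.succ_last, Fin.snoc_last]; exact hk
      · rw [Fin.snoc_castSucc, Fin.succ_castSucc, Fin.snoc_castSucc]
        exact hm (Fin.castSucc_lt_succ)
  · intro v _
    exact Fin.snoc_init_self v
  · rintro ⟨u, k⟩ _
    simp
  · intro v _
    simp

/-- Telescoping of k ↦ q_{a,k} p_{k,n} from k = a to k = n. -/
theorem sub_eq_sum_of_comp {S : Type*} [Ring S] {n : ℕ} {p q : ℕ → ℕ → S}
    (hp1 : p n n = 1) (hq1 : ∀ a ≤ n, q a a = 1)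
    (hp : ∀ a b c, a ≤ b → b ≤ c → c ≤ n → p a b * p b c = p a c)
    (hq : ∀ a b c, a ≤ b → b ≤ c → c ≤ n → q a b * q b c = q a c) {a : ℕ} (ha : a ≤ n) :
    p a n = q a n + ∑ k ∈ Finset.univ.filter fun k : Fin (n + 1) => a < (k : ℕ),
      q a (k - 1) * (p (k - 1) k - q (k - 1) k) * p k n := by
  -- The sum starts at 0 with an indicator, so the partial sum stops at max a N: nothing has been
  -- added while N ≤ a.
  have h1 : ∀ N ≤ n, (∑ j ∈ range N, if a ≤ j then
      q a j * (p j (j + 1) - q j (j + 1)) * p (j + 1) n else 0)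
      = q a a * p a n - q a (max a N) * p (max a N) n := by
    intro N
    induction N with
    | zero => intro _; simp
    | succ N ih =>
      intro hN
      rw [sum_range_succ, ih (by omega)]
      split_ifs with h
      · rw [max_eq_right h, max_eq_right (by omega : a ≤ N + 1), mul_sub, sub_mul, mul_assoc,
          hp N (N + 1) n (by omega) hN le_rfl, hq a N (N + 1) h (by omega) hN]
        abel
      · rw [max_eq_left (by omega : N ≤ a), max_eq_left (by omega : N + 1 ≤ a), add_zero]
  have h2 := h1 n le_rfl
  rw [max_eq_right ha, hp1, mul_one, hq1 a ha, one_mul] at h2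
  rw [sum_filter, Fin.sum_univ_succ]
  simp only [Fin.val_zero, not_lt_zero, if_false, zero_add, Fin.val_succ, Nat.add_sub_cancel,
    Nat.lt_succ_iff]
  rw [Fin.sum_univ_eq_sum_range (fun j => if a ≤ j then
      q a j * (p j (j + 1) - q j (j + 1)) * p (j + 1) n else 0) n, h2]
  abel

/-- Induction on m: applying the telescoping identity to the closing factor p of the remainder turns
its q part into the new main term, while the sum over k adds one jump to each chain. -/
theorem lindeberg_expansion {S : Type*} [Ring S] {n : ℕ} {p q : ℕ → ℕ → S}
    (hp1 : p n n = 1) (hq1 : ∀ a ≤ n, q a a = 1)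
    (hp : ∀ a b c, a ≤ b → b ≤ c → c ≤ n → p a b * p b c = p a c)
    (hq : ∀ a b c, a ≤ b → b ≤ c → c ≤ n → q a b * q b c = q a c) (m : ℕ) :
    p 0 n = ∑ i ∈ range m, ∑ u ∈ chains n i,
        chainProd q (fun k => p (k - 1) k - q (k - 1) k) i (fun j => u j) * q (u (Fin.last i)) n
      + ∑ u ∈ chains n m,
        chainProd q (fun k => p (k - 1) k - q (k - 1) k) m (fun j => u j) * p (u (Fin.last m)) n := by
  induction m with
  | zero =>
    rw [chains_zero]
    simp [chainProd_zero]
  | succ m ih =>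
    rw [sum_range_succ, add_assoc, sum_chains_succ, ← sum_add_distrib]
    refine ih.trans (congrArg _ (sum_congr rfl fun u _ => ?_))
    rw [sub_eq_sum_of_comp hp1 hq1 hp hq (a := u (Fin.last m)) (by omega), mul_add, mul_sum]
    refine congrArg _ (sum_congr rfl fun k _ => ?_)
    rw [chainProd_succ]
    simp only [Fin.snoc_castSucc, Fin.snoc_last]
    simp only [mul_assoc]

/-- A chain with at most `m` jumps has a gap of length at least `n / (m + 1)`. -/
theorem exists_gap {n i g : ℕ} (hg : (i + 1) * g ≤ n) (u : Fin (i + 1) → ℕ) (h0 : u 0 = 0)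
    (hu : StrictMono u) :
    (∃ j : Fin i, u j.castSucc + g ≤ u j.succ - 1) ∨ u (Fin.last i) + g ≤ n := by
  by_contra! h
  have key : ∀ j : Fin (i + 1), u j ≤ j * g := by
    intro j
    induction j using Fin.induction with
    | zero => simp [h0]
    | succ j ih =>
      have h1 := h.1 j
      have h2 := hu (Fin.castSucc_lt_succ (i := j))
      simp only [Fin.val_succ, Fin.val_castSucc] at ih ⊢
      rw [add_mul, one_mul]
      omega
  have h3 := key (Fin.last i)
  have h4 := h.2
  rw [Fin.val_last] at h3
  rw [add_mul, one_mul] at hg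
  omega

/-! ### Products along a chain -/

theorem Good.prod_ofFn {d R κ : ℕ} {c b : ℝ} (i : ℕ) (a : Fin i → Op d)
    (h : ∀ j, Good R κ c b (a j)) : Good R (i * κ) (c ^ i) (b ^ i) (List.ofFn a).prod := by
  induction i with
  | zero => simpa using Good.one
  | succ i ih =>
    rw [List.ofFn_succ', List.prod_concat]
    have := (ih (fun j => a j.castSucc) fun j => h _).mul (h (Fin.last i))
    rw [pow_succ, pow_succ, add_mul, one_mul]
    exact this

theorem Op.mul_sub {d : ℕ} (x a b : Op d) : x * (a - b) = x * a - x * b := _root_.mul_sub x a b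

theorem Op.sub_mul {d : ℕ} (a b x : Op d) : (a - b) * x = a * x - b * x := _root_.sub_mul a b x

theorem Op.mul_sub_mul_eq {d : ℕ} (x y a b : Op d) :
    x * a - y * b = (x - y) * a + y * (a - b) := by
  rw [Op.mul_sub, Op.sub_mul]
  exact (sub_add_sub_cancel (x * a) (y * a) (y * b)).symm

/-- Telescoping with x a - y b = (x - y) a + y (a - b): each term has one small factor e and i - 1
ordinary ones. On bounded functions the differences are not small, so b appears i times. For i = 0
the truncated exponent is harmless, the coefficient being 0. -/
theorem Good.prod_ofFn_sub {d R κ : ℕ} {c b e : ℝ} (i : ℕ) (x y : Fin i → Op d)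
    (hx : ∀ j, Good R κ c b (x j)) (hy : ∀ j, Good R κ c b (y j))
    (h : ∀ j, Good R κ e b (x j - y j)) :
    Good R (i * κ) (i * c ^ (i - 1) * e) (i * b ^ i) ((List.ofFn x).prod - (List.ofFn y).prod) := by
  induction i with
  | zero =>
    have e0 : (List.ofFn x).prod - (List.ofFn y).prod = 0 := by
      rw [List.ofFn_zero, List.ofFn_zero]; exact sub_self (1 : Op d)
    rw [e0]
    simpa using Good.zero
  | succ i ih =>
    rw [List.ofFn_succ', List.prod_concat, List.ofFn_succ', List.prod_concat]
    have h1 := (ih (fun j => x j.castSucc) (fun j => y j.castSucc) (fun j => hx _) (fun j => hy _)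
      (fun j => h _)).mul (hx (Fin.last i))
    have h2 := (Good.prod_ofFn i (fun j => y j.castSucc) fun j => hy _).mul (h (Fin.last i))
    have h3 := h1.add h2
    have e1 := Op.mul_sub_mul_eq (List.ofFn fun j => x j.castSucc).prod
      (List.ofFn fun j => y j.castSucc).prod (x (Fin.last i)) (y (Fin.last i))
    rw [e1]
    refine h3.mono (by rw [add_mul, one_mul]) (le_of_eq ?_) (le_of_eq ?_)
    · rcases i with _ | i
      · simp
      · push_cast
        simp only [pow_succ]; ring
    · push_cast; rw [pow_succ]; ring

theorem Regularized.mono {d R q q' : ℕ} {M σ e e' b b' : ℝ} {A : Op d}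
    (hA : Regularized R M σ q e b A) (hq : q ≤ q') (he : e ≤ e') (hb : b ≤ b')
    (hM : 0 ≤ M) (hσ : 0 ≤ σ) : Regularized R M σ q' e' b' A := fun q'' e'' b'' U hU hR => by
  refine (hA _ _ _ U hU (by omega)).mono ?_
  have := hU.c_nonneg
  have := hU.b_nonneg
  gcongr

/-- The interval `(a, b)`, with `b - a ≥ g`, has a regularizing effect. -/
def LongRegularizing {d : ℕ} (R n g : ℕ) (M σ : ℝ) (X : ℕ → ℕ → Op d) : Prop :=
  ∀ a b : ℕ, a + g ≤ b → b ≤ n → ∀ (W : Op d) (r : ℕ) (e bW : ℝ), SmoothBound r e bW W →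
    Regularized R M σ r e bW (W * X a b)

section Chain
variable {d R κ n g : ℕ} {K c b e M σ : ℝ} {q : ℕ → ℕ → Op d} {D D' : ℕ → Op d}

theorem Good.factor (hq : ∀ a b, a ≤ b → b ≤ n → Good R 0 K K (q a b))
    (hD : ∀ k, 1 ≤ k → k ≤ n → Good R κ c b (D k)) {i : ℕ} {u : Fin (i + 1) → ℕ}
    (hu : StrictMono u) (hn : u (Fin.last i) ≤ n) (j : Fin i) :
    Good R κ (K * c) (K * b) (q (u j.castSucc) (u j.succ - 1) * D (u j.succ)) := by
  have h1 := hu (Fin.castSucc_lt_succ (i := j))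
  have h2 := hu.monotone (Fin.le_last j.succ)
  exact ((hq _ _ (by omega) (by omega)).mul (hD _ (by omega) (by omega))).mono (by omega) le_rfl
    le_rfl

theorem Good.chainProd (hq : ∀ a b, a ≤ b → b ≤ n → Good R 0 K K (q a b))
    (hD : ∀ k, 1 ≤ k → k ≤ n → Good R κ c b (D k)) {i : ℕ} {u : Fin (i + 1) → ℕ}
    (hu : StrictMono u) (hn : u (Fin.last i) ≤ n) :
    Good R (i * κ) ((K * c) ^ i) ((K * b) ^ i) (chainProd q D i u) :=
  Good.prod_ofFn i _ fun j => Good.factor hq hD hu hn j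

theorem Good.chainProd_sub (hq : ∀ a b, a ≤ b → b ≤ n → Good R 0 K K (q a b))
    (hD : ∀ k, 1 ≤ k → k ≤ n → Good R κ c b (D k))
    (hD' : ∀ k, 1 ≤ k → k ≤ n → Good R κ c b (D' k))
    (hDD' : ∀ k, 1 ≤ k → k ≤ n → Good R κ e b (D k - D' k)) {i : ℕ} {u : Fin (i + 1) → ℕ}
    (hu : StrictMono u) (hn : u (Fin.last i) ≤ n) :
    Good R (i * κ) (i * (K * c) ^ (i - 1) * (K * e)) (i * (K * b) ^ i)
      (WeakApprox.chainProd q D i u - WeakApprox.chainProd q D' i u) := by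
  refine Good.prod_ofFn_sub i _ _ (fun j => Good.factor hq hD hu hn j)
    (fun j => Good.factor hq hD' hu hn j) fun j => ?_
  have := Good.factor (D := fun k => D k - D' k) hq hDD' hu hn j
  rwa [Op.mul_sub] at this

/-- Peel the factors off from the right until the gap is in the last one; the product to its left
then plays the role of W. The constant of the semigroup over the gap is already in M and σ, so K ≥ 1
merely restores a uniform form. -/
theorem Regularized.chainProd (hK : 1 ≤ K) (hM : 0 ≤ M) (hσ : 0 ≤ σ)
    (hq : ∀ a b, a ≤ b → b ≤ n → Good R 0 K K (q a b))
    (hlong : LongRegularizing R n g M σ q)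
    (hD : ∀ k, 1 ≤ k → k ≤ n → Good R κ c b (D k)) (i : ℕ) (u : Fin (i + 1) → ℕ)
    (hu : StrictMono u) (hn : u (Fin.last i) ≤ n) (hR : i * κ ≤ R)
    (hgap : ∃ j : Fin i, u j.castSucc + g ≤ u j.succ - 1) :
    Regularized R M σ (i * κ) ((K * c) ^ i) ((K * b) ^ i) (chainProd q D i u) := by
  induction i with
  | zero => obtain ⟨j, -⟩ := hgap; exact j.elim0
  | succ i ih =>
    have hu' : StrictMono fun j : Fin (i + 1) => u j.castSucc := fun a b hab => hu (by simpa using hab)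
    have hlt := hu (Fin.castSucc_lt_last (Fin.last i))
    have hn' : u (Fin.last i).castSucc ≤ n := by omega
    have hR' : i * κ ≤ R := by rw [add_mul] at hR; omega
    have hD1 := hD (u (Fin.last (i + 1))) (by omega) hn
    have hc0 := hD1.c_nonneg
    have hb0 := hD1.b_nonneg
    rw [chainProd_succ, add_mul, one_mul, pow_succ, pow_succ]
    obtain ⟨j, hj⟩ := hgap
    rcases Fin.eq_castSucc_or_eq_last j with ⟨j, rfl⟩ | rfl
    · have h1 := (ih (fun j => u j.castSucc) hu' hn' hR' ⟨j, hj⟩).mul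
        ((hq (u (Fin.last i).castSucc) (u (Fin.last (i + 1)) - 1) (by omega) (by omega)).mul hD1)
      rwa [zero_add] at h1
    · have h1 := (hlong _ _ hj (by change u (Fin.last (i + 1)) - 1 ≤ n; omega) _ _ _ _
        ((Good.chainProd hq hD hu' hn').smoothBound hR')).mul hD1
      rw [Fin.succ_last, mul_assoc (G := Op d)] at h1
      refine h1.mono le_rfl ?_ ?_ hM hσ
      · gcongr; exact le_mul_of_one_le_left hc0 hK
      · gcongr; exact le_mul_of_one_le_left hb0 hK

/-- Both products run over the same chain and contain the same semigroup factor over the gap, so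
every term of the telescoped difference is regularized. If the gap is in the last factor, the left
operator W is x - y in one term and y in the other. -/
theorem Regularized.chainProd_sub (hK : 1 ≤ K) (hM : 0 ≤ M) (hσ : 0 ≤ σ)
    (hq : ∀ a b, a ≤ b → b ≤ n → Good R 0 K K (q a b))
    (hlong : LongRegularizing R n g M σ q)
    (hD : ∀ k, 1 ≤ k → k ≤ n → Good R κ c b (D k))
    (hD' : ∀ k, 1 ≤ k → k ≤ n → Good R κ c b (D' k))
    (hDD' : ∀ k, 1 ≤ k → k ≤ n → Good R κ e b (D k - D' k)) (i : ℕ) (u : Fin (i + 1) → ℕ)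
    (hu : StrictMono u) (hn : u (Fin.last i) ≤ n) (hR : i * κ ≤ R)
    (hgap : ∃ j : Fin i, u j.castSucc + g ≤ u j.succ - 1) :
    Regularized R M σ (i * κ) (i * (K * c) ^ (i - 1) * (K * e)) (i * (K * b) ^ i)
      (WeakApprox.chainProd q D i u - WeakApprox.chainProd q D' i u) := by
  induction i with
  | zero => obtain ⟨j, -⟩ := hgap; exact j.elim0
  | succ i ih =>
    have hu' : StrictMono fun j : Fin (i + 1) => u j.castSucc := fun a b hab => hu (by simpa using hab)
    have hlt := hu (Fin.castSucc_lt_last (Fin.last i))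
    have hn' : u (Fin.last i).castSucc ≤ n := by omega
    have hR' : i * κ ≤ R := by rw [add_mul] at hR; omega
    have hD1 := hD (u (Fin.last (i + 1))) (by omega) hn
    have hD2 := hDD' (u (Fin.last (i + 1))) (by omega) hn
    have hc0 := hD1.c_nonneg
    have hb0 := hD1.b_nonneg
    have he0 := hD2.c_nonneg
    have hK0 : 0 ≤ K := by linarith
    have hq1 := hq (u (Fin.last i).castSucc) (u (Fin.last (i + 1)) - 1) (by omega) (by omega)
    have hcoef : (i : ℝ) * (K * c) ^ (i - 1) * (K * e) * (K * c) + (K * c) ^ i * (K * e)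
        = ((i + 1 : ℕ) : ℝ) * (K * c) ^ (i + 1 - 1) * (K * e) := by
      rcases i with _ | i
      · simp
      · push_cast
        simp only [pow_succ]; ring
    have hcoef' : (i : ℝ) * (K * b) ^ i * (K * b) + (K * b) ^ i * (K * b)
        = ((i + 1 : ℕ) : ℝ) * (K * b) ^ (i + 1) := by
      push_cast; rw [pow_succ]; ring
    rw [chainProd_succ, chainProd_succ]
    set x := WeakApprox.chainProd q D i fun j => u j.castSucc
    set y := WeakApprox.chainProd q D' i fun j => u j.castSucc
    have e1 := Op.mul_sub_mul_eq x y
      (q (u (Fin.last i).castSucc) (u (Fin.last (i + 1)) - 1) * D (u (Fin.last (i + 1))))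
      (q (u (Fin.last i).castSucc) (u (Fin.last (i + 1)) - 1) * D' (u (Fin.last (i + 1))))
    rw [e1, ← Op.mul_sub, add_mul, one_mul, ← hcoef, ← hcoef']
    obtain ⟨j, hj⟩ := hgap
    rcases Fin.eq_castSucc_or_eq_last j with ⟨j, rfl⟩ | rfl
    · have h1 := (ih (fun j => u j.castSucc) hu' hn' hR' ⟨j, hj⟩).mul (hq1.mul hD1)
      have h2 := (Regularized.chainProd hK hM hσ hq hlong hD' i (fun j => u j.castSucc) hu' hn' hR'
        ⟨j, hj⟩).mul (hq1.mul hD2)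
      rw [zero_add] at h1 h2
      exact h1.add h2
    · have hbn : u (Fin.last (i + 1)) - 1 ≤ n := by omega
      rw [Fin.succ_last] at hj
      have h1 := (hlong _ _ hj hbn _ _ _ _
        ((Good.chainProd_sub hq hD hD' hDD' hu' hn').smoothBound hR')).mul hD1
      have h2 := (hlong _ _ hj hbn _ _ _ _
        ((Good.chainProd hq hD' hu' hn').smoothBound hR')).mul hD2
      rw [mul_assoc (G := Op d)] at h1 h2
      refine (h1.add h2).mono le_rfl (add_le_add ?_ ?_) (add_le_add ?_ ?_) hM hσ
      · gcongr; exact le_mul_of_one_le_left hc0 hK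
      · gcongr; exact le_mul_of_one_le_left he0 hK
      · gcongr; exact le_mul_of_one_le_left hb0 hK
      · gcongr; exact le_mul_of_one_le_left hb0 hK

end Chain

/-! ### Semigroups and schemes on the grids -/

/-- The semigroups `P` and `Q^{δ_n^l}`, with their bounds for at most `R` derivatives. -/
structure Scheme {d : ℕ} (α : ℝ) (R β L : ℕ) (K T : ℝ) (n : ℕ) (P : ℝ → ℝ → Op d)
    (Q : ℕ → ℝ → ℝ → Op d) : Prop where
  T_pos : 0 < T
  n_pos : 0 < n
  semigroupP : IsSemigroupOn (Set.Icc 0 T) P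
  semigroupQ : ∀ l : ℕ, IsSemigroupOn (grid (step T n l) T) (Q l)
  goodP : ∀ s t : ℝ, 0 ≤ s → s ≤ t → t ≤ T → Good R 0 K K (P s t)
  goodQ : ∀ l : ℕ, ∀ s ∈ grid (step T n l) T, ∀ t ∈ grid (step T n l) T, s ≤ t →
    Good R 0 K K (Q l s t)
  short : ∀ l : ℕ, 1 ≤ l → l ≤ L → ∀ t ∈ grid (step T n l) T, t + step T n l ≤ T →
    Good R β (K * step T n l ^ (α + 1)) (2 * K) (P t (t + step T n l) - Q l t (t + step T n l))

theorem step_eq {T : ℝ} {n : ℕ} (hn : 0 < n) (l : ℕ) : step T n l = n * step T n (l + 1) := by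
  have : (n : ℝ) ≠ 0 := by positivity
  unfold step
  rw [pow_succ]
  field_simp

theorem Op.sum_sub {d : ℕ} {ι : Type*} (s : Finset ι) (f g : ι → Op d) :
    ∑ i ∈ s, f i - ∑ i ∈ s, g i = ∑ i ∈ s, (f i - g i) :=
  (Finset.sum_sub_distrib f g).symm

/-- The family `A_{s,t}` between the points `t + a δ`. -/
def onGrid {d : ℕ} (A : ℝ → ℝ → Op d) (t δ : ℝ) (a b : ℕ) : Op d := A (t + a * δ) (t + b * δ)

section Grid
variable {d n R β L : ℕ} {α K T : ℝ} {P : ℝ → ℝ → Op d} {Q : ℕ → ℝ → ℝ → Op d} {l : ℕ} {t : ℝ}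

theorem step_pos (hT : 0 < T) (hn : 0 < n) (l : ℕ) : 0 < step T n l := by
  unfold step; positivity

theorem add_mul_step_le (hT : 0 < T) (hn : 0 < n) (htT : t + step T n l ≤ T) {a : ℕ} (ha : a ≤ n) :
    t + a * step T n (l + 1) ≤ T := by
  have h1 : (a : ℝ) * step T n (l + 1) ≤ n * step T n (l + 1) :=
    mul_le_mul_of_nonneg_right (by exact_mod_cast ha) (step_pos hT hn _).le
  rw [← step_eq hn] at h1
  linarith

theorem add_mul_step_mem_grid (hT : 0 < T) (hn : 0 < n) (ht : t ∈ grid (step T n l) T)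
    (htT : t + step T n l ≤ T) {a : ℕ} (ha : a ≤ n) :
    t + a * step T n (l + 1) ∈ grid (step T n (l + 1)) T := by
  refine ⟨?_, add_mul_step_le hT hn htT ha⟩
  obtain ⟨⟨k, rfl⟩, -⟩ := ht
  refine ⟨k * n + a, ?_⟩
  rw [step_eq hn l]
  push_cast
  ring

theorem grid_nonneg (hT : 0 < T) (hn : 0 < n) (ht : t ∈ grid (step T n l) T) : 0 ≤ t := by
  obtain ⟨⟨k, rfl⟩, -⟩ := ht
  have := step_pos hT hn l
  positivity

theorem Scheme.add_mem_Icc (h : Scheme α R β L K T n P Q) (ht : t ∈ grid (step T n l) T)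
    (htT : t + step T n l ≤ T) {a : ℕ} (ha : a ≤ n) :
    t + a * step T n (l + 1) ∈ Set.Icc 0 T := by
  have hm := add_mul_step_mem_grid h.T_pos h.n_pos ht htT ha
  exact ⟨grid_nonneg h.T_pos h.n_pos hm, hm.2⟩

theorem Scheme.add_le_add (h : Scheme α R β L K T n P Q) (l : ℕ) (t : ℝ) {a b : ℕ} (hab : a ≤ b) :
    t + a * step T n l ≤ t + b * step T n l :=
  add_le_add_right (mul_le_mul_of_nonneg_right (by exact_mod_cast hab)
    (step_pos h.T_pos h.n_pos _).le) t

theorem Scheme.good_onGrid_P (h : Scheme α R β L K T n P Q) (ht : t ∈ grid (step T n l) T)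
    (htT : t + step T n l ≤ T) (a b : ℕ) (hab : a ≤ b) (hb : b ≤ n) :
    Good R 0 K K (onGrid P t (step T n (l + 1)) a b) :=
  h.goodP _ _ (h.add_mem_Icc ht htT (hab.trans hb)).1 (h.add_le_add _ _ hab)
    (h.add_mem_Icc ht htT hb).2

theorem Scheme.good_onGrid_Q (h : Scheme α R β L K T n P Q) (ht : t ∈ grid (step T n l) T)
    (htT : t + step T n l ≤ T) (a b : ℕ) (hab : a ≤ b) (hb : b ≤ n) :
    Good R 0 K K (onGrid (Q (l + 1)) t (step T n (l + 1)) a b) :=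
  h.goodQ _ _ (add_mul_step_mem_grid h.T_pos h.n_pos ht htT (hab.trans hb)) _
    (add_mul_step_mem_grid h.T_pos h.n_pos ht htT hb) (h.add_le_add _ _ hab)

theorem Scheme.comp_onGrid_P (h : Scheme α R β L K T n P Q) (ht : t ∈ grid (step T n l) T)
    (htT : t + step T n l ≤ T) (a b c : ℕ) (hab : a ≤ b) (hbc : b ≤ c) (hc : c ≤ n) :
    onGrid P t (step T n (l + 1)) a b * onGrid P t (step T n (l + 1)) b c
      = onGrid P t (step T n (l + 1)) a c :=
  h.semigroupP.comp _ (h.add_mem_Icc ht htT (hab.trans (hbc.trans hc))) _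
    (h.add_mem_Icc ht htT (hbc.trans hc)) _ (h.add_mem_Icc ht htT hc)
    (h.add_le_add _ _ hab) (h.add_le_add _ _ hbc)

theorem Scheme.comp_onGrid_Q (h : Scheme α R β L K T n P Q) (ht : t ∈ grid (step T n l) T)
    (htT : t + step T n l ≤ T) (a b c : ℕ) (hab : a ≤ b) (hbc : b ≤ c) (hc : c ≤ n) :
    onGrid (Q (l + 1)) t (step T n (l + 1)) a b * onGrid (Q (l + 1)) t (step T n (l + 1)) b c
      = onGrid (Q (l + 1)) t (step T n (l + 1)) a c :=
  (h.semigroupQ (l + 1)).comp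
    _ (add_mul_step_mem_grid h.T_pos h.n_pos ht htT (hab.trans (hbc.trans hc))) _
    (add_mul_step_mem_grid h.T_pos h.n_pos ht htT (hbc.trans hc)) _
    (add_mul_step_mem_grid h.T_pos h.n_pos ht htT hc)
    (h.add_le_add _ _ hab) (h.add_le_add _ _ hbc)

/-- `P_{t_{k-1},t_k} - Q_{t_{k-1},t_k}` for the points `t_k = t + k δ`. -/
def stepDiff (A B : ℝ → ℝ → Op d) (t δ : ℝ) (k : ℕ) : Op d :=
  onGrid A t δ (k - 1) k - onGrid B t δ (k - 1) k

/-- The Lindeberg expansion with m(l,ν) jumps and the definition of Q̂ have the same chains and the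
same closing factors for fewer jumps; they differ only in the one-step operators compared with Q. -/
theorem Scheme.sub_Qhat_eq (h : Scheme α R β L K T n P Q) (hα : 0 < α) (ν : ℝ)
    (hm : 0 < mOrd α l ν) (ht : t ∈ grid (step T n l) T) (htT : t + step T n l ≤ T) :
    P t (t + step T n l) - Qhat α hα T n Q l ν t =
      ∑ i : Fin (mOrd α l ν - 1), ∑ u ∈ chains n ((i : ℕ) + 1),
        (chainProd (onGrid (Q (l + 1)) t (step T n (l + 1)))
            (stepDiff P (Q (l + 1)) t (step T n (l + 1))) ((i : ℕ) + 1) (fun j => u j) -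
          chainProd (onGrid (Q (l + 1)) t (step T n (l + 1)))
            (stepDiff (fun s _ => Qhat α hα T n Q (l + 1) (qOrd α l ν (i + 1)) s) (Q (l + 1)) t
              (step T n (l + 1))) ((i : ℕ) + 1) (fun j => u j)) *
          onGrid (Q (l + 1)) t (step T n (l + 1)) (u (Fin.last _)) n +
      ∑ u ∈ chains n (mOrd α l ν),
        chainProd (onGrid (Q (l + 1)) t (step T n (l + 1)))
            (stepDiff P (Q (l + 1)) t (step T n (l + 1))) (mOrd α l ν) (fun j => u j) *
          onGrid P t (step T n (l + 1)) (u (Fin.last _)) n := by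
  have hlin := lindeberg_expansion (S := Op d) (n := n)
    (p := onGrid P t (step T n (l + 1))) (q := onGrid (Q (l + 1)) t (step T n (l + 1)))
    (by rw [onGrid, h.semigroupP.refl _ (h.add_mem_Icc ht htT le_rfl)])
    (fun a ha => by
      rw [onGrid, (h.semigroupQ (l + 1)).refl _
        (add_mul_step_mem_grid h.T_pos h.n_pos ht htT ha)])
    (h.comp_onGrid_P ht htT) (h.comp_onGrid_Q ht htT) (mOrd α l ν)
  have hP0 : onGrid P t (step T n (l + 1)) 0 n = P t (t + step T n l) := by
    rw [step_eq h.n_pos l]; simp [onGrid]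
  have hQ0 : onGrid (Q (l + 1)) t (step T n (l + 1)) 0 n = Q (l + 1) t (t + step T n l) := by
    rw [step_eq h.n_pos l]; simp [onGrid]
  have hQn : ∀ a : ℕ, onGrid (Q (l + 1)) t (step T n (l + 1)) a n
      = Q (l + 1) (t + a * step T n (l + 1)) (t + step T n l) := by
    intro a; rw [step_eq h.n_pos l]; rfl
  have hhat : Qhat α hα T n Q l ν t = onGrid (Q (l + 1)) t (step T n (l + 1)) 0 n +
      ∑ i : Fin (mOrd α l ν - 1), ∑ u ∈ chains n ((i : ℕ) + 1),
        chainProd (onGrid (Q (l + 1)) t (step T n (l + 1)))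
            (stepDiff (fun s _ => Qhat α hα T n Q (l + 1) (qOrd α l ν (i + 1)) s) (Q (l + 1)) t
              (step T n (l + 1))) ((i : ℕ) + 1) (fun j => u j) *
          onGrid (Q (l + 1)) t (step T n (l + 1)) (u (Fin.last _)) n := by
    rw [Qhat, hQ0]
    refine congrArg _ (sum_congr rfl fun i _ => sum_congr rfl fun u hu => ?_)
    rw [hQn]
    refine congrArg (fun x : Op d => x * _) ?_
    unfold chainProd
    refine congrArg (fun f => (List.ofFn f).prod) (funext fun j => ?_)
    -- A point after a jump is at least 1, so the truncated subtraction in the index agrees with the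
    -- real subtraction of one step.
    have hpos : 1 ≤ (u j.succ : ℕ) := by
      have : u j.castSucc < u j.succ := (mem_chains.1 hu).2 (Fin.castSucc_lt_succ)
      have := Fin.lt_def.1 this
      omega
    have e : t + ((u j.succ : ℕ) : ℝ) * step T n (l + 1) - step T n (l + 1)
        = t + (((u j.succ : ℕ) - 1 : ℕ) : ℝ) * step T n (l + 1) := by
      rw [Nat.cast_sub hpos]; push_cast; ring
    rw [e]
    rfl
  rw [hhat, ← hP0]
  -- The term without jumps is split off: it is Q over the whole interval and cancels the leading
  -- term of Q̂.
  rw [show mOrd α l ν = (mOrd α l ν - 1) + 1 by omega, sum_range_succ'] at hlin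
  rw [Nat.sub_add_cancel hm] at hlin
  have hz : ∑ u ∈ chains n 0, chainProd (onGrid (Q (l + 1)) t (step T n (l + 1)))
      (fun k => onGrid P t (step T n (l + 1)) (k - 1) k -
        onGrid (Q (l + 1)) t (step T n (l + 1)) (k - 1) k) 0 (fun j => u j) *
        onGrid (Q (l + 1)) t (step T n (l + 1)) (u (Fin.last 0)) n
      = onGrid (Q (l + 1)) t (step T n (l + 1)) 0 n := by
    rw [chains_zero, sum_singleton, chainProd_zero, one_mul]
    simp
  have e : ∀ (A B C F G : Op d), A = F + B + C → A - (B + G) = (F - G) + C := by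
    rintro A B C F G rfl
    have : F + B + C - (B + G) = (F - G) + C := by abel
    exact this
  rw [e _ _ _ _ _ (hlin.trans (congrArg (fun x : Op d => x + _) (congrArg _ hz)))]
  refine congrArg (fun x : Op d => x + _) ?_
  rw [← Fin.sum_univ_eq_sum_range (fun i => ∑ u ∈ chains n (i + 1),
    chainProd (onGrid (Q (l + 1)) t (step T n (l + 1)))
      (fun k => onGrid P t (step T n (l + 1)) (k - 1) k -
        onGrid (Q (l + 1)) t (step T n (l + 1)) (k - 1) k) (i + 1) (fun j => u j) *
        onGrid (Q (l + 1)) t (step T n (l + 1)) (u (Fin.last (i + 1))) n)]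
  rw [Op.sum_sub]
  refine sum_congr rfl fun i _ => ?_
  rw [Op.sum_sub]
  refine sum_congr rfl fun u _ => ?_
  exact (Op.sub_mul _ _ _).symm

theorem Scheme.good_stepDiff (h : Scheme α R β L K T n P Q) (hl : l + 1 ≤ L)
    (ht : t ∈ grid (step T n l) T) (htT : t + step T n l ≤ T) {k : ℕ} (hk1 : 1 ≤ k) (hk : k ≤ n) :
    Good R β (K * step T n (l + 1) ^ (α + 1)) (2 * K)
      (stepDiff P (Q (l + 1)) t (step T n (l + 1)) k) := by
  have hm := add_mul_step_mem_grid h.T_pos h.n_pos ht htT (show k - 1 ≤ n by omega)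
  have e : t + ((k - 1 : ℕ) : ℝ) * step T n (l + 1) + step T n (l + 1)
      = t + (k : ℝ) * step T n (l + 1) := by
    rw [Nat.cast_sub hk1]; push_cast; ring
  have := h.short (l + 1) (by omega) hl _ hm
    (by rw [e]; exact add_mul_step_le h.T_pos h.n_pos htT hk)
  rw [e] at this
  exact this

end Grid

/-! ### Orders -/

theorem mOrd_pos {α ν : ℝ} (hα : 0 < α) (l : ℕ) (hν : 0 < ν) : 0 < mOrd α l ν := by
  unfold mOrd
  rw [Nat.ceil_pos]
  positivity

theorem le_mOrd_mul {α : ℝ} (hα : 0 < α) (l : ℕ) (ν : ℝ) :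
    ν ≤ mOrd α l ν * ((1 + α) * l + α) := by
  have hden : 0 < (1 + α) * (l : ℝ) + α := by positivity
  have := Nat.le_ceil (ν / ((1 + α) * (l : ℝ) + α))
  rwa [div_le_iff₀ hden] at this

theorem mul_lt_of_lt_mOrd {α : ℝ} (hα : 0 < α) {l : ℕ} {ν : ℝ} {i : ℕ} (hi : i < mOrd α l ν) :
    i * ((1 + α) * l + α) < ν := by
  have hden : 0 < (1 + α) * (l : ℝ) + α := by positivity
  have := Nat.lt_ceil.1 (show i < ⌈ν / ((1 + α) * (l : ℝ) + α)⌉₊ from hi)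
  rwa [lt_div_iff₀ hden] at this

theorem le_qOrd (α : ℝ) (l : ℕ) (ν : ℝ) (i : ℕ) :
    ν + (i + 1) - (1 + α) * (l + 1) * i ≤ qOrd α l ν (i + 1) := by
  unfold qOrd
  have := Int.le_ceil (((i + 1 : ℕ) : ℝ) - (1 + α) * (l + 1) * (((i + 1 : ℕ) : ℝ) - 1))
  push_cast at this ⊢
  rw [add_sub_cancel_right] at this ⊢
  linarith

/-- Since i + 1 < m(l,ν), ν exceeds (i+1)((1+α)(l+1) - 1), and the claim follows from the definition
of q_i. Thus the finer Q̂ has a higher order than one step of Q, and the standing condition of the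
recursion passes to level l + 1. -/
theorem lt_qOrd {α : ℝ} (hα : 0 < α) {l : ℕ} {ν : ℝ} {i : ℕ} (hi : i + 1 < mOrd α l ν) :
    (1 + α) * ((l + 1 : ℕ) : ℝ) < qOrd α l ν (i + 1) := by
  have h1 := le_qOrd α l ν i
  have h2 := mul_lt_of_lt_mOrd hα hi
  push_cast at h2 ⊢
  linarith

/-- The order increases by at most 1 when the level does, so ν - l does not increase along the
recursion; this bounds the number of levels at which short time estimates are needed. -/
theorem qOrd_le {α : ℝ} (hα : 0 < α) (l : ℕ) (ν : ℝ) (i : ℕ) : qOrd α l ν (i + 1) ≤ ν + 1 := by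
  unfold qOrd
  have : (⌈((i + 1 : ℕ) : ℝ) - (1 + α) * (l + 1) * (((i + 1 : ℕ) : ℝ) - 1)⌉ : ℤ) ≤ 1 := by
    rw [Int.ceil_le]
    push_cast
    have : 0 ≤ (i : ℝ) * (α * (l + 1) + l) := by positivity
    nlinarith
  have h2 : ((⌈((i + 1 : ℕ) : ℝ) - (1 + α) * (l + 1) * (((i + 1 : ℕ) : ℝ) - 1)⌉ : ℤ) : ℝ) ≤ 1 := by
    exact_mod_cast this
  linarith

theorem mul_le_kappa {α : ℝ} (hα : 0 < α) (β l : ℕ) (ν : ℝ) :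
    β * mOrd α l ν ≤ kappa α hα β l ν := by
  rw [kappa]; exact le_max_left _ _

theorem mul_max_le_kappa {α : ℝ} (hα : 0 < α) (β l : ℕ) (ν : ℝ) (i : Fin (mOrd α l ν - 1)) :
    ((i : ℕ) + 1) * max β (kappa α hα β (l + 1) (qOrd α l ν (i + 1))) ≤ kappa α hα β l ν := by
  rcases le_total (kappa α hα β (l + 1) (qOrd α l ν (i + 1))) β with h | h
  · rw [max_eq_left h]
    refine le_trans ?_ (mul_le_kappa hα β l ν)
    rw [mul_comm]
    exact Nat.mul_le_mul_left _ (by omega)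
  · rw [max_eq_right h, kappa.eq_1 α hα β l ν]
    exact le_trans (Finset.le_sup (f := fun i : Fin (mOrd α l ν - 1) =>
      ((i : ℕ) + 1) * kappa α hα β (l + 1) (qOrd α l ν (i + 1))) (mem_univ i)) (le_max_right _ _)

/-! ### Numerical estimates -/

theorem card_chains_le_pow {n : ℕ} (hn : 0 < n) (i : ℕ) :
    ((chains n i).card : ℝ) ≤ 2 ^ i * (n : ℝ) ^ i := by
  have h1 : ((chains n i).card : ℝ) ≤ ((n + 1 : ℕ) : ℝ) ^ i := by exact_mod_cast card_chains_le n i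
  refine h1.trans ?_
  rw [← mul_pow]
  have : (1 : ℝ) ≤ n := by exact_mod_cast hn
  exact pow_le_pow_left₀ (by positivity) (by push_cast; linarith) i

/-- The count behind q_i: N^{i+1} chains, i factors P - Q of size N^{-a}, and one factor P - Q̂ of
size N^{-q}. -/
theorem pow_mul_rpow_le {N a ν q : ℝ} (hN : 1 ≤ N) (i : ℕ) (h : ν + (i + 1) - a * i ≤ q) :
    N ^ (i + 1) * ((N ^ (-a)) ^ i * N ^ (-q)) ≤ N ^ (-ν) := by
  have hN0 : 0 < N := by linarith
  rw [← Real.rpow_natCast N (i + 1), ← Real.rpow_mul_natCast hN0.le, ← Real.rpow_add hN0,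
    ← Real.rpow_add hN0]
  refine Real.rpow_le_rpow_of_exponent_le hN ?_
  push_cast
  linarith

/-- The count behind m(l,ν): each jump of the remainder costs a factor N for its position and gains
N^{-a}. -/
theorem pow_mul_rpow_pow_le {N a ν : ℝ} (hN : 1 ≤ N) (m : ℕ) (h : ν ≤ m * (a - 1)) :
    N ^ m * (N ^ (-a)) ^ m ≤ N ^ (-ν) := by
  have hN0 : 0 < N := by linarith
  rw [← Real.rpow_natCast N m, ← Real.rpow_mul_natCast hN0.le, ← Real.rpow_add hN0]
  refine Real.rpow_le_rpow_of_exponent_le hN ?_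
  linarith

theorem step_rpow_le {T α : ℝ} {n l p : ℕ} (hT : 0 < T) (hn : 0 < n) (hα : 0 < α)
    (hp : α + 1 ≤ p) : step T n (l + 1) ^ (α + 1) ≤
      (1 + T) ^ p * (n : ℝ) ^ (-((1 + α) * ((l : ℝ) + 1))) := by
  have hn0 : (0 : ℝ) < n := by exact_mod_cast hn
  unfold step
  rw [Real.div_rpow hT.le (by positivity), div_eq_mul_inv, ← Real.rpow_natCast (n : ℝ) (l + 1),
    ← Real.rpow_mul hn0.le, ← Real.rpow_neg hn0.le]
  have h1 : T ^ (α + 1) ≤ (1 + T) ^ p := by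
    rw [← Real.rpow_natCast (1 + T) p]
    exact (Real.rpow_le_rpow hT.le (by linarith) (by linarith)).trans
      (Real.rpow_le_rpow_of_exponent_le (by linarith) hp)
  have h2 : -(((l + 1 : ℕ) : ℝ) * (α + 1)) = -((1 + α) * ((l : ℝ) + 1)) := by push_cast; ring
  rw [h2]
  exact mul_le_mul_of_nonneg_right h1 (Real.rpow_nonneg hn0.le _)

/-! ### The error of the approximation for smooth functions -/

/-- Smooth error estimate of order `n^{-ν}` for the approximation `Q̂^{ν,δ_n^l}`, the bound on `M_b`
being allowed to grow polynomially in `n`. -/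
def SmoothError (α : ℝ) (hα : 0 < α) (l : ℕ) (ν : ℝ) : Prop :=
  ∃ p k : ℕ, ∀ (d R β L : ℕ) (K : ℝ), 1 ≤ K → ν - l ≤ α * L → ∃ C : ℝ, 1 ≤ C ∧
    ∀ (T : ℝ) (n : ℕ) (P : ℝ → ℝ → Op d) (Q : ℕ → ℝ → ℝ → Op d), Scheme α R β L K T n P Q →
      ∀ t ∈ grid (step T n l) T, t + step T n l ≤ T →
        Good R (kappa α hα β l ν) (C * (1 + T) ^ p * (n : ℝ) ^ (-ν)) (C * (n : ℝ) ^ k)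
          (P t (t + step T n l) - Qhat α hα T n Q l ν t)

/-- The estimates of all the factors in the Lindeberg expansion of `P - Q̂^{ν,δ_n^l}`. -/
def FactorBounds (α : ℝ) (hα : 0 < α) (l : ℕ) (ν : ℝ) : Prop :=
  ∃ p k : ℕ, ∀ (d R β L : ℕ) (K : ℝ), 1 ≤ K → ν - l ≤ α * L → ∃ C : ℝ, 1 ≤ C ∧
    ∀ (T : ℝ) (n : ℕ) (P : ℝ → ℝ → Op d) (Q : ℕ → ℝ → ℝ → Op d), Scheme α R β L K T n P Q →
      ∀ t ∈ grid (step T n l) T, t + step T n l ≤ T →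
        (∀ i : Fin (mOrd α l ν - 1), ∃ c b e : ℝ,
          (∀ j, 1 ≤ j → j ≤ n → Good R (max β (kappa α hα β (l + 1) (qOrd α l ν (i + 1)))) c b
            (stepDiff P (Q (l + 1)) t (step T n (l + 1)) j)) ∧
          (∀ j, 1 ≤ j → j ≤ n → Good R (max β (kappa α hα β (l + 1) (qOrd α l ν (i + 1)))) c b
            (stepDiff (fun s _ => Qhat α hα T n Q (l + 1) (qOrd α l ν (i + 1)) s) (Q (l + 1)) t
              (step T n (l + 1)) j)) ∧
          (∀ j, 1 ≤ j → j ≤ n → Good R (max β (kappa α hα β (l + 1) (qOrd α l ν (i + 1)))) e b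
            (stepDiff P (Q (l + 1)) t (step T n (l + 1)) j -
              stepDiff (fun s _ => Qhat α hα T n Q (l + 1) (qOrd α l ν (i + 1)) s) (Q (l + 1)) t
              (step T n (l + 1)) j)) ∧
          ((chains n ((i : ℕ) + 1)).card : ℝ) *
              (((i : ℕ) + 1 : ℕ) * (K * c) ^ (((i : ℕ) + 1) - 1) * (K * e) * K)
            ≤ C * (1 + T) ^ p * (n : ℝ) ^ (-ν) ∧
          ((chains n ((i : ℕ) + 1)).card : ℝ) * (((i : ℕ) + 1 : ℕ) * (K * b) ^ ((i : ℕ) + 1) * K)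
            ≤ C * (n : ℝ) ^ k) ∧
        ∃ c b : ℝ, (∀ j, 1 ≤ j → j ≤ n → Good R β c b
            (stepDiff P (Q (l + 1)) t (step T n (l + 1)) j)) ∧
          ((chains n (mOrd α l ν)).card : ℝ) * ((K * c) ^ mOrd α l ν * K)
            ≤ C * (1 + T) ^ p * (n : ℝ) ^ (-ν) ∧
          ((chains n (mOrd α l ν)).card : ℝ) * ((K * b) ^ mOrd α l ν * K) ≤ C * (n : ℝ) ^ k

theorem smoothError_of_factorBounds {α : ℝ} (hα : 0 < α) {l : ℕ} {ν : ℝ} (hν : 0 < ν)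
    (h : FactorBounds α hα l ν) : SmoothError α hα l ν := by
  obtain ⟨p, k, h⟩ := h
  refine ⟨p, k, fun d R β L K hK hL => ?_⟩
  obtain ⟨C, hC, h⟩ := h d R β L K hK hL
  -- One C for each number of jumps below m(l,ν), and one for the remainder.
  refine ⟨((mOrd α l ν - 1 : ℕ) + 1) * C, ?_, fun T n P Q hS t ht htT => ?_⟩
  · have : (0 : ℝ) ≤ ((mOrd α l ν - 1 : ℕ) : ℝ) := Nat.cast_nonneg _
    nlinarith
  obtain ⟨h1, c, b, h2, h3, h4⟩ := h T n P Q hS t ht htT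
  rw [hS.sub_Qhat_eq hα ν (mOrd_pos hα l hν) ht htT]
  have hchain : ∀ {i : ℕ} {u : Fin (i + 1) → Fin (n + 1)}, u ∈ chains n i →
      StrictMono (fun j => (u j : ℕ)) ∧ (u (Fin.last i) : ℕ) ≤ n := fun hu =>
    ⟨fun a b hab => (mem_chains.1 hu).2 hab, by omega⟩
  have hq := hS.good_onGrid_Q ht htT
  have hmain : ∀ i : Fin (mOrd α l ν - 1), Good R (kappa α hα β l ν)
      (C * (1 + T) ^ p * (n : ℝ) ^ (-ν)) (C * (n : ℝ) ^ k)
      (∑ u ∈ chains n ((i : ℕ) + 1),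
        (chainProd (onGrid (Q (l + 1)) t (step T n (l + 1)))
            (stepDiff P (Q (l + 1)) t (step T n (l + 1))) ((i : ℕ) + 1) (fun j => u j) -
          chainProd (onGrid (Q (l + 1)) t (step T n (l + 1)))
            (stepDiff (fun s _ => Qhat α hα T n Q (l + 1) (qOrd α l ν (i + 1)) s) (Q (l + 1)) t
              (step T n (l + 1))) ((i : ℕ) + 1) (fun j => u j)) *
          onGrid (Q (l + 1)) t (step T n (l + 1)) (u (Fin.last _)) n) := by
    intro i
    obtain ⟨c, b, e, g1, g2, g3, g4, g5⟩ := h1 i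
    refine (Good.sum (q := kappa α hα β l ν) (chains n ((i : ℕ) + 1)) fun u hu =>
      ((Good.chainProd_sub hq g1 g2 g3 (hchain hu).1 (hchain hu).2).mul
        (hq _ _ (hchain hu).2 le_rfl)).mono ?_ le_rfl le_rfl).mono le_rfl ?_ ?_
    · rw [add_zero]; exact mul_max_le_kappa hα β l ν i
    · rw [sum_const, nsmul_eq_mul]; exact g4
    · rw [sum_const, nsmul_eq_mul]; exact g5
  have hrem := Good.sum (R := R) (q := kappa α hα β l ν) (chains n (mOrd α l ν)) fun u hu =>
      ((Good.chainProd hq h2 (hchain hu).1 (hchain hu).2).mul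
        (hS.good_onGrid_P ht htT _ _ (hchain hu).2 le_rfl)).mono
        (by rw [add_zero, mul_comm]; exact mul_le_kappa hα β l ν) le_rfl le_rfl
  rw [sum_const, nsmul_eq_mul, sum_const, nsmul_eq_mul] at hrem
  have hsum := Good.sum (R := R) (q := kappa α hα β l ν) Finset.univ fun i _ => hmain i
  simp only [sum_const, card_univ, Fintype.card_fin, nsmul_eq_mul] at hsum
  refine (hsum.add (hrem.mono le_rfl h3 h4)).mono le_rfl (le_of_eq ?_) (le_of_eq ?_) <;> ring

set_option maxHeartbeats 1000000 in
-- P - Q is bounded by the short time estimate and P - Q̂ by the error at level l + 1; Q̂ - Q, their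
-- difference, has the order of P - Q because q_i > (1+α)(l+1). It remains to multiply by the number
-- of chains.
theorem factorBounds_of_smoothError {α : ℝ} (hα : 0 < α) {l : ℕ} {ν : ℝ}
    (hlν : (1 + α) * l < ν)
    (h : ∀ i : Fin (mOrd α l ν - 1), SmoothError α hα (l + 1) (qOrd α l ν (i + 1))) :
    FactorBounds α hα l ν := by
  choose p k h using h
  obtain ⟨m, hm⟩ : ∃ m, m = mOrd α l ν := ⟨_, rfl⟩
  have hν : 0 < ν := lt_of_le_of_lt (by positivity) hlν
  have hm1 : 1 ≤ m := hm ▸ mOrd_pos hα l hν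
  -- The ceiling absorbs T^{α+1} from the power of the time step; the sum dominates every exponent
  -- of the finer level. All of this is fixed before d, β and K.
  set p₀ : ℕ := ∑ i, p i + ⌈α + 1⌉₊ with hp₀
  set k₀ : ℕ := ∑ i, k i with hk₀
  refine ⟨m * p₀, m * (k₀ + 1), fun d R β L K hK hL => ?_⟩
  -- From (1+α) l < ν and ν - l ≤ α L one gets α l < α L, so the short time estimate is available on
  -- the next grid.
  have hlL : l + 1 ≤ L := by
    have : α * l < α * L := by linarith
    have := lt_of_mul_lt_mul_left this hα.le
    exact_mod_cast this
  have hL' : ∀ i : Fin (mOrd α l ν - 1), qOrd α l ν (i + 1) - ((l + 1 : ℕ) : ℝ) ≤ α * L := fun i => by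
    have := qOrd_le hα l ν i
    push_cast
    linarith
  choose C hC h using fun i => h i d R β L K hK (hL' i)
  set C₀ : ℝ := ∑ i, C i + 2 * K with hC₀
  have hC0 : ∀ i, C i ≤ C₀ := fun i => by
    have : C i ≤ ∑ i, C i := single_le_sum (fun i _ => by linarith [hC i]) (mem_univ i)
    linarith
  have hCK : 2 * K ≤ C₀ := by
    have : 0 ≤ ∑ i, C i := sum_nonneg fun i _ => by linarith [hC i]
    linarith
  have hC01 : 1 ≤ C₀ := by linarith
  -- The 2 comes from writing Q̂ - Q as a difference of two operators with constant C₀; K is the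
  -- semigroup factor attached to each jump.
  set G : ℝ := K * (2 * C₀) with hG
  have hG1 : 1 ≤ G := by nlinarith
  refine ⟨2 ^ m * m * G ^ m * K, ?_, fun T n P Q hS t ht htT => ?_⟩
  · have e1 : (1 : ℝ) ≤ 2 ^ m := one_le_pow₀ (by norm_num)
    have e2 : (1 : ℝ) ≤ m := by exact_mod_cast hm1
    have e3 : 1 ≤ G ^ m := one_le_pow₀ hG1
    exact one_le_mul_of_one_le_of_one_le (one_le_mul_of_one_le_of_one_le
      (one_le_mul_of_one_le_of_one_le e1 e2) e3) hK
  have hT := hS.T_pos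
  have hn := hS.n_pos
  have hN : (1 : ℝ) ≤ n := by exact_mod_cast hn
  have hN0 : (0 : ℝ) < n := by linarith
  set N : ℝ := (n : ℝ) with hNdef
  set a : ℝ := (1 + α) * ((l : ℝ) + 1) with ha
  have hΛ : 1 ≤ 1 + T := by linarith
  set Λ : ℝ := (1 + T) ^ p₀ with hΛdef
  have hΛ1 : 1 ≤ Λ := one_le_pow₀ hΛ
  set x : ℝ := N ^ (-a) with hx
  have hx0 : 0 ≤ x := Real.rpow_nonneg hN0.le _
  set B : ℝ := N ^ k₀ with hB
  have hB1 : 1 ≤ B := one_le_pow₀ hN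
  have hδ : K * step T n (l + 1) ^ (α + 1) ≤ C₀ * (Λ * x) := by
    have h1 := step_rpow_le (l := l) (p := p₀) hT hn hα
      ((Nat.le_ceil _).trans (by exact_mod_cast Nat.le_add_left _ _))
    exact mul_le_mul (by linarith) h1 (Real.rpow_nonneg (step_pos hT hn _).le _) (by linarith)
  have hD : ∀ j, 1 ≤ j → j ≤ n → Good R β (C₀ * (Λ * x)) (C₀ * B)
      (stepDiff P (Q (l + 1)) t (step T n (l + 1)) j) := fun j hj1 hj =>
    (hS.good_stepDiff hlL ht htT hj1 hj).mono le_rfl hδ (by nlinarith)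
  have hDle : C₀ * (Λ * x) ≤ 2 * C₀ * (Λ * x) := by
    have : 0 ≤ C₀ * (Λ * x) := by positivity
    linarith
  have hBle : C₀ * B ≤ 2 * C₀ * B := by
    have : 0 ≤ C₀ * B := by positivity
    linarith
  have hΛm : ∀ i ≤ m, Λ ^ i ≤ (1 + T) ^ (m * p₀) := fun i hi => by
    rw [mul_comm, pow_mul]
    exact pow_le_pow_right₀ hΛ1 hi
  have hGm : ∀ i ≤ m, G ^ i ≤ G ^ m := fun i hi => pow_le_pow_right₀ hG1 hi
  have h2m : ∀ i ≤ m, (2 : ℝ) ^ i ≤ 2 ^ m := fun i hi => pow_le_pow_right₀ (by norm_num) hi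
  have hNB : ∀ i ≤ m, N ^ i * B ^ i ≤ N ^ (m * (k₀ + 1)) := fun i hi => by
    rw [← mul_pow, hB, ← pow_succ', ← pow_mul, mul_comm]
    exact pow_le_pow_right₀ hN (Nat.mul_le_mul_right _ hi)
  refine ⟨fun i => ?_, ?_⟩
  · set κ' := max β (kappa α hα β (l + 1) (qOrd α l ν (i + 1))) with hκ'
    have hi1 : (i : ℕ) + 1 < m := by have := i.2; omega
    have hE : ∀ j, 1 ≤ j → j ≤ n → Good R κ' (C₀ * (Λ * N ^ (-qOrd α l ν (i + 1)))) (C₀ * B)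
        (stepDiff P (Q (l + 1)) t (step T n (l + 1)) j -
          stepDiff (fun s _ => Qhat α hα T n Q (l + 1) (qOrd α l ν (i + 1)) s) (Q (l + 1)) t
              (step T n (l + 1)) j) := by
      intro j hj1 hj
      have hmem := add_mul_step_mem_grid hT hn ht htT (show j - 1 ≤ n by omega)
      have e : t + ((j - 1 : ℕ) : ℝ) * step T n (l + 1) + step T n (l + 1)
          = t + (j : ℝ) * step T n (l + 1) := by
        rw [Nat.cast_sub hj1]; push_cast; ring
      have h1 := h i T n P Q hS _ hmem (by rw [e]; exact add_mul_step_le hT hn htT hj)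
      rw [e] at h1
      -- Q cancels between the two one-step differences, leaving P - Q̂ at level l + 1.
      have e2 : ∀ A B C : Op d, (A - C) - (B - C) = A - B := fun A B C => sub_sub_sub_cancel_right A B C
      unfold stepDiff
      rw [e2]
      refine h1.mono (le_max_right _ _) ?_ ?_
      · rw [mul_assoc]
        have : (1 + T) ^ p i ≤ Λ := pow_le_pow_right₀ hΛ
          ((single_le_sum (fun _ _ => Nat.zero_le _) (mem_univ i)).trans (Nat.le_add_right _ _))
        have := hC0 i
        gcongr
      · have : N ^ k i ≤ B := pow_le_pow_right₀ hN
          (single_le_sum (f := k) (fun _ _ => Nat.zero_le _) (mem_univ i))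
        have := hC0 i
        gcongr
    have hq : a ≤ qOrd α l ν (i + 1) := by
      have := lt_qOrd hα (hm ▸ hi1)
      push_cast at this
      exact this.le
    have hqx : N ^ (-qOrd α l ν (i + 1)) ≤ x := Real.rpow_le_rpow_of_exponent_le hN (by linarith)
    have hq0 : 0 ≤ N ^ (-qOrd α l ν (i + 1)) := Real.rpow_nonneg hN0.le _
    have hD' : ∀ j, 1 ≤ j → j ≤ n → Good R κ' (C₀ * (Λ * x)) (C₀ * B)
        (stepDiff P (Q (l + 1)) t (step T n (l + 1)) j) := fun j hj1 hj =>
      (hD j hj1 hj).mono (le_max_left _ _) le_rfl le_rfl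
    refine ⟨2 * C₀ * (Λ * x), 2 * C₀ * B, C₀ * (Λ * N ^ (-qOrd α l ν (i + 1))),
      fun j hj1 hj => (hD' j hj1 hj).mono le_rfl hDle hBle, fun j hj1 hj => ?_,
      fun j hj1 hj => (hE j hj1 hj).mono le_rfl le_rfl hBle, ?_, ?_⟩
    · have e2 : ∀ A B : Op d, A - (A - B) = B := fun A B => sub_sub_cancel A B
      rw [← e2 (stepDiff P (Q (l + 1)) t (step T n (l + 1)) j)
        (stepDiff (fun s _ => Qhat α hα T n Q (l + 1) (qOrd α l ν (i + 1)) s) (Q (l + 1)) t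
              (step T n (l + 1)) j)]
      refine ((hD' j hj1 hj).sub (hE j hj1 hj)).mono le_rfl ?_ (by linarith)
      have : C₀ * (Λ * N ^ (-qOrd α l ν (i + 1))) ≤ C₀ * (Λ * x) := by gcongr
      linarith
    · rw [Nat.add_sub_cancel]
      have hcard := card_chains_le_pow hn ((i : ℕ) + 1)
      have hpow := pow_mul_rpow_le (a := a) hN (i : ℕ) (le_qOrd α l ν i)
      have him : (((i : ℕ) + 1 : ℕ) : ℝ) ≤ m := by exact_mod_cast hi1.le
      have hKC : K * C₀ ≤ G := by rw [hG]; nlinarith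
      calc ((chains n ((i : ℕ) + 1)).card : ℝ) * (((i : ℕ) + 1 : ℕ) * (K * (2 * C₀ * (Λ * x))) ^ (i : ℕ)
            * (K * (C₀ * (Λ * N ^ (-qOrd α l ν (i + 1))))) * K)
          ≤ (2 ^ ((i : ℕ) + 1) * N ^ ((i : ℕ) + 1)) * (m * (G * (Λ * x)) ^ (i : ℕ)
            * (G * (Λ * N ^ (-qOrd α l ν (i + 1)))) * K) := by
            have e1 : K * (2 * C₀ * (Λ * x)) = G * (Λ * x) := by rw [hG]; ring
            have e2 : K * (C₀ * (Λ * N ^ (-qOrd α l ν (i + 1))))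
              = K * C₀ * (Λ * N ^ (-qOrd α l ν (i + 1))) := by ring
            rw [e1, e2]
            gcongr
        _ = 2 ^ ((i : ℕ) + 1) * m * G ^ ((i : ℕ) + 1) * K * Λ ^ ((i : ℕ) + 1) *
            (N ^ ((i : ℕ) + 1) * (x ^ (i : ℕ) * N ^ (-qOrd α l ν (i + 1)))) := by
            simp only [mul_pow, pow_succ]; ring
        _ ≤ 2 ^ m * m * G ^ m * K * (1 + T) ^ (m * p₀) * N ^ (-ν) := by
            have := h2m _ hi1.le
            have := hGm _ hi1.le
            have := hΛm _ hi1.le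
            gcongr
    · have hcard := card_chains_le_pow hn ((i : ℕ) + 1)
      have him : (((i : ℕ) + 1 : ℕ) : ℝ) ≤ m := by exact_mod_cast hi1.le
      calc ((chains n ((i : ℕ) + 1)).card : ℝ) * (((i : ℕ) + 1 : ℕ) * (K * (2 * C₀ * B)) ^ ((i : ℕ) + 1) * K)
          ≤ (2 ^ ((i : ℕ) + 1) * N ^ ((i : ℕ) + 1)) * (m * (K * (2 * C₀ * B)) ^ ((i : ℕ) + 1) * K) := by
            gcongr
        _ = 2 ^ ((i : ℕ) + 1) * m * G ^ ((i : ℕ) + 1) * K * (N ^ ((i : ℕ) + 1) * B ^ ((i : ℕ) + 1)) := by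
            rw [hG]; simp only [mul_pow]; ring
        _ ≤ 2 ^ m * m * G ^ m * K * N ^ (m * (k₀ + 1)) := by
            have := h2m _ hi1.le
            have := hGm _ hi1.le
            have := hNB _ hi1.le
            gcongr
  · rw [← hm]
    have hcard := card_chains_le_pow hn m
    have hm1' : (1 : ℝ) ≤ m := by exact_mod_cast hm1
    refine ⟨2 * C₀ * (Λ * x), 2 * C₀ * B, fun j hj1 hj => (hD j hj1 hj).mono le_rfl hDle hBle, ?_, ?_⟩
    · have hpow := pow_mul_rpow_pow_le (a := a) (ν := ν) hN m (by
        have := le_mOrd_mul hα l ν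
        rw [← hm] at this
        rw [ha]
        calc ν ≤ m * ((1 + α) * l + α) := this
          _ = m * ((1 + α) * ((l : ℝ) + 1) - 1) := by ring)
      calc ((chains n m).card : ℝ) * ((K * (2 * C₀ * (Λ * x))) ^ m * K)
          ≤ (2 ^ m * N ^ m) * ((K * (2 * C₀ * (Λ * x))) ^ m * K) := by gcongr
        _ = 2 ^ m * 1 * G ^ m * K * Λ ^ m * (N ^ m * x ^ m) := by
            rw [hG]; simp only [mul_pow]; ring
        _ ≤ 2 ^ m * m * G ^ m * K * (1 + T) ^ (m * p₀) * N ^ (-ν) := by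
            have := hΛm _ le_rfl
            gcongr
    · calc ((chains n m).card : ℝ) * ((K * (2 * C₀ * B)) ^ m * K)
          ≤ (2 ^ m * N ^ m) * ((K * (2 * C₀ * B)) ^ m * K) := by gcongr
        _ = 2 ^ m * 1 * G ^ m * K * (N ^ m * B ^ m) := by
            rw [hG]; simp only [mul_pow]; ring
        _ ≤ 2 ^ m * m * G ^ m * K * N ^ (m * (k₀ + 1)) := by
            have := hNB _ le_rfl
            gcongr

/-- Induction along the termination measure of Q̂. If m(l,ν) = 1, no finer level is called and only
the remainder is left to estimate. -/
theorem factorBounds {α : ℝ} (hα : 0 < α) (l : ℕ) (ν : ℝ) (hlν : (1 + α) * l < ν) :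
    FactorBounds α hα l ν := by
  induction hN : ⌈(ν - (1 + α) * (l : ℝ) - α) / α⌉₊ using Nat.strong_induction_on
    generalizing l ν with
  | _ N ih =>
    subst hN
    refine factorBounds_of_smoothError hα hlν fun i => ?_
    have hq : (1 + α) * ((l + 1 : ℕ) : ℝ) < qOrd α l ν (i + 1) :=
      lt_qOrd hα (by have := i.2; omega)
    exact smoothError_of_factorBounds hα (lt_of_le_of_lt (by positivity) hq)
      (ih _ (recursion_decreases hα l ν i) _ _ hq rfl)

/-! ### Consequences of the stability and short time assumptions -/

/-- Only r ≤ R matter, so a single K' replaces the sequence K_r. The bound on bounded measurable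
functions is the case r = 0, extended through the kernel. -/
theorem Good.of_transport {d R : ℕ} {K : ℕ → ℝ} {K' : ℝ} {A : Op d} (hk : IsKernelOp A)
    (h : Transport K A) (h' : DualTransport K A) (hK : ∀ r ≤ R, K r ≤ K') (hK' : 0 ≤ K') :
    Good R 0 K' K' A := by
  refine ⟨hk, hK', hK', fun r hr f hf => ?_, fun r hr f hf => ?_,
    opBound_of_smooth hk hK' fun f hf x => ?_⟩
  · rw [zero_add] at hf hr ⊢
    obtain ⟨h1, h2⟩ := h r f hf
    exact ⟨h1, h2.trans (mul_le_mul_of_nonneg_right (hK r hr) (normInf_nonneg _ _))⟩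
  · rw [zero_add] at hf hr ⊢
    obtain ⟨g, h0, h1, h2⟩ := h' r f hf
    exact ⟨g, h0, h1, h2.trans (mul_le_mul_of_nonneg_right (hK r hr) (normOne_nonneg _ _))⟩
  · obtain ⟨-, h2⟩ := h 0 f (hf.of_le le_top)
    rw [normInf_zero, normInf_zero] at h2
    exact (abs_le_supNorm (A f) x).trans (h2.trans
      (mul_le_mul_of_nonneg_right (hK 0 (Nat.zero_le _)) (supNorm_nonneg _)))

theorem Good.of_shortTime {d R β : ℕ} {K : ℕ → ℝ} {K' α δ : ℝ} {A B : Op d}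
    (hA : Good R 0 K' K' A) (hB : Good R 0 K' K' B) (h : ShortTime K α β δ A B)
    (h' : DualShortTime K α β δ A B) (hK : ∀ r ≤ R, K r ≤ K') (hδ : 0 ≤ δ) :
    Good R β (K' * δ ^ (α + 1)) (2 * K') (A - B) := by
  have hK' := hA.c_nonneg
  have hδ' : 0 ≤ δ ^ (α + 1) := Real.rpow_nonneg hδ _
  refine ⟨hA.kernel.sub hB.kernel, by positivity, by positivity, fun r hr f hf => ?_,
    fun r hr f hf => ?_, (hA.op.sub hB.op).mono (by linarith)⟩
  · have hf' : IsCb ((0 + r : ℕ) : ℕ∞) f.1 := hf.of_le (by exact_mod_cast by omega)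
    have e : ((A - B) f).1 = (A f).1 + (-1 : ℝ) • (B f).1 := by
      funext x
      change (A f).1 x - (B f).1 x = (A f).1 x + -1 * (B f).1 x
      ring
    refine ⟨?_, (h r f hf).trans ?_⟩
    · rw [e]
      exact (hA.smooth r (by omega) f hf').1.add_smul _ (hB.smooth r (by omega) f hf').1
    · rw [mul_right_comm]
      exact mul_le_mul_of_nonneg_right (mul_le_mul_of_nonneg_right (hK r (by omega)) hδ')
        (normInf_nonneg _ _)
  · obtain ⟨g₁, g₂, h1, h2, h3, h4, h5⟩ := h' r f hf
    have e : g₁ - g₂ = g₁ + (-1 : ℝ) • g₂ := by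
      funext x; simp [sub_eq_add_neg]
    refine ⟨g₁ - g₂, fun u => ?_, ?_, h5.trans ?_⟩
    · have e1 : ∀ x, ((A - B) u).1 x * f x = (A u).1 x * f x - (B u).1 x * f x := fun x =>
        sub_mul ((A u).1 x) ((B u).1 x) (f x)
      have e2 : ∀ x, u.1 x * (g₁ - g₂) x = u.1 x * g₁ x - u.1 x * g₂ x := fun x =>
        mul_sub (u.1 x) (g₁ x) (g₂ x)
      simp_rw [e1, e2]
      rw [integral_sub (integrable_Mb_mul _ hf.integrable) (integrable_Mb_mul _ hf.integrable),
        integral_sub (integrable_Mb_mul _ h3.integrable) (integrable_Mb_mul _ h4.integrable),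
        h1 u, h2 u]
    · rw [e]; exact h3.add_smul _ h4
    · rw [mul_right_comm]
      exact mul_le_mul_of_nonneg_right (mul_le_mul_of_nonneg_right (hK r (by omega)) hδ')
        (normOne_nonneg _ _)

/-- A bound of `K_r`, `r ≤ R`. -/
noncomputable def maxConst (K : ℕ → ℝ) (R : ℕ) : ℝ := 1 + ∑ r ∈ range (R + 1), |K r|

theorem one_le_maxConst (K : ℕ → ℝ) (R : ℕ) : 1 ≤ maxConst K R :=
  le_add_of_nonneg_right (sum_nonneg fun _ _ => abs_nonneg _)

theorem le_maxConst (K : ℕ → ℝ) {R r : ℕ} (hr : r ≤ R) : K r ≤ maxConst K R := by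
  have : |K r| ≤ ∑ r ∈ range (R + 1), |K r| :=
    single_le_sum (f := fun r => |K r|) (fun _ _ => abs_nonneg _) (mem_range.2 (by omega))
  unfold maxConst
  linarith [le_abs_self (K r)]

theorem Scheme.of_assumptions {d β L : ℕ} {K : ℕ → ℝ} {α T : ℝ} {n : ℕ} {P : ℝ → ℝ → Op d}
    {Q : ℕ → ℝ → ℝ → Op d} (R : ℕ) (hT : 0 < T) (hn : 0 < n)
    (hP : IsSemigroupOn (Set.Icc 0 T) P)
    (hQ : ∀ l : ℕ, IsSemigroupOn (grid (step T n l) T) (Q l))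
    (hPt : ∀ s t : ℝ, 0 ≤ s → s ≤ t → t ≤ T → Transport K (P s t))
    (hQt : ∀ l : ℕ, ∀ s ∈ grid (step T n l) T, ∀ t ∈ grid (step T n l) T, s ≤ t →
        Transport K (Q l s t))
    (hPd : ∀ s t : ℝ, 0 ≤ s → s ≤ t → t ≤ T → DualTransport K (P s t))
    (hQd : ∀ l : ℕ, ∀ s ∈ grid (step T n l) T, ∀ t ∈ grid (step T n l) T, s ≤ t →
        DualTransport K (Q l s t))
    (hs : ∀ l : ℕ, 1 ≤ l → l ≤ L → ∀ t ∈ grid (step T n l) T, t + step T n l ≤ T →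
        ShortTime K α β (step T n l) (P t (t + step T n l)) (Q l t (t + step T n l)))
    (hsd : ∀ l : ℕ, 1 ≤ l → l ≤ L → ∀ t ∈ grid (step T n l) T, t + step T n l ≤ T →
        DualShortTime K α β (step T n l) (P t (t + step T n l)) (Q l t (t + step T n l))) :
    Scheme α R β L (maxConst K R) T n P Q := by
  have h0 : 0 ≤ maxConst K R := zero_le_one.trans (one_le_maxConst K R)
  have hgP : ∀ s t : ℝ, 0 ≤ s → s ≤ t → t ≤ T → Good R 0 (maxConst K R) (maxConst K R) (P s t) :=
    fun s t h1 h2 h3 => Good.of_transport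
      (hP.kernel s ⟨h1, h2.trans h3⟩ t ⟨h1.trans h2, h3⟩ h2) (hPt s t h1 h2 h3) (hPd s t h1 h2 h3)
      (fun _ hr => le_maxConst K hr) h0
  have hgQ : ∀ l : ℕ, ∀ s ∈ grid (step T n l) T, ∀ t ∈ grid (step T n l) T, s ≤ t →
      Good R 0 (maxConst K R) (maxConst K R) (Q l s t) := fun l s h1 t h2 h3 =>
    Good.of_transport ((hQ l).kernel s h1 t h2 h3) (hQt l s h1 t h2 h3) (hQd l s h1 t h2 h3)
      (fun _ hr => le_maxConst K hr) h0
  refine ⟨hT, hn, hP, hQ, hgP, hgQ, fun l h1 h2 t ht htT => ?_⟩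
  have hδ := step_pos hT hn l
  have ht' : t + step T n l ∈ grid (step T n l) T := by
    refine ⟨?_, htT⟩
    obtain ⟨⟨k, rfl⟩, -⟩ := ht
    exact ⟨k + 1, by push_cast; ring⟩
  exact Good.of_shortTime (hgP _ _ (grid_nonneg hT hn ht) (by linarith) htT)
    (hgQ l _ ht _ ht' (by linarith)) (hs l h1 h2 t ht htT) (hsd l h1 h2 t ht htT)
    (fun _ hr => le_maxConst K hr) hδ.le

theorem Regularizing.smoothing {d q : ℕ} {S : Set ℝ} {c η : ℝ} {A : ℝ → ℝ → Op d}
    (h : Regularizing S c q η A) {s t : ℝ} (hs : s ∈ S) (ht : t ∈ S) (hst : s < t) :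
    Smoothing q (|c| / (t - s) ^ η) (A s t) := fun r γ hr f hf => by
  obtain ⟨h1, h2⟩ := h s hs t ht hst r γ hr f hf
  refine ⟨h1, h2.trans (mul_le_mul_of_nonneg_right ?_ (supNorm_nonneg _))⟩
  exact div_le_div_of_nonneg_right (le_abs_self c) (Real.rpow_nonneg (by linarith) _)

/-- Each of the N pieces has w steps, hence time length wδ: this is the length at which the
modification and its distance to the semigroup are evaluated. -/
theorem longRegularizing_of_modification {d R n w N g : ℕ} {K c η δ ρ T : ℝ}
    {A Abar : ℝ → ℝ → Op d} (hK : 0 ≤ K) (hδ : 0 < δ) (hT : n * δ ≤ T) (hw : 1 ≤ w)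
    (hN : N * w ≤ g) (hA : ∀ a b, a ≤ b → b ≤ n → Good R 0 K K (onGrid A 0 δ a b))
    (hcomp : ∀ a b c, a ≤ b → b ≤ c → c ≤ n →
      onGrid A 0 δ a b * onGrid A 0 δ b c = onGrid A 0 δ a c)
    (hk : ∀ s ∈ grid δ T, ∀ t ∈ grid δ T, s < t → IsKernelOp (Abar s t))
    (hreg : Regularizing (grid δ T) c R η Abar) (hρ0 : 0 ≤ ρ)
    (hρ : ∀ s ∈ grid δ T, ∀ t ∈ grid δ T, s < t → OpBound (ρ / (t - s) ^ η) (A s t - Abar s t)) :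
    LongRegularizing R n g
      (N * (multiIdx d R).card * K * (1 + K + |c| / (w * δ) ^ η) ^ N * (|c| / (w * δ) ^ η))
      (K * (ρ / (w * δ) ^ η) ^ N) (onGrid A 0 δ) := by
  intro a b hab hb W r e bW hW
  have hwδ : 0 < (w : ℝ) * δ := mul_pos (by exact_mod_cast hw) hδ
  refine regularized_mul_of_split (w := w) hK (by positivity) (by positivity) hA hcomp (fun a ha => ?_) N
    (by omega) hb hW
  have hmem : ∀ a ≤ n, 0 + (a : ℝ) * δ ∈ grid δ T := fun a ha => by
    refine ⟨⟨a, by ring⟩, ?_⟩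
    have : (a : ℝ) * δ ≤ n * δ := mul_le_mul_of_nonneg_right (by exact_mod_cast ha) hδ.le
    linarith
  have h1 := hmem a (by omega)
  have h2 := hmem (a + w) ha
  have hlt : 0 + (a : ℝ) * δ < 0 + ((a + w : ℕ) : ℝ) * δ := by push_cast; linarith
  have hsub : 0 + ((a + w : ℕ) : ℝ) * δ - (0 + (a : ℝ) * δ) = w * δ := by push_cast; ring
  refine ⟨Abar (0 + (a : ℝ) * δ) (0 + ((a + w : ℕ) : ℝ) * δ), hk _ h1 _ h2 hlt, ?_, ?_⟩
  · rw [← hsub]; exact hreg.smoothing h1 h2 hlt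
  · rw [← hsub]; exact hρ _ h1 _ h2 hlt

/-! ### The error in total variation -/

theorem mul_max_le_qReg {α : ℝ} (hα : 0 < α) (β : ℕ) (ν : ℝ) (i : Fin (mOrd α 0 ν - 1)) :
    ((i : ℕ) + 1) * max β (kappa α hα β (0 + 1) (qOrd α 0 ν (i + 1))) ≤ qReg α hα β ν := by
  have := Finset.le_sup (f := fun i : ℕ => i * max β (kappa α hα β 1 (qOrd α 0 ν i)))
    (show (i : ℕ) + 1 ∈ Finset.Icc 1 (mOrd α 0 ν) by rw [Finset.mem_Icc]; omega)
  unfold qReg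
  exact this

theorem mOrd_mul_le_qReg {α : ℝ} (hα : 0 < α) (β : ℕ) {ν : ℝ} (hν : 0 < ν) :
    mOrd α 0 ν * β ≤ qReg α hα β ν := by
  have := Finset.le_sup (f := fun i : ℕ => i * max β (kappa α hα β 1 (qOrd α 0 ν i)))
    (show mOrd α 0 ν ∈ Finset.Icc 1 (mOrd α 0 ν) by
      rw [Finset.mem_Icc]; exact ⟨mOrd_pos hα 0 hν, le_rfl⟩)
  unfold qReg
  exact le_trans (Nat.mul_le_mul_left _ (le_max_left _ _)) this

/-- The gap is either between two jumps, where A itself is regularized, or after the last jump,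
where the closing semigroup factor regularizes and A serves as the left operator. -/
theorem opBound_chain_mul {d R κ n g i : ℕ} {K e b M σ : ℝ} {q : ℕ → ℕ → Op d} {A : Op d}
    {u : Fin (i + 1) → Fin (n + 1)} (hK : 1 ≤ K) (hM : 0 ≤ M) (hσ : 0 ≤ σ)
    (hq : ∀ a b, a ≤ b → b ≤ n → Good R 0 K K (q a b)) (hlong : LongRegularizing R n g M σ q)
    (hg : (i + 1) * g ≤ n) (hu : u ∈ chains n i) (hR : i * κ ≤ R) (hA : Good R (i * κ) e b A)
    (hreg : (∃ j : Fin i, (u j.castSucc : ℕ) + g ≤ (u j.succ : ℕ) - 1) →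
      Regularized R M σ (i * κ) e b A) :
    OpBound (e * K * M + b * K * σ) (A * q (u (Fin.last i)) n) := by
  have hun : (u (Fin.last i) : ℕ) ≤ n := by omega
  have he := hA.c_nonneg
  have hb := hA.b_nonneg
  rcases exists_gap hg (fun j => (u j : ℕ)) (by rw [(mem_chains.1 hu).1]; rfl)
    (fun a b hab => (mem_chains.1 hu).2 hab) with h | h
  · exact ((hreg h).mul (hq _ _ hun le_rfl)).opBound (by omega)
  · refine ((hlong _ _ h le_rfl _ _ _ _ (hA.smoothBound hR)).opBound hR).mono ?_
    have h1 : e ≤ e * K := le_mul_of_one_le_right he hK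
    have h2 : b ≤ b * K := le_mul_of_one_le_right hb hK
    gcongr

/-- The first bound grows with n and serves when n ≤ m(0,ν), where the guaranteed gap is empty. In
the second, M multiplies the small smooth estimates and σ the non-small estimates on bounded
functions. The exponents are chosen before d, β and K. -/
theorem opBound_sub_Qhat {α : ℝ} (hα : 0 < α) {ν : ℝ} (hν : 0 < ν) :
    ∃ p k : ℕ, ∀ (d β L : ℕ) (K : ℝ), 1 ≤ K → ν ≤ α * L → ∃ C : ℝ, 1 ≤ C ∧
      ∀ (T : ℝ) (n : ℕ) (P : ℝ → ℝ → Op d) (Q : ℕ → ℝ → ℝ → Op d),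
        Scheme α (qReg α hα β ν) β L K T n P Q →
        OpBound (C * (n : ℝ) ^ k) (P 0 T - Qhat α hα T n Q 0 ν 0) ∧
        ∀ (M σ : ℝ), 0 ≤ M → 0 ≤ σ →
          LongRegularizing (qReg α hα β ν) n (n / (mOrd α 0 ν + 1)) M σ
            (onGrid (Q 1) 0 (step T n 1)) →
          LongRegularizing (qReg α hα β ν) n (n / (mOrd α 0 ν + 1)) M σ
            (onGrid P 0 (step T n 1)) →
          OpBound (C * ((1 + T) ^ p * (n : ℝ) ^ (-ν) * M + (n : ℝ) ^ k * σ))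
            (P 0 T - Qhat α hα T n Q 0 ν 0) := by
  have hfb := factorBounds hα 0 ν (by simpa using hν)
  obtain ⟨p₁, k₁, hsm⟩ := smoothError_of_factorBounds hα hν hfb
  obtain ⟨p, k, hfb⟩ := hfb
  refine ⟨p, k + k₁, fun d β L K hK hL => ?_⟩
  obtain ⟨C, hC, hfb⟩ := hfb d (qReg α hα β ν) β L K hK (by simpa using hL)
  obtain ⟨C₁, hC₁, hsm⟩ := hsm d (qReg α hα β ν) β L K hK (by simpa using hL)
  set m := mOrd α 0 ν with hm
  have hm1 : 1 ≤ m := mOrd_pos hα 0 hν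
  have hm1' : (1 : ℝ) ≤ m := by exact_mod_cast hm1
  -- m C covers the m - 1 jump numbers and the remainder; C₁ covers the crude bound.
  refine ⟨m * C + C₁, by nlinarith, fun T n P Q hS => ?_⟩
  have hT := hS.T_pos
  have hn : (1 : ℝ) ≤ n := by exact_mod_cast hS.n_pos
  have h0 : (0 : ℝ) ∈ grid (step T n 0) T := ⟨⟨0, by simp⟩, hT.le⟩
  have hstep : 0 + step T n 0 = T := by simp [step]
  have hpow : ∀ {a b : ℕ}, a ≤ b → (n : ℝ) ^ a ≤ (n : ℝ) ^ b := fun h => pow_le_pow_right₀ hn h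
  refine ⟨?_, fun M σ hM hσ hlQ hlP => ?_⟩
  · have := (hsm T n P Q hS 0 h0 hstep.le).op
    rw [hstep] at this
    refine this.mono ?_
    have h1 : (n : ℝ) ^ k₁ ≤ (n : ℝ) ^ (k + k₁) := hpow (by omega)
    have h2 : C₁ ≤ m * C + C₁ := by nlinarith
    exact mul_le_mul h2 h1 (by positivity) (by nlinarith)
  obtain ⟨h1, c, b, h2, h3, h4⟩ := hfb T n P Q hS 0 h0 hstep.le
  have heq := hS.sub_Qhat_eq hα ν (mOrd_pos hα 0 hν) h0 hstep.le
  rw [hstep] at heq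
  rw [heq]
  have hq := hS.good_onGrid_Q h0 hstep.le
  have hp := hS.good_onGrid_P h0 hstep.le
  have hchain : ∀ {i : ℕ} {u : Fin (i + 1) → Fin (n + 1)}, u ∈ chains n i →
      StrictMono (fun j => (u j : ℕ)) ∧ (u (Fin.last i) : ℕ) ≤ n := fun hu =>
    ⟨fun a b hab => (mem_chains.1 hu).2 hab, by omega⟩
  have hgap : ∀ i ≤ m, (i + 1) * (n / (m + 1)) ≤ n := fun i hi =>
    (Nat.mul_le_mul_right _ (by omega)).trans (Nat.mul_div_le n (m + 1))
  have hterm : ∀ x y : ℝ, ∀ N : ℕ, N * x ≤ C * (1 + T) ^ p * (n : ℝ) ^ (-ν) → N * y ≤ C * (n : ℝ) ^ k →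
      N * (x * M + y * σ) ≤ C * ((1 + T) ^ p * (n : ℝ) ^ (-ν) * M + (n : ℝ) ^ k * σ) := by
    intro x y N hx hy
    have e1 := mul_le_mul_of_nonneg_right hx hM
    have e2 := mul_le_mul_of_nonneg_right hy hσ
    calc (N : ℝ) * (x * M + y * σ) = N * x * M + N * y * σ := by ring
      _ ≤ C * (1 + T) ^ p * (n : ℝ) ^ (-ν) * M + C * (n : ℝ) ^ k * σ := add_le_add e1 e2
      _ = _ := by ring
  have hmain := OpBound.sum Finset.univ fun (i : Fin (m - 1)) _ => by
    obtain ⟨c, b, e, g1, g2, g3, g4, g5⟩ := h1 i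
    have him : (i : ℕ) + 1 ≤ m := by have := i.2; omega
    have hR := mul_max_le_qReg hα β ν i
    have := OpBound.sum (chains n ((i : ℕ) + 1)) fun u hu =>
      opBound_chain_mul hK hM hσ hq hlQ (hgap _ him) hu hR
        (Good.chainProd_sub hq g1 g2 g3 (hchain hu).1 (hchain hu).2)
        (Regularized.chainProd_sub hK hM hσ hq hlQ g1 g2 g3 _ _ (hchain hu).1 (hchain hu).2 hR)
    rw [sum_const, nsmul_eq_mul] at this
    exact this.mono (hterm _ _ _ g4 g5)
  have hRm := mOrd_mul_le_qReg hα β hν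
  -- The remainder is closed by P, so a gap after the last jump needs the regularization of P
  -- instead of that of Q.
  have hrem := OpBound.sum (chains n m) fun u hu => by
    have hun : (u (Fin.last m) : ℕ) ≤ n := by omega
    have hcp := Good.chainProd hq h2 (hchain hu).1 (hchain hu).2
    have he := hcp.c_nonneg
    have hb := hcp.b_nonneg
    rcases exists_gap (hgap m le_rfl) (fun j => (u j : ℕ)) (by rw [(mem_chains.1 hu).1]; rfl)
      (hchain hu).1 with h | h
    · exact ((Regularized.chainProd hK hM hσ hq hlQ h2 _ _ (hchain hu).1 (hchain hu).2 hRm h).mul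
        (hp _ _ hun le_rfl)).opBound (by omega)
    · refine ((hlP _ _ h le_rfl _ _ _ _ (hcp.smoothBound hRm)).opBound hRm).mono ?_
      have h1 := le_mul_of_one_le_right he hK
      have h2 := le_mul_of_one_le_right hb hK
      gcongr
  rw [sum_const, nsmul_eq_mul] at hrem
  rw [sum_const, card_univ, Fintype.card_fin, nsmul_eq_mul] at hmain
  refine (hmain.add (hrem.mono (hterm _ _ _ h3 h4))).mono ?_
  have hTp : 0 ≤ (1 + T) ^ p * (n : ℝ) ^ (-ν) * M := by positivity
  have hnk : (n : ℝ) ^ k * σ ≤ (n : ℝ) ^ (k + k₁) * σ :=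
    mul_le_mul_of_nonneg_right (hpow (by omega)) hσ
  have hcast : ((m - 1 : ℕ) : ℝ) = m - 1 := by rw [Nat.cast_sub hm1]; simp
  rw [hcast]
  have hnk0 : 0 ≤ (n : ℝ) ^ k * σ := by positivity
  calc ((m : ℝ) - 1) * (C * ((1 + T) ^ p * (n : ℝ) ^ (-ν) * M + (n : ℝ) ^ k * σ))
        + C * ((1 + T) ^ p * (n : ℝ) ^ (-ν) * M + (n : ℝ) ^ k * σ)
      = m * C * ((1 + T) ^ p * (n : ℝ) ^ (-ν) * M + (n : ℝ) ^ k * σ) := by ring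
    _ ≤ (m * C + C₁) * ((1 + T) ^ p * (n : ℝ) ^ (-ν) * M + (n : ℝ) ^ (k + k₁) * σ) := by
        have : m * C ≤ m * C + C₁ := by linarith
        gcongr

/-! ### The time `T(ν)` -/

/-- The constraint on the k-th grid point reads n ≤ k(m+1) + m, whose least solution is ⌊n/(m+1)⌋:
T(ν) is the gap that every chain leaves. -/
theorem Tnu_eq {α T ν : ℝ} {n : ℕ} (hT : 0 < T) (hn : 0 < n) :
    Tnu α T n ν = ((n / (mOrd α 0 ν + 1) : ℕ) : ℝ) * step T n 1 := by
  set m := mOrd α 0 ν with hm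
  have hn' : (0 : ℝ) < n := by exact_mod_cast hn
  have hm' : (0 : ℝ) < (m : ℝ) + 1 := by positivity
  have hiff : ∀ k : ℕ, T * ((n : ℝ) - m) / (n * ((m : ℝ) + 1)) ≤ k * step T n 1 ↔
      n ≤ k * (m + 1) + m := by
    intro k
    unfold step
    rw [pow_one, div_le_iff₀ (by positivity)]
    have e : (k : ℝ) * (T / n) * (n * ((m : ℝ) + 1)) = T * (k * (m + 1)) := by field_simp
    rw [e, mul_le_mul_iff_right₀ hT, sub_le_iff_le_add]
    exact_mod_cast Iff.rfl
  refine IsLeast.csInf_eq ⟨⟨⟨_, rfl⟩, (hiff _).2 ?_⟩, ?_⟩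
  · have h1 := Nat.div_add_mod n (m + 1)
    have h2 := Nat.mod_lt n (show 0 < m + 1 by omega)
    rw [mul_comm]
    omega
  · rintro _ ⟨⟨k, rfl⟩, hk⟩
    have h1 := (hiff k).1 hk
    have h2 : n / (m + 1) ≤ k := by
      rw [← Nat.lt_succ_iff, Nat.div_lt_iff_lt_mul (by omega), Nat.succ_mul]
      omega
    exact mul_le_mul_of_nonneg_right (by exact_mod_cast h2) (step_pos hT hn 1).le

theorem one_add_rpow_pow_le {T a b : ℝ} (hT : 0 < T) (N : ℕ) (ha : 0 ≤ a) (hab : a * N ≤ b) :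
    (1 + T ^ a) ^ N ≤ 2 ^ N * (1 + T ^ b) := by
  have hb : 0 ≤ b := le_trans (by positivity) hab
  have hTb : 0 ≤ T ^ b := Real.rpow_nonneg hT.le _
  rcases le_total T 1 with h | h
  · have h1 : T ^ a ≤ 1 := Real.rpow_le_one hT.le h ha
    calc (1 + T ^ a) ^ N ≤ 2 ^ N := pow_le_pow_left₀ (by positivity) (by linarith) N
      _ ≤ 2 ^ N * (1 + T ^ b) := le_mul_of_one_le_right (by positivity) (by linarith)
  · have h1 : 1 ≤ T ^ a := Real.one_le_rpow h ha
    calc (1 + T ^ a) ^ N ≤ (2 * T ^ a) ^ N := pow_le_pow_left₀ (by positivity) (by linarith) N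
      _ = 2 ^ N * T ^ (a * N) := by rw [mul_pow, Real.rpow_mul_natCast hT.le]
      _ ≤ 2 ^ N * (1 + T ^ b) := by
          have := Real.rpow_le_rpow_of_exponent_le h hab
          gcongr
          linarith

/-! ### The contribution of the regularizing intervals -/

set_option maxHeartbeats 1000000 in
/-- Bounds of the constants of `longRegularizing_of_modification`, for `n > m` and intervals
of length `τ = ⌊n / (m + 1)⌋ δ`: the loss `n ^ k` is compensated by splitting into `k + 1` pieces. -/
theorem exists_split {m k : ℕ} (hm : 1 ≤ m) {ν η K c T₀ S : ℝ} (hν : 0 < ν) (hη : 0 ≤ η) (hK : 1 ≤ K)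
    (hT₀ : 0 < T₀) (hS : 0 ≤ S) : ∃ C : ℝ, 0 ≤ C ∧ ∀ (T H : ℝ) (n : ℕ), T₀ ≤ T → 1 ≤ H → m < n →
      ∃ N w : ℕ, 1 ≤ w ∧ N * w ≤ n / (m + 1) ∧
        N * S * K * (1 + K + |c| / (w * (T / n)) ^ η) ^ N * (|c| / (w * (T / n)) ^ η)
            * (((n / (m + 1) : ℕ) : ℝ) * (T / n)) ^ η ≤ C ∧
        (n : ℝ) ^ k * (K * (|c| * H / (n : ℝ) ^ (ν + m) / (w * (T / n)) ^ η) ^ N)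
            * (((n / (m + 1) : ℕ) : ℝ) * (T / n)) ^ η ≤ C * H ^ (k + 1) * (n : ℝ) ^ (-ν) := by
  -- A lower bound of τ, uniform in n > m and T ≥ T₀. It absorbs all the powers of τ^{-η} except the
  -- single one allowed in the conclusion.
  set τ₀ : ℝ := T₀ / (2 * (m + 1)) with hτ₀
  have hτ₀0 : 0 < τ₀ := by positivity
  set A : ℝ := (2 * ((k : ℝ) + 1)) ^ η with hA
  have hA0 : 0 < A := by positivity
  set A₀ : ℝ := A / τ₀ ^ η with hA₀
  have hA₀0 : 0 < A₀ := by positivity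
  set b : ℝ := 1 + |c| * (A + A₀) with hb
  have hc0 := abs_nonneg c
  have hb1 : 1 ≤ b := le_add_of_nonneg_right (by positivity)
  refine ⟨max ((k + 1) * S * K * (1 + K + |c| * A₀) ^ (k + 1) * (|c| * A))
    (K * (((k : ℝ) + 1) * (m + 1)) ^ k * b ^ (k + 1)), le_max_of_le_right (by positivity),
    fun T H n hT hH hn => ?_⟩
  have hT0 : 0 < T := by linarith
  have hn0 : 0 < n := by omega
  have hnr : (0 : ℝ) < n := by exact_mod_cast hn0
  have hn1 : (1 : ℝ) ≤ n := by exact_mod_cast hn0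
  set g : ℕ := n / (m + 1) with hg
  have hg1 : 1 ≤ g := (Nat.one_le_div_iff (by omega)).2 (by omega)
  have hlt : n < (g + 1) * (m + 1) := by
    rw [← Nat.div_lt_iff_lt_mul (by omega)]; omega
  set δ : ℝ := T / n with hδ
  have hδ0 : 0 < δ := by positivity
  set τ : ℝ := (g : ℝ) * δ with hτ
  have hτ0 : 0 < τ := mul_pos (by exact_mod_cast hg1) hδ0
  have hττ : τ₀ ≤ τ := by
    have h1 : (n : ℝ) ≤ 2 * g * (m + 1) := by
      have : n ≤ 2 * g * (m + 1) := by nlinarith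
      exact_mod_cast this
    have h2 : τ₀ ≤ T / (2 * (m + 1)) := by rw [hτ₀]; gcongr
    refine h2.trans ?_
    rw [hτ, hδ, ← mul_div_assoc, div_le_div_iff₀ (by positivity) hnr]
    calc T * n ≤ T * (2 * g * (m + 1)) := by gcongr
      _ = g * T * (2 * (m + 1)) := by ring
  -- If the gap has fewer than k + 1 steps it cannot be cut into k + 1 pieces, but then n is bounded
  -- and one piece suffices.
  obtain ⟨N, hN1, hNk, hNg, hNcase⟩ : ∃ N : ℕ, 1 ≤ N ∧ N ≤ k + 1 ∧ N ≤ g ∧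
      (N = k + 1 ∨ (N = 1 ∧ n ≤ (k + 1) * (m + 1))) := by
    rcases le_or_gt (k + 1) g with h | h
    · exact ⟨k + 1, by omega, le_rfl, h, Or.inl rfl⟩
    · refine ⟨1, le_rfl, by omega, hg1, Or.inr ⟨rfl, hlt.le.trans ?_⟩⟩
      exact Nat.mul_le_mul_right _ (by omega)
  set w : ℕ := g / N with hw
  have hw1 : 1 ≤ w := (Nat.one_le_div_iff (by omega)).2 hNg
  have hNw : N * w ≤ g := Nat.mul_div_le g N
  refine ⟨N, w, hw1, hNw, ?_⟩
  have hwδ : 0 < (w : ℝ) * δ := mul_pos (by exact_mod_cast hw1) hδ0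
  -- The pieces have length comparable to the whole gap; the 2 pays for the rounding in w = ⌊g/N⌋.
  have hgw : (g : ℝ) ≤ 2 * ((k : ℝ) + 1) * w := by
    have h1 : g < (w + 1) * N := by rw [← Nat.div_lt_iff_lt_mul (by omega)]; omega
    have h2 : g ≤ 2 * (k + 1) * w := by
      calc g ≤ (w + 1) * N := h1.le
        _ ≤ (2 * w) * (k + 1) := Nat.mul_le_mul (by omega) hNk
        _ = 2 * (k + 1) * w := by ring
    exact_mod_cast h2
  have hτη : 0 < τ ^ η := by positivity
  have hinv : 1 / ((w : ℝ) * δ) ^ η ≤ A / τ ^ η := by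
    rw [div_le_div_iff₀ (by positivity) hτη, one_mul, hA, ← Real.mul_rpow (by positivity) hwδ.le]
    refine Real.rpow_le_rpow hτ0.le ?_ hη
    rw [hτ, ← mul_assoc]
    exact mul_le_mul_of_nonneg_right hgw hδ0.le
  have hinv₀ : 1 / ((w : ℝ) * δ) ^ η ≤ A₀ := by
    refine hinv.trans ?_
    rw [hA₀]
    have := Real.rpow_le_rpow hτ₀0.le hττ hη
    gcongr
  set y : ℝ := 1 / ((w : ℝ) * δ) ^ η with hy
  have hy0 : 0 < y := by positivity
  have hyτ : y * τ ^ η ≤ A := by rwa [le_div_iff₀ hτη] at hinv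
  have hdiv : ∀ x : ℝ, x / ((w : ℝ) * δ) ^ η = x * y := fun x => by rw [hy, mul_one_div]
  rw [hdiv, hdiv]
  constructor
  · refine le_trans ?_ (le_max_left _ _)
    have hNr : (N : ℝ) ≤ (k : ℝ) + 1 := by exact_mod_cast hNk
    have h1 : (1 + K + |c| * y) ^ N ≤ (1 + K + |c| * A₀) ^ (k + 1) := by
      have e1 : 1 + K + |c| * y ≤ 1 + K + |c| * A₀ := by gcongr
      have e2 : 1 ≤ 1 + K + |c| * A₀ := by nlinarith [mul_nonneg hc0 hA₀0.le]
      exact (pow_le_pow_left₀ (by positivity) e1 N).trans (pow_le_pow_right₀ e2 hNk)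
    calc (N : ℝ) * S * K * (1 + K + |c| * y) ^ N * (|c| * y) * τ ^ η
        = N * S * K * (1 + K + |c| * y) ^ N * (|c| * (y * τ ^ η)) := by ring
      _ ≤ _ := by gcongr
  · have hmax := le_max_right ((k + 1) * S * K * (1 + K + |c| * A₀) ^ (k + 1) * (|c| * A))
      (K * (((k : ℝ) + 1) * (m + 1)) ^ k * b ^ (k + 1))
    have hH0 : 0 ≤ H := by linarith
    refine le_trans ?_ (mul_le_mul_of_nonneg_right (mul_le_mul_of_nonneg_right hmax
      (by positivity)) (Real.rpow_nonneg hnr.le _))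
    set z : ℝ := (n : ℝ) ^ (-(ν + m)) with hz
    have hz0 : 0 < z := by positivity
    have hdivn : |c| * H / (n : ℝ) ^ (ν + m) = |c| * H * z := by
      rw [hz, Real.rpow_neg hnr.le, div_eq_mul_inv]
    rw [hdivn]
    have hbA : |c| * A ≤ b := by rw [hb]; nlinarith [mul_nonneg hc0 hA₀0.le]
    have hbA₀ : |c| * A₀ ≤ b := by rw [hb]; nlinarith [mul_nonneg hc0 hA0.le]
    -- One y is cancelled by τ^η; the j others are bounded through τ₀.
    have hstep : ∀ j : ℕ, (|c| * H * z * y) ^ (j + 1) * τ ^ η ≤ b ^ (j + 1) * H ^ (j + 1) * z ^ (j + 1) := by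
      intro j
      calc (|c| * H * z * y) ^ (j + 1) * τ ^ η
          = (|c| * y) ^ j * (|c| * (y * τ ^ η)) * H ^ (j + 1) * z ^ (j + 1) := by
            simp only [mul_pow, pow_succ]; ring
        _ ≤ b ^ j * b * H ^ (j + 1) * z ^ (j + 1) := by
            have e1 : |c| * y ≤ b := (mul_le_mul_of_nonneg_left hinv₀ hc0).trans hbA₀
            have e2 : |c| * (y * τ ^ η) ≤ b := (mul_le_mul_of_nonneg_left hyτ hc0).trans hbA
            gcongr
        _ = b ^ (j + 1) * H ^ (j + 1) * z ^ (j + 1) := by rw [pow_succ b]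
    have hmr : (1 : ℝ) ≤ m := by exact_mod_cast hm
    have hzν : z ≤ (n : ℝ) ^ (-ν) := Real.rpow_le_rpow_of_exponent_le hn1 (by linarith)
    have hX : 1 ≤ ((k : ℝ) + 1) * (m + 1) := by nlinarith [k.cast_nonneg (α := ℝ)]
    rcases hNcase with rfl | ⟨rfl, hnk⟩
    -- The exponent k - (k+1)(ν+m) is at most -ν because m ≥ 1: this is where k + 1 pieces beat n^k.
    · have hzk : (n : ℝ) ^ k * z ^ (k + 1) ≤ (n : ℝ) ^ (-ν) := by
        rw [hz, ← Real.rpow_natCast (n : ℝ) k, ← Real.rpow_mul_natCast hnr.le,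
          ← Real.rpow_add hnr]
        refine Real.rpow_le_rpow_of_exponent_le hn1 ?_
        push_cast
        have hk0 : (0 : ℝ) ≤ k := k.cast_nonneg
        nlinarith [mul_nonneg hk0 hν.le, mul_le_mul_of_nonneg_left hmr hk0]
      calc (n : ℝ) ^ k * (K * (|c| * H * z * y) ^ (k + 1)) * τ ^ η
          = (n : ℝ) ^ k * K * ((|c| * H * z * y) ^ (k + 1) * τ ^ η) := by ring
        _ ≤ (n : ℝ) ^ k * K * (b ^ (k + 1) * H ^ (k + 1) * z ^ (k + 1)) := by
            have := hstep k
            gcongr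
        _ = K * 1 * b ^ (k + 1) * H ^ (k + 1) * ((n : ℝ) ^ k * z ^ (k + 1)) := by ring
        _ ≤ K * (((k : ℝ) + 1) * (m + 1)) ^ k * b ^ (k + 1) * H ^ (k + 1) * (n : ℝ) ^ (-ν) := by
            have : (1 : ℝ) ≤ (((k : ℝ) + 1) * (m + 1)) ^ k := one_le_pow₀ hX
            gcongr
    · have hnk' : (n : ℝ) ≤ ((k : ℝ) + 1) * (m + 1) := by exact_mod_cast hnk
      have h1 := hstep 0
      have hpow : ∀ x : ℝ, 1 ≤ x → x ^ (0 + 1) ≤ x ^ (k + 1) := fun x hx =>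
        pow_le_pow_right₀ hx (by omega)
      calc (n : ℝ) ^ k * (K * (|c| * H * z * y) ^ 1) * τ ^ η
          = (n : ℝ) ^ k * K * ((|c| * H * z * y) ^ (0 + 1) * τ ^ η) := by ring
        _ ≤ (n : ℝ) ^ k * K * (b ^ (0 + 1) * H ^ (0 + 1) * z ^ (0 + 1)) := by gcongr
        _ = K * (n : ℝ) ^ k * b ^ (0 + 1) * H ^ (0 + 1) * z := by ring
        _ ≤ K * (((k : ℝ) + 1) * (m + 1)) ^ k * b ^ (k + 1) * H ^ (k + 1) * (n : ℝ) ^ (-ν) := by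
            have := hpow b hb1
            have := hpow H hH
            gcongr

end WeakApprox


theorem proposition2p1 (ν α pbar : ℝ) (hν : 0 < ν) (hα : 0 < α) (hpbar : 0 ≤ pbar) :
    ∃ p : ℝ, 0 ≤ p ∧
    ∀ (d β : ℕ) (η : ℝ) (K : ℕ → ℝ) (c T₀ : ℝ), 0 < d → 0 ≤ η → 0 < T₀ →
    ∃ C : ℝ, 0 < C ∧
    ∀ (T : ℝ) (n : ℕ) (P : ℝ → ℝ → Op d) (Q : ℕ → ℝ → ℝ → Op d) (Pbar Qbar : ℝ → ℝ → Op d),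
      T₀ ≤ T → 0 < n →
      -- semigroups
      IsSemigroupOn (Set.Icc 0 T) P →
      (∀ l : ℕ, IsSemigroupOn (grid (step T n l) T) (Q l)) →
      -- stability of the smooth functions
      (∀ s t : ℝ, 0 ≤ s → s ≤ t → t ≤ T → Transport K (P s t)) →
      (∀ l : ℕ, ∀ s ∈ grid (step T n l) T, ∀ t ∈ grid (step T n l) T, s ≤ t →
        Transport K (Q l s t)) →
      (∀ s t : ℝ, 0 ≤ s → s ≤ t → t ≤ T → DualTransport K (P s t)) →
      (∀ l : ℕ, ∀ s ∈ grid (step T n l) T, ∀ t ∈ grid (step T n l) T, s ≤ t →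
        DualTransport K (Q l s t)) →
      -- short time estimates
      (∀ l : ℕ, 1 ≤ l → l ≤ ⌈ν / α⌉₊ → ∀ t ∈ grid (step T n l) T, t + step T n l ≤ T →
        ShortTime K α β (step T n l) (P t (t + step T n l)) (Q l t (t + step T n l))) →
      (∀ l : ℕ, 1 ≤ l → l ≤ ⌈ν / α⌉₊ → ∀ t ∈ grid (step T n l) T, t + step T n l ≤ T →
        DualShortTime K α β (step T n l) (P t (t + step T n l)) (Q l t (t + step T n l))) →
      -- regularization property of the modifications
      (∀ s ∈ grid (step T n 1) T, ∀ t ∈ grid (step T n 1) T, s < t →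
        IsKernelOp (Qbar s t) ∧ IsKernelOp (Pbar s t)) →
      Regularizing (grid (step T n 1) T) c (qReg α hα β ν) η Qbar →
      Regularizing (grid (step T n 1) T) c (qReg α hα β ν) η Pbar →
      -- distance between the semigroups and their modifications
      (∀ s ∈ grid (step T n 1) T, ∀ t ∈ grid (step T n 1) T, s < t → ∀ f : Mb d,
        supNorm (Q 1 s t f - Qbar s t f : E d → ℝ) + supNorm (P s t f - Pbar s t f : E d → ℝ)
          ≤ c * (1 + T ^ pbar) / (n : ℝ) ^ (ν + (mOrd α 0 ν : ℝ)) / (t - s) ^ η *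
            supNorm (f : E d → ℝ)) →
      ∀ f : Mb d,
        supNorm (P 0 T f - Qhat α hα T n Q 0 ν 0 f : E d → ℝ) * (Tnu α T n ν) ^ η
          ≤ C * (1 + T ^ p) / (n : ℝ) ^ ν * supNorm (f : E d → ℝ) := by
  obtain ⟨p, k, hmain⟩ := opBound_sub_Qhat hα hν
  set m := mOrd α 0 ν with hm
  have hm1 : 1 ≤ m := mOrd_pos hα 0 hν
  -- p comes from the powers of the time step, and p̄ (k+1) from the k + 1 replacement errors.
  refine ⟨p + pbar * ((k + 1 : ℕ) : ℝ), by positivity, fun d β η K c T₀ _ hη hT₀ => ?_⟩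
  set R := qReg α hα β ν with hR
  have hK1 := one_le_maxConst K R
  obtain ⟨C₁, hC₁, hmain⟩ := hmain d β ⌈ν / α⌉₊ (maxConst K R) hK1 (by
    have := Nat.le_ceil (ν / α)
    rw [div_le_iff₀ hα] at this
    linarith)
  obtain ⟨C₂, hC₂, hsplit⟩ := exists_split (k := k) (c := c) (S := (multiIdx d R).card) hm1 hν hη hK1 hT₀
    (Nat.cast_nonneg _)
  -- The first summand is for n ≤ m, the second for n > m.
  refine ⟨C₁ * (m : ℝ) ^ k * (m : ℝ) ^ ν + C₁ * (2 ^ p * C₂ + C₂ * 2 ^ (k + 1)), by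
    have : (1 : ℝ) ≤ m := by exact_mod_cast hm1
    positivity, ?_⟩
  intro T n P Q Pbar Qbar hT hn hP hQ hPt hQt hPd hQd hs hsd hker hregQ hregP hdist f
  have hT0 : 0 < T := by linarith
  have hn1 : (1 : ℝ) ≤ n := by exact_mod_cast hn
  have hnr : (0 : ℝ) < n := by linarith
  have hmr : (1 : ℝ) ≤ m := by exact_mod_cast hm1
  have hf0 := supNorm_nonneg f.1
  have hS := Scheme.of_assumptions R hT0 hn hP hQ hPt hQt hPd hQd hs hsd
  obtain ⟨hcrude, hfine⟩ := hmain T n P Q hS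
  have hTp : 0 ≤ T ^ (p + pbar * ((k + 1 : ℕ) : ℝ)) := Real.rpow_nonneg hT0.le _
  set h : ℝ := 1 + T ^ (p + pbar * ((k + 1 : ℕ) : ℝ)) with hh
  have hh1 : 1 ≤ h := le_add_of_nonneg_right hTp
  have hnν : (n : ℝ) ^ (-ν) = 1 / (n : ℝ) ^ ν := by rw [Real.rpow_neg hnr.le, one_div]
  have hnν0 : 0 < (n : ℝ) ^ (-ν) := by positivity
  have hgoal : ∀ X : ℝ, X * h / (n : ℝ) ^ ν = X * h * (n : ℝ) ^ (-ν) := fun X => by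
    rw [hnν, mul_one_div]
  rw [hgoal, Tnu_eq hT0 hn]
  rcases le_or_gt n m with hnm | hnm
  · have hg : n / (mOrd α 0 ν + 1) = 0 := Nat.div_eq_of_lt (by omega)
    rw [hg, Nat.cast_zero, zero_mul]
    -- Here T(ν) = 0. If η = 0 the crude bound applies, n being at most m; if η > 0 the left side
    -- vanishes.
    rcases hη.eq_or_lt with rfl | hη0
    · rw [Real.rpow_zero, mul_one]
      refine (hcrude f).trans (mul_le_mul_of_nonneg_right ?_ hf0)
      have h1 : (n : ℝ) ^ k ≤ (m : ℝ) ^ k := by gcongr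
      have h2 : 1 ≤ (m : ℝ) ^ ν * (n : ℝ) ^ (-ν) := by
        rw [hnν, mul_one_div, one_le_div (by positivity)]
        exact Real.rpow_le_rpow hnr.le (by exact_mod_cast hnm) hν.le
      calc C₁ * (n : ℝ) ^ k ≤ C₁ * (m : ℝ) ^ k * 1 * 1 := by rw [mul_one, mul_one]; gcongr
        _ ≤ C₁ * (m : ℝ) ^ k * h * ((m : ℝ) ^ ν * (n : ℝ) ^ (-ν)) := by gcongr
        _ = C₁ * (m : ℝ) ^ k * (m : ℝ) ^ ν * h * (n : ℝ) ^ (-ν) := by ring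
        _ ≤ _ := by
          gcongr
          exact le_add_of_nonneg_right (by positivity)
    · rw [Real.zero_rpow hη0.ne', mul_zero]
      positivity
  have hTpb : 0 ≤ T ^ pbar := Real.rpow_nonneg hT0.le _
  obtain ⟨N, w, hw, hNw, hM, hσ⟩ := hsplit T (1 + T ^ pbar) n hT (le_add_of_nonneg_right hTpb) hnm
  have hstep : step T n 1 = T / n := by simp [step]
  have hnδ : (n : ℝ) * step T n 1 ≤ T := by rw [hstep]; field_simp; exact le_rfl
  have hδ := step_pos hT0 hn 1
  have h0 : (0 : ℝ) ∈ grid (step T n 0) T := ⟨⟨0, by simp⟩, hT0.le⟩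
  have h0T : 0 + step T n 0 ≤ T := by simp [step]
  have hρ0 : 0 ≤ |c| * (1 + T ^ pbar) / (n : ℝ) ^ (ν + (m : ℝ)) := by positivity
  have hρ : ∀ s ∈ grid (step T n 1) T, ∀ t ∈ grid (step T n 1) T, s < t →
      OpBound (|c| * (1 + T ^ pbar) / (n : ℝ) ^ (ν + (m : ℝ)) / (t - s) ^ η) (Q 1 s t - Qbar s t) ∧
      OpBound (|c| * (1 + T ^ pbar) / (n : ℝ) ^ (ν + (m : ℝ)) / (t - s) ^ η) (P s t - Pbar s t) := by
    intro s hs t ht hst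
    have hts : 0 ≤ (t - s) ^ η := Real.rpow_nonneg (by linarith) _
    have key : ∀ u : Mb d, c * (1 + T ^ pbar) / (n : ℝ) ^ (ν + (m : ℝ)) / (t - s) ^ η * supNorm u.1 ≤
        |c| * (1 + T ^ pbar) / (n : ℝ) ^ (ν + (m : ℝ)) / (t - s) ^ η * supNorm u.1 := fun u => by
      have := supNorm_nonneg u.1
      gcongr
      exact le_abs_self c
    refine ⟨fun u => ?_, fun u => ?_⟩
    · exact (le_add_of_nonneg_right (supNorm_nonneg _)).trans
        ((hdist s hs t ht hst u).trans (key u))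
    · exact (le_add_of_nonneg_left (supNorm_nonneg _)).trans
        ((hdist s hs t ht hst u).trans (key u))
  have hlQ := longRegularizing_of_modification (g := n / (m + 1)) (zero_le_one.trans hK1) hδ hnδ hw hNw
    (hS.good_onGrid_Q h0 h0T) (hS.comp_onGrid_Q h0 h0T)
    (fun s hs t ht hst => (hker s hs t ht hst).1) hregQ hρ0
    (fun s hs t ht hst => (hρ s hs t ht hst).1)
  have hlP := longRegularizing_of_modification (g := n / (m + 1)) (zero_le_one.trans hK1) hδ hnδ hw hNw
    (hS.good_onGrid_P h0 h0T) (hS.comp_onGrid_P h0 h0T)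
    (fun s hs t ht hst => (hker s hs t ht hst).2) hregP hρ0
    (fun s hs t ht hst => (hρ s hs t ht hst).2)
  have hwδ : 0 < (w : ℝ) * step T n 1 := mul_pos (by exact_mod_cast hw) hδ
  have hbound := hfine _ _ (by positivity) (by positivity) hlQ hlP f
  have hτ : 0 ≤ ((n / (m + 1) : ℕ) * step T n 1 : ℝ) ^ η :=
    Real.rpow_nonneg (mul_nonneg (Nat.cast_nonneg _) hδ.le) _
  rw [← hstep] at hM hσ
  refine (mul_le_mul_of_nonneg_right hbound hτ).trans ?_
  set M : ℝ := N * (multiIdx d R).card * maxConst K R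
    * (1 + maxConst K R + |c| / (w * step T n 1) ^ η) ^ N * (|c| / (w * step T n 1) ^ η) with hMdef
  set σ : ℝ := maxConst K R
    * (|c| * (1 + T ^ pbar) / (n : ℝ) ^ (ν + (m : ℝ)) / (w * step T n 1) ^ η) ^ N with hσdef
  set τη : ℝ := ((n / (m + 1) : ℕ) * step T n 1 : ℝ) ^ η with hτη
  have hΛ : (1 + T) ^ p ≤ 2 ^ p * h := by
    have := one_add_rpow_pow_le (a := 1) (b := p + pbar * ((k + 1 : ℕ) : ℝ)) hT0 p zero_le_one (by
      rw [one_mul]; exact le_add_of_nonneg_right (by positivity))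
    rwa [Real.rpow_one] at this
  have hH : (1 + T ^ pbar) ^ (k + 1) ≤ 2 ^ (k + 1) * h :=
    one_add_rpow_pow_le hT0 (k + 1) hpbar (le_add_of_nonneg_left (Nat.cast_nonneg _))
  calc C₁ * ((1 + T) ^ p * (n : ℝ) ^ (-ν) * M + (n : ℝ) ^ k * σ) * supNorm f.1 * τη
      = C₁ * ((1 + T) ^ p * (n : ℝ) ^ (-ν) * (M * τη) + (n : ℝ) ^ k * σ * τη) * supNorm f.1 := by
        ring
    _ ≤ C₁ * (2 ^ p * h * (n : ℝ) ^ (-ν) * C₂ + C₂ * (2 ^ (k + 1) * h) * (n : ℝ) ^ (-ν))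
          * supNorm f.1 := by
        have : C₂ * (1 + T ^ pbar) ^ (k + 1) * (n : ℝ) ^ (-ν)
          ≤ C₂ * (2 ^ (k + 1) * h) * (n : ℝ) ^ (-ν) := by gcongr
        have := hσ.trans this
        gcongr
    _ = C₁ * (2 ^ p * C₂ + C₂ * 2 ^ (k + 1)) * h * (n : ℝ) ^ (-ν) * supNorm f.1 := by ring
    _ ≤ _ := by
        gcongr
        exact le_add_of_nonneg_left (by positivity)
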